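/- **Proposition 3.1.** Let $n\ge 1$, $m\ge 2$. A multilinear Calderón–Zygmund kernel is a function $K:(\mathbb R^n)^{m+1}\setminus\Delta\to\mathbb C$, with $\Delta=\{x=y_1=\dots=y_m\}$, for which there are $C>0$ and a nondecreasing $\omega:[0,1)\to[0,\infty)$ with $\omega(0)=0$ and $\int_0^1\omega(t)\,\frac{dt}{t}<\infty$ such that, for all $(x,y_1,\dots,y_m)\notin\Delta$, $$|K(x,y_1,\dots,y_m)|\le \frac{C}{(\sum_i|x-y_i|)^{mn}},$$ and, for all $h\in\mathbb R^n$ with $|h|\le\frac12\max_i|x-y_i|$, $$|K(x+h,y_1,\dots,y_m)-K(x,y_1,\dots,y_m)|+\sum_{i=1}^m|K(x,y_1,\dots,y_i+h,\dots,y_m)-K(x,y_1,\dots,y_m)|\le\frac{C}{(\sum_i|x-y_i|)^{mn}}\,\omega\Big(\frac{|h|}{\sum_i|x-y_i|}\Big).$$ An $m$-linear Calderón–Zygmund operator is an $m$-linear operator $T$, initially defined on $C_c^\infty(\mathbb R^n)^m$ and with values in the measurable functions modulo null sets, such that (a) for some $q_1,\dots,q_m\in(1,\infty]$ and $q_0\in(0,\infty)$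 with $\frac1{q_0}=\sum_i\frac1{q_i}$ there is a constant $C$ with $\|T(f_1,\dots,f_m)\|_{q_0}\le C\prod_i\|f_i\|_{q_i}$ for all $f_i\in C_c^\infty(\mathbb R^n)$; and (b) for some multilinear Calderón–Zygmund kernel $K$ and all $f_i\in C_c^\infty(\mathbb R^n)$, for almost every $x\notin\bigcap_i\operatorname{supp}f_i$, $$T(f_1,\dots,f_m)(x)=\int_{\mathbb R^{mn}}K(x,y_1,\dots,y_m)\prod_{i=1}^m f_i(y_i)\,dy_1\cdots dy_m.$$ Let $T$ be such an operator. Let $0<q<p<\infty$ and $p_i\in(1,\infty)$ with $\frac1p=\sum_{i=1}^m\frac1{p_i}$, let $\frac1{p_1}+\frac1{p_1'}=1$, and let $\frac1r:=\frac1q-\frac1p<\frac1{p_1'}$. Let $b\in\dot L^r(\mathbb R^n)$, that is, $b:\mathbb R^n\to\mathbb C$ is measurable, locally in $L^r$, and $\inf_{c\in\mathbb C}\|b-c\|_r<\infty$. Let $V$ be the linear span of $\bigcup_{1<s<\infty}L^s(\mathbb R^n)$. Then $T$ has a unique extension to an $m$-linear operator on $V^m$, with values in the measurable functions modulo null sets,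 which for all $s_1,\dots,s_m\in(1,\infty)$ is bounded from $L^{s_1}\times\cdots\times L^{s_m}$ to $L^s$, where $\frac1s=\sum_i\frac1{s_i}$. Denote this extension again by $T$. For all $f_i\in L^{p_i}(\mathbb R^n)$ one has $bf_1\in V$, so that the commutator $$[b,T]_1(f_1,\dots,f_m):=b\,T(f_1,\dots,f_m)-T(bf_1,f_2,\dots,f_m)$$ is well defined, and $[b,T]_1$ is bounded from $L^{p_1}(\mathbb R^n)\times\cdots\times L^{p_m}(\mathbb R^n)$ to $L^q(\mathbb R^n)$: there is a constant $C$ with $\|[b,T]_1(f_1,\dots,f_m)\|_q\le C\prod_{i=1}^m\|f_i\|_{p_i}$ for all $f_i\in L^{p_i}(\mathbb R^n)$. -/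

import Mathlib

open MeasureTheory Set
open scoped ENNReal NNReal

noncomputable section

namespace MultilinearCZ

/-- Euclidean space `ℝⁿ`. -/
abbrev E (n : ℕ) : Type := EuclideanSpace ℝ (Fin n)

/-- Complex measurable functions on `ℝⁿ`, modulo equality Lebesgue-almost everywhere. -/
abbrev Fun (n : ℕ) : Type := E n →ₘ[(volume : Measure (E n))] ℂ

/-- `C_c^∞(ℝⁿ)`, with complex values. -/
abbrev Test (n : ℕ) : Type := TestFunction (⊤ : TopologicalSpace.Opens (E n)) ℂ ⊤

/-- A modulus of continuity `ω : [0,1) → [0,∞)`: nondecreasing, `ω(0) = 0`, and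
satisfying the Dini condition `∫₀¹ ω(t)/t dt < ∞`. -/
structure IsDiniModulus (ω : ℝ → ℝ) : Prop where
  nonneg : ∀ t ∈ Ico (0 : ℝ) 1, 0 ≤ ω t
  mono : MonotoneOn ω (Ico (0 : ℝ) 1)
  zero : ω 0 = 0
  dini : IntegrableOn (fun t => ω t / t) (Ioo (0 : ℝ) 1)

/-- `K` is an `m`-linear Calderón–Zygmund kernel on `ℝⁿ`. Only the values of `K` off the diagonal
`x = y₁ = ⋯ = y_m` are constrained. The hypothesis `∃ i, ‖h‖ ≤ ‖x - y i‖ / 2` says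
`|h| ≤ (1/2) max_i |x - y_i|`. -/
def IsCZKernel {n m : ℕ} (K : E n → (Fin m → E n) → ℂ) : Prop :=
  ∃ (C : ℝ) (ω : ℝ → ℝ), 0 < C ∧ IsDiniModulus ω ∧
    (∀ (x : E n) (y : Fin m → E n), (∃ i, y i ≠ x) →
      ‖K x y‖ ≤ C / (∑ i, ‖x - y i‖) ^ (m * n)) ∧
    (∀ (x : E n) (y : Fin m → E n) (h : E n), (∃ i, y i ≠ x) →
      (∃ i, ‖h‖ ≤ ‖x - y i‖ / 2) →
      ‖K (x + h) y - K x y‖ + ∑ i, ‖K x (Function.update y i (y i + h)) - K x y‖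
        ≤ C / (∑ i, ‖x - y i‖) ^ (m * n) * ω (‖h‖ / ∑ i, ‖x - y i‖))

/-- `T` is an `m`-linear Calderón–Zygmund operator: an `m`-linear operator, initially defined on
`C_c^∞(ℝⁿ)^m`, which is bounded there with respect to the norms of
`L^{q₁} × ⋯ × L^{q_m} → L^q` for some exponents `q_i ∈ (1,∞]` and `q ∈ (0,∞)` with
`1/q = ∑ 1/q_i`, and which is given off `⋂ supp f_i` by a Calderón–Zygmund kernel. -/
def IsCZOperator {n m : ℕ} (T : MultilinearMap ℂ (fun _ : Fin m => Test n) (Fun n)) : Prop :=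
  (∃ (q : Fin m → ℝ≥0∞) (q₀ : ℝ≥0∞), (∀ i, 1 < q i) ∧ 0 < q₀ ∧ q₀ < ∞ ∧
    q₀⁻¹ = ∑ i, (q i)⁻¹ ∧
    ∃ C : ℝ≥0, ∀ f : Fin m → Test n,
      eLpNorm (T f) q₀ volume ≤ C * ∏ i, eLpNorm (f i) (q i) volume) ∧
  ∃ K : E n → (Fin m → E n) → ℂ, IsCZKernel K ∧
    ∀ f : Fin m → Test n, ∀ᵐ x : E n, x ∉ ⋂ i, tsupport (f i) →
      T f x = ∫ y : Fin m → E n, K x y * ∏ i, f i (y i)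

/-- The sum (linear span) of all the spaces `L^s(ℝⁿ)`, `1 < s < ∞`. -/
def LpSum (n : ℕ) : Submodule ℂ (Fun n) :=
  ⨆ s ∈ Ioo (1 : ℝ≥0∞) ∞, Lp.LpSubmodule ℂ ℂ s volume

/-- A test function, seen as an element of `LpSum n`. -/
def ofTest {n : ℕ} (f : Test n) : LpSum n :=
  ⟨AEEqFun.mk f f.continuous.aestronglyMeasurable, by
    refine Submodule.mem_iSup_of_mem 2 (Submodule.mem_iSup_of_mem ⟨by norm_num, by norm_num⟩ ?_)
    have h : MemLp f 2 (volume : Measure (E n)) :=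
      f.continuous.memLp_of_hasCompactSupport f.hasCompactSupport
    exact (h.toLp f).2⟩

/-- The `m`-linear operator `S` is bounded from `L^{s₁} × ⋯ × L^{s_m}` to `L^s`. -/
def IsBoundedOn {n m : ℕ} (S : MultilinearMap ℂ (fun _ : Fin m => LpSum n) (Fun n))
    (s : Fin m → ℝ≥0∞) (s₀ : ℝ≥0∞) : Prop :=
  ∃ C : ℝ≥0, ∀ f : Fin m → LpSum n, (∀ i, (f i : Fun n) ∈ Lp ℂ (s i) volume) →
    eLpNorm (S f) s₀ volume ≤ C * ∏ i, eLpNorm (f i : Fun n) (s i) volume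

/-- `S` is a bounded extension of `T` to the Lebesgue spaces: it agrees with `T` on test functions,
and is bounded `L^{s₁} × ⋯ × L^{s_m} → L^s`, `1/s = ∑ 1/s_i`, for all `s_i ∈ (1,∞)`. -/
def IsExtension {n m : ℕ} (T : MultilinearMap ℂ (fun _ : Fin m => Test n) (Fun n))
    (S : MultilinearMap ℂ (fun _ : Fin m => LpSum n) (Fun n)) : Prop :=
  (∀ f : Fin m → Test n, S (fun i => ofTest (f i)) = T f) ∧
  ∀ s : Fin m → ℝ≥0∞, (∀ i, s i ∈ Ioo (1 : ℝ≥0∞) ∞) → IsBoundedOn S s (∑ i, (s i)⁻¹)⁻¹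

/-- The commutator `[b,S]_i(f₁,…,f_m) = b S(f₁,…,f_m) - S(f₁,…,b f_i,…,f_m)`, for those `f` for
which `b f_i` lies in the domain of `S`. -/
def commutator {n m : ℕ} (b : Fun n) (S : MultilinearMap ℂ (fun _ : Fin m => LpSum n) (Fun n))
    (i : Fin m) (f : Fin m → LpSum n) (h : b * (f i : Fun n) ∈ LpSum n) : Fun n :=
  b * S f - S (Function.update f i ⟨b * (f i : Fun n), h⟩)

/-- `‖b‖_{L̇^r} = inf_c ‖b - c‖_r`, over complex constants `c`. -/
def dotNorm {n : ℕ} (b : Fun n) (r : ℝ≥0∞) : ℝ≥0∞ :=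
  ⨅ c : ℂ, eLpNorm (fun x => b x - c) r volume

/-- `b ∈ L̇^r(ℝⁿ)`: `b` is locally in `L^r`, and `‖b‖_{L̇^r} < ∞`. -/
def MemDotLp {n : ℕ} (b : Fun n) (r : ℝ≥0∞) : Prop :=
  (∀ (x : E n) (R : ℝ), MemLp b r (volume.restrict (Metric.ball x R))) ∧ dotNorm b r < ∞

end MultilinearCZ

end

/-! The commutator bound needs no cancellation between its two terms. Subtracting a constant from
`b` does not change the commutator (`commutator_eq_of_sub_const`), so `b` may be replaced by `b₀ = b
- c` in `L^r`. Then `b₀ T(f)` is in `L^q` by Hölder, because `1/q = 1/r + 1/p`. In the other term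
`b₀ f₁` lies in `L^t` with `1/t = 1/r + 1/p₁`; the hypothesis `1/r < 1/p₁'` says exactly that `t >
1`, so the boundedness of `T` from `L^t × L^{p₂} × ⋯` to `L^q` applies.

The real work is the multilinear Calderón–Zygmund theorem: one bound for `T` implies all bounds with
exponents in `(1, ∞)`, including targets below `L¹`. The given bound is weakened to weak type, and
its exponents are lowered to `1` one slot at a time (`HasWeakBound.update_one`). In the chosen slot
the function is split by a smooth Calderón–Zygmund decomposition (`exists_smooth_decomposition`):
the good part is handled by the bound already known, the bad part by the regularity of the kernel,
with the other slots dominated by maximal functions. The result is the endpoint `L¹ × ⋯ × L¹ →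
L^{1/m,∞}` (`HasWeakBound.all_one`). From this endpoint a good-`λ` inequality
(`exists_oscillation_bound`, `measure_goodLambda_le`) compares `T f` with the product of the maximal
functions of the `f k` in every `L^s` with `s > 1/m`; Hölder and the maximal theorem finish
(`IsCZOperator.exists_strong_bound`). The Dini condition enters through the summability of the
modulus along a dyadic sequence.

For the extension, a function is approximated by mollified truncations, the same sequence for all
exponents. The images under `T` converge in the target space, hence in measure; convergence in
measure does not refer to an exponent, so it passes to sums from different Lebesgue spaces. Every
extension must give this limit, which proves uniqueness. -/

set_option linter.unusedSectionVars false

namespace MultilinearCZ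

open Metric Filter Topology

/-! ### Volumes of balls and the Vitali covering lemma. -/

section Balls

variable {n : ℕ} [NeZero n]

theorem volume_ball_eq (x : E n) {R : ℝ} (hR : 0 ≤ R) :
    volume (ball x R) = ENNReal.ofReal (R ^ n) * volume (ball (0 : E n) 1) := by
  rw [Measure.addHaar_ball _ _ hR, finrank_euclideanSpace_fin]

theorem volume_ball_mul (x y : E n) {κ R : ℝ} (hκ : 0 ≤ κ) (hR : 0 ≤ R) :
    volume (ball x (κ * R)) = ENNReal.ofReal (κ ^ n) * volume (ball y R) := by
  rw [volume_ball_eq _ (mul_nonneg hκ hR), volume_ball_eq _ hR, mul_pow,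
    ENNReal.ofReal_mul (by positivity), mul_assoc]

theorem volume_ball_ne_zero (x : E n) {R : ℝ} (hR : 0 < R) : volume (ball x R) ≠ 0 :=
  (measure_ball_pos _ _ hR).ne'

theorem volume_ball_ne_top (x : E n) (R : ℝ) : volume (ball x R) ≠ ∞ :=
  measure_ball_lt_top.ne

theorem ball_ae_eq_closedBall (x : E n) (R : ℝ) :
    ball x R =ᵐ[volume] closedBall x R := by
  refine (ae_eq_set).2 ⟨?_, ?_⟩
  · rw [sdiff_eq_empty.2 ball_subset_closedBall, measure_empty]
  · rw [closedBall_sdiff_ball, Measure.addHaar_sphere]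

/-- The balls of volume at most `I` have bounded radii. -/
theorem exists_radius_bound {I : ℝ≥0∞} (hI : I ≠ ∞) :
    ∃ M : ℝ, ∀ (x : E n) (R : ℝ), volume (ball x R) ≤ I → R ≤ M := by
  have hv := volume_ball_ne_zero (0 : E n) one_pos
  have hv' := volume_ball_ne_top (0 : E n) 1
  -- The maximum with `1` allows `R ≤ R ^ n` for every larger radius, as `n ≥ 1`.
  refine ⟨max 1 (I / volume (ball (0 : E n) 1)).toReal, fun x R h => ?_⟩
  by_contra! hc
  have h1 : 1 < R := (le_max_left _ _).trans_lt hc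
  have h2 : (I / volume (ball (0 : E n) 1)).toReal < R := (le_max_right _ _).trans_lt hc
  rw [volume_ball_eq x (by linarith)] at h
  have h3 : ENNReal.ofReal (R ^ n) ≤ I / volume (ball (0 : E n) 1) := by
    rwa [ENNReal.le_div_iff_mul_le (.inl hv) (.inl hv')]
  have h4 := ENNReal.toReal_mono (ENNReal.div_ne_top hI hv) h3
  rw [ENNReal.toReal_ofReal (by positivity)] at h4
  have : R ≤ R ^ n := le_self_pow₀ h1.le (NeZero.ne n)
  linarith

theorem tsum_lintegral_le {ι : Type*} {w : Set ι} {B : ι → Set (E n)} (hw : w.Countable)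
    (hB : ∀ a ∈ w, MeasurableSet (B a)) (hd : w.PairwiseDisjoint B) (u : E n → ℝ≥0∞) :
    ∑' a : w, ∫⁻ y in B a, u y ≤ ∫⁻ y, u y := by
  have := hw.to_subtype
  rw [← lintegral_iUnion (fun a : w => hB a a.2)]
  · exact setLIntegral_le_lintegral _ _
  · intro a b hab
    exact hd a.2 b.2 (fun h => hab (Subtype.ext h))

/-- **Vitali covering**: balls whose volume is controlled by the mass of `u` in them have a
countable disjoint subfamily of total volume at most `∫ u`, whose enlargements cover them all. -/
theorem exists_disjoint_balls {ι : Type*} (t : Set ι) (c : ι → E n) (R : ι → ℝ)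
    (hR : ∀ a ∈ t, 0 < R a) {u : E n → ℝ≥0∞} (hu : ∫⁻ y, u y ≠ ∞)
    (h : ∀ a ∈ t, volume (ball (c a) (R a)) ≤ ∫⁻ y in ball (c a) (R a), u y) :
    ∃ w ⊆ t, w.Countable ∧ w.PairwiseDisjoint (fun a => ball (c a) (R a)) ∧
      (∀ a ∈ t, ∃ b ∈ w, ball (c a) (R a) ⊆ ball (c b) (4 * R b)) ∧
      ∑' a : w, volume (ball (c a) (R a)) ≤ ∫⁻ y, u y := by
  obtain ⟨M, hM⟩ := exists_radius_bound (n := n) hu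
  obtain ⟨w, hwt, hd, hcov⟩ := Vitali.exists_disjoint_subfamily_covering_enlargement_ball t c R M
    (fun a ha => hM (c a) _ ((h a ha).trans (setLIntegral_le_lintegral _ _))) 4 (by norm_num)
  have hw : w.Countable := hd.countable_of_isOpen (fun _ _ => isOpen_ball)
    (fun a ha => nonempty_ball.2 (hR a (hwt ha)))
  refine ⟨w, hwt, hw, hd, hcov, ?_⟩
  exact (ENNReal.tsum_le_tsum fun a : w => h a (hwt a.2)).trans
    (tsum_lintegral_le hw (fun _ _ => measurableSet_ball) hd u)

/-- The source of the weak type bounds for the maximal function: the disjoint balls of the Vitali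
family have total volume at most `∫ u`, and their 4-fold enlargements cover `S`. -/
theorem measure_le_of_forall_exists_ball {S : Set (E n)} {u : E n → ℝ≥0∞}
    (h : ∀ x ∈ S, ∃ c R, x ∈ ball c R ∧ volume (ball c R) ≤ ∫⁻ y in ball c R, u y) :
    volume S ≤ ENNReal.ofReal (4 ^ n) * ∫⁻ y, u y := by
  by_cases hu : ∫⁻ y, u y = ∞
  · rw [hu, ENNReal.mul_top (by simp)]; exact le_top
  choose! c R hx hb using h
  have hR : ∀ x ∈ S, 0 < R x := fun x hxS => pos_of_mem_ball (hx x hxS)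
  obtain ⟨w, hwt, hw, -, hcov, hsum⟩ := exists_disjoint_balls S c R hR hu hb
  have hsub : S ⊆ ⋃ b ∈ w, ball (c b) (4 * R b) := by
    intro x hxS
    obtain ⟨b, hbw, hb⟩ := hcov x hxS
    exact mem_iUnion₂.2 ⟨b, hbw, hb (hx x hxS)⟩
  calc volume S ≤ ∑' b : w, volume (ball (c b) (4 * R b)) :=
        (measure_mono hsub).trans (measure_biUnion_le _ hw _)
    _ = ∑' b : w, ENNReal.ofReal (4 ^ n) * volume (ball (c b) (R b)) :=
        tsum_congr fun b => volume_ball_mul _ _ (by norm_num) (hR b (hwt b.2)).le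
    _ = ENNReal.ofReal (4 ^ n) * ∑' b : w, volume (ball (c b) (R b)) := ENNReal.tsum_mul_left
    _ ≤ _ := by gcongr

/-- If the mass of `u` in some ball around `x` exceeds the volume, then this happens for a radius
`R` but no longer for `κ R`. -/
theorem exists_ball_scale (x : E n) {u : E n → ℝ≥0∞} (hu : ∫⁻ y, u y ≠ ∞) {κ : ℝ} (hκ : 1 < κ)
    {R₀ : ℝ} (hR₀ : 0 < R₀) (h : volume (ball x R₀) ≤ ∫⁻ y in ball x R₀, u y) :
    ∃ R, 0 < R ∧ volume (ball x R) ≤ ∫⁻ y in ball x R, u y ∧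
      ∫⁻ y in ball x (κ * R), u y < volume (ball x (κ * R)) := by
  obtain ⟨M, hM⟩ := exists_radius_bound (n := n) hu
  by_contra! hc
  -- If the condition survived every passage from `R` to `κ R`, it would hold for the unbounded
  -- radii `κ ^ k R₀`, whereas balls of volume at most `∫ u` have bounded radii.
  have key : ∀ k : ℕ, volume (ball x (κ ^ k * R₀)) ≤ ∫⁻ y in ball x (κ ^ k * R₀), u y := by
    intro k
    induction k with
    | zero => simpa using h
    | succ k ih =>
      have := hc _ (by positivity) ih
      rwa [← mul_assoc, ← pow_succ'] at this
  obtain ⟨k, hk⟩ := ((tendsto_pow_atTop_atTop_of_one_lt hκ).eventually_gt_atTop (M / R₀)).exists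
  have h1 := hM x _ ((key k).trans (setLIntegral_le_lintegral _ _))
  rw [div_lt_iff₀ hR₀] at hk
  linarith

end Balls

/-! ### The Hardy–Littlewood maximal function. -/

section MaxFun

variable {n : ℕ}

/-- The noncentred Hardy–Littlewood maximal function. -/
noncomputable def maxFun (u : E n → ℝ≥0∞) (z : E n) : ℝ≥0∞ :=
  ⨆ (c : E n) (R : ℝ) (_ : z ∈ ball c R), (volume (ball c R))⁻¹ * ∫⁻ y in ball c R, u y

theorem lt_maxFun_iff {u : E n → ℝ≥0∞} {z : E n} {l : ℝ≥0∞} : l < maxFun u z ↔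
    ∃ c R, z ∈ ball c R ∧ l < (volume (ball c R))⁻¹ * ∫⁻ y in ball c R, u y := by
  simp only [maxFun, lt_iSup_iff, exists_prop]

/-- The balls are open and noncentred, so a ball witnessing `l < maxFun u z` serves all nearby
points as well; hence `maxFun u` is lower semicontinuous for any `u`. -/
theorem measurable_maxFun (u : E n → ℝ≥0∞) : Measurable (maxFun u) := by
  refine LowerSemicontinuous.measurable (lowerSemicontinuous_iff_isOpen_preimage.2 fun l => ?_)
  rw [isOpen_iff_mem_nhds]
  intro z hz
  obtain ⟨c, R, hzc, hl⟩ := lt_maxFun_iff.1 (show l < maxFun u z from hz)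
  filter_upwards [isOpen_ball.mem_nhds hzc] with z' hz'
  exact lt_maxFun_iff.2 ⟨c, R, hz', hl⟩

variable [NeZero n]

theorem lintegral_ball_le_maxFun (u : E n → ℝ≥0∞) {z c : E n} {R : ℝ} (h : z ∈ ball c R) :
    ∫⁻ y in ball c R, u y ≤ volume (ball c R) * maxFun u z := by
  have : (volume (ball c R))⁻¹ * ∫⁻ y in ball c R, u y ≤ maxFun u z :=
    le_iSup_of_le c (le_iSup₂_of_le R h le_rfl)
  rw [mul_comm, ← div_eq_mul_inv] at this
  rw [mul_comm]
  exact (ENNReal.div_le_iff_le_mul (.inl (volume_ball_ne_zero c (pos_of_mem_ball h)))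
    (.inl (volume_ball_ne_top c R))).1 this

theorem maxFun_le_of_ae_le {u : E n → ℝ≥0∞} {l : ℝ≥0∞} (h : ∀ᵐ x, u x ≤ l) (z : E n) :
    maxFun u z ≤ l := by
  refine iSup_le fun c => iSup₂_le fun R hR => ?_
  calc (volume (ball c R))⁻¹ * ∫⁻ y in ball c R, u y
      ≤ (volume (ball c R))⁻¹ * ∫⁻ y in ball c R, l := by
        gcongr 1
        exact lintegral_mono_ae (ae_restrict_of_ae h)
    _ = l := by
        rw [setLIntegral_const, mul_comm l, ← mul_assoc, ENNReal.inv_mul_cancel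
          (volume_ball_ne_zero c (pos_of_mem_ball hR)) (volume_ball_ne_top c R), one_mul]

/-- The maximal function is of weak type `(q, q)`, `1 ≤ q < ∞`. -/
theorem measure_maxFun_gt_le {u : E n → ℝ≥0∞} (hu : AEMeasurable u) {q : ℝ} (hq : 1 ≤ q)
    {l : ℝ≥0∞} (hl : l ≠ 0) (hl' : l ≠ ∞) :
    volume {x | l < maxFun u x} ≤ ENNReal.ofReal (4 ^ n) * (l⁻¹ ^ q * ∫⁻ y, u y ^ q) := by
  have hq0 : 0 < q := by linarith
  rw [← lintegral_const_mul' _ _ (ENNReal.rpow_ne_top_of_nonneg hq0.le (ENNReal.inv_ne_top.2 hl))]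
  -- The covering lemma is applied to `(u / l) ^ q`: if the average of `u` over a ball of volume `V`
  -- exceeds `l`, Hölder gives `l ^ q * V ≤ ∫ u ^ q` over that ball.
  refine measure_le_of_forall_exists_ball fun x hx => ?_
  obtain ⟨c, R, hxc, h⟩ := lt_maxFun_iff.1 hx
  refine ⟨c, R, hxc, ?_⟩
  set V := volume (ball c R)
  have hV0 : V ≠ 0 := volume_ball_ne_zero c (pos_of_mem_ball hxc)
  have hV : V ≠ ∞ := volume_ball_ne_top c R
  rw [lintegral_const_mul' _ _ (ENNReal.rpow_ne_top_of_nonneg hq0.le (ENNReal.inv_ne_top.2 hl))]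
  -- Hölder on the ball
  have hol : ∫⁻ y in ball c R, u y ≤ (∫⁻ y in ball c R, u y ^ q) ^ (1 / q) * V ^ (1 - 1 / q) := by
    rcases hq.eq_or_lt with rfl | hq1
    · simp
    · have := ENNReal.lintegral_mul_le_Lp_mul_Lq (volume.restrict (ball c R))
        (Real.HolderConjugate.conjExponent hq1) hu.restrict (aemeasurable_const (b := (1 : ℝ≥0∞)))
      simp only [Pi.mul_apply, mul_one, ENNReal.one_rpow, lintegral_const, one_mul,
        Measure.restrict_apply_univ] at this
      rwa [show 1 / Real.conjExponent q = 1 - 1 / q by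
        rw [one_div, one_div, ← (Real.HolderConjugate.conjExponent hq1).inv_add_inv_eq_one]
        ring] at this
  have h1 : l * V < (∫⁻ y in ball c R, u y ^ q) ^ (1 / q) * V ^ (1 - 1 / q) := by
    refine lt_of_lt_of_le ?_ hol
    rw [mul_comm, ← div_eq_mul_inv] at h
    exact (ENNReal.lt_div_iff_mul_lt (.inl hV0) (.inl hV)).1 h
  have h2 : (l * V) ^ q ≤ ((∫⁻ y in ball c R, u y ^ q) ^ (1 / q) * V ^ (1 - 1 / q)) ^ q := by
    gcongr
  rw [ENNReal.mul_rpow_of_nonneg _ _ hq0.le, ENNReal.mul_rpow_of_nonneg _ _ hq0.le,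
    ← ENNReal.rpow_mul, ← ENNReal.rpow_mul, one_div, inv_mul_cancel₀ hq0.ne', ENNReal.rpow_one,
    show (1 - q⁻¹) * q = q - 1 by field_simp] at h2
  have h3 : V ^ q = V * V ^ (q - 1) := by
    nth_rw 2 [← ENNReal.rpow_one V]
    rw [← ENNReal.rpow_add _ _ hV0 hV]; congr 1; ring
  rw [h3, ← mul_assoc] at h2
  have hV1 : V ^ (q - 1) ≠ 0 := by
    rw [Ne, ENNReal.rpow_eq_zero_iff]; push Not; exact ⟨fun h => absurd h hV0, fun h => absurd h hV⟩
  have hV2 : V ^ (q - 1) ≠ ∞ := ENNReal.rpow_ne_top_of_nonneg (by linarith) hV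
  have h4 := (ENNReal.mul_le_mul_iff_left hV1 hV2).1 h2
  have hlq : l ^ q ≠ 0 := by
    rw [Ne, ENNReal.rpow_eq_zero_iff]; push Not; exact ⟨fun h => absurd h hl, fun h => absurd h hl'⟩
  rw [ENNReal.inv_rpow, mul_comm, ← div_eq_mul_inv, ENNReal.le_div_iff_mul_le (.inl hlq)
    (.inl (ENNReal.rpow_ne_top_of_nonneg hq0.le hl')), mul_comm]
  exact h4

/-- The layer cake formula for `ℝ≥0∞`-valued functions. -/
theorem lintegral_rpow_eq_lintegral_meas_ofReal_lt {v : E n → ℝ≥0∞} (hv : AEMeasurable v)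
    (hfin : ∀ᵐ x, v x ≠ ∞) {p : ℝ} (hp : 0 < p) :
    ∫⁻ x, v x ^ p = ENNReal.ofReal p *
      ∫⁻ t in Ioi (0 : ℝ), volume {x | ENNReal.ofReal t < v x} * ENNReal.ofReal (t ^ (p - 1)) := by
  have h := lintegral_rpow_eq_lintegral_meas_lt_mul volume (f := fun x => (v x).toReal)
    (Eventually.of_forall fun x => ENNReal.toReal_nonneg) hv.ennreal_toReal hp
  have h1 : ∫⁻ x, v x ^ p = ∫⁻ x, ENNReal.ofReal ((v x).toReal ^ p) := by
    refine lintegral_congr_ae ?_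
    filter_upwards [hfin] with x hx
    rw [← ENNReal.ofReal_rpow_of_nonneg ENNReal.toReal_nonneg hp.le, ENNReal.ofReal_toReal hx]
  rw [h1, h]
  congr 1
  refine setLIntegral_congr_fun measurableSet_Ioi fun t ht => ?_
  have ht0 : (0 : ℝ) ≤ t := (mem_Ioi.1 ht).le
  congr 1
  refine measure_congr ?_
  filter_upwards [hfin] with x hx
  exact propext (ENNReal.ofReal_lt_iff_lt_toReal ht0 hx).symm

/-- The truncation of the Marcinkiewicz argument: the part of `u` not exceeding `l` has averages at
most `l`. -/
theorem maxFun_le_add (u : E n → ℝ≥0∞) (l : ℝ≥0∞) (z : E n) :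
    maxFun u z ≤ maxFun ({x | l < u x}.indicator u) z + l := by
  refine iSup_le fun c => iSup₂_le fun R hR => ?_
  calc (volume (ball c R))⁻¹ * ∫⁻ y in ball c R, u y
      ≤ (volume (ball c R))⁻¹ * ∫⁻ y in ball c R, ({x | l < u x}.indicator u y + l) := by
        gcongr with y
        by_cases hy : l < u y
        · rw [indicator_of_mem (by exact hy)]; exact le_self_add
        · rw [indicator_of_notMem (by exact hy), zero_add]; exact not_lt.1 hy
    _ = (volume (ball c R))⁻¹ * (∫⁻ y in ball c R, {x | l < u x}.indicator u y) + l := by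
        rw [lintegral_add_right _ measurable_const, setLIntegral_const, mul_add, mul_comm l,
          ← mul_assoc, ENNReal.inv_mul_cancel
          (volume_ball_ne_zero c (pos_of_mem_ball hR)) (volume_ball_ne_top c R), one_mul]
    _ ≤ _ := by
        gcongr
        exact le_iSup_of_le c (le_iSup₂_of_le R hR le_rfl)

theorem ae_ne_top_of_lintegral_rpow {u : E n → ℝ≥0∞} (hu : AEMeasurable u) {p : ℝ} (hp : 0 < p)
    (h : ∫⁻ x, u x ^ p ≠ ∞) : ∀ᵐ x, u x ≠ ∞ := by
  filter_upwards [ae_lt_top' (hu.pow_const p) h] with x hx h'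
  simp [h', ENNReal.top_rpow_of_pos hp] at hx

/-- The set where the maximal function is infinite lies in every level set, and the weak type bounds
at the levels `k + 1` tend to zero. -/
theorem ae_maxFun_ne_top {u : E n → ℝ≥0∞} (hu : AEMeasurable u) {p : ℝ} (hp : 1 ≤ p)
    (h : ∫⁻ x, u x ^ p ≠ ∞) : ∀ᵐ x, maxFun u x ≠ ∞ := by
  have hp0 : 0 < p := by linarith
  rw [ae_iff]
  simp only [ne_eq, not_not]
  have key : ∀ k : ℕ, volume {x | maxFun u x = ∞} ≤
      ENNReal.ofReal (4 ^ n) * (((k + 1 : ℕ) : ℝ≥0∞)⁻¹ ^ p * ∫⁻ y, u y ^ p) := fun k =>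
    (measure_mono fun x hx => by
      simp only [mem_ofPred_eq] at hx ⊢; rw [hx]; exact ENNReal.natCast_lt_top _).trans
    (measure_maxFun_gt_le hu hp (by simp) (ENNReal.natCast_ne_top _))
  have lim : Tendsto (fun k : ℕ => ENNReal.ofReal (4 ^ n) *
      (((k + 1 : ℕ) : ℝ≥0∞)⁻¹ ^ p * ∫⁻ y, u y ^ p)) atTop (𝓝 0) := by
    have h1 : Tendsto (fun k : ℕ => ((k + 1 : ℕ) : ℝ≥0∞)⁻¹) atTop (𝓝 0) :=
      ENNReal.tendsto_inv_nat_nhds_zero.comp (tendsto_add_atTop_nat 1)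
    have h2 := (ENNReal.continuous_rpow_const (y := p)).tendsto 0 |>.comp h1
    rw [ENNReal.zero_rpow_of_pos hp0] at h2
    have h3 := ENNReal.Tendsto.mul_const h2 (.inr h)
    have h4 := ENNReal.Tendsto.const_mul (a := ENNReal.ofReal (4 ^ n)) h3 (.inr ENNReal.ofReal_ne_top)
    simpa using h4
  exact le_antisymm (ge_of_tendsto' lim key) zero_le

theorem lintegral_Ioo_rpow {a s : ℝ} (ha : 0 ≤ a) (hs : 0 < s) :
    ∫⁻ t in Ioo 0 a, ENNReal.ofReal (t ^ (s - 1)) = ENNReal.ofReal (a ^ s / s) := by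
  have hint : IntervalIntegrable (fun t : ℝ => t ^ (s - 1)) volume 0 a :=
    intervalIntegral.intervalIntegrable_rpow' (by linarith)
  have h1 : IntegrableOn (fun t : ℝ => t ^ (s - 1)) (Ioo 0 a) :=
    ((intervalIntegrable_iff_integrableOn_Ioc_of_le ha).1 hint).mono_set Ioo_subset_Ioc_self
  rw [← ofReal_integral_eq_lintegral_ofReal h1]
  · rw [← integral_Ioc_eq_integral_Ioo, ← intervalIntegral.integral_of_le ha, integral_rpow
      (.inl (by linarith))]
    simp [Real.zero_rpow hs.ne']
  · filter_upwards [self_mem_ae_restrict measurableSet_Ioo] with t ht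
    exact Real.rpow_nonneg ht.1.le _

/-- The maximal function is bounded on `L^p`, `1 < p < ∞`. -/
theorem exists_lintegral_maxFun_rpow_le (n : ℕ) [NeZero n] {p : ℝ} (hp : 1 < p) :
    ∃ C : ℝ≥0, ∀ u : E n → ℝ≥0∞, Measurable u →
      ∫⁻ x, maxFun u x ^ p ≤ C * ∫⁻ x, u x ^ p := by
  have hp0 : 0 < p := by linarith
  -- `4 ^ n * 2` comes from the weak `(1, 1)` bound at level `t / 2`, and `2 ^ (p - 1) / (p - 1)`
  -- from integrating `t ^ (p - 2)` over `0 < t < 2 u x`. The added `1` keeps the constant nonzero,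
  -- which settles the case of an infinite right-hand side.
  refine ⟨(p * (4 ^ n * 2) * (2 ^ (p - 1) / (p - 1))).toNNReal + 1, fun u hu => ?_⟩
  by_cases hfin : ∫⁻ x, u x ^ p = ∞
  · rw [hfin, ENNReal.mul_top (by simp)]; exact le_top
  have hae := ae_ne_top_of_lintegral_rpow hu.aemeasurable hp0 hfin
  rw [lintegral_rpow_eq_lintegral_meas_ofReal_lt (measurable_maxFun u).aemeasurable
    (ae_maxFun_ne_top hu.aemeasurable hp.le hfin) hp0]
  have step : ∀ t ∈ Ioi (0 : ℝ), volume {x | ENNReal.ofReal t < maxFun u x} *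
      ENNReal.ofReal (t ^ (p - 1)) ≤ ENNReal.ofReal (4 ^ n * 2) *
        ∫⁻ x, {x | ENNReal.ofReal (t / 2) < u x}.indicator u x * ENNReal.ofReal (t ^ (p - 1 - 1)) := by
    intro t ht
    have ht0 : 0 < t := ht
    set v := {x | ENNReal.ofReal (t / 2) < u x}.indicator u
    have hv : Measurable v := hu.indicator (measurableSet_lt measurable_const hu)
    have h1 : {x | ENNReal.ofReal t < maxFun u x} ⊆ {x | ENNReal.ofReal (t / 2) < maxFun v x} := by
      intro x hx
      have h3 : ENNReal.ofReal t < maxFun u x := hx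
      have h4 := h3.trans_le (maxFun_le_add u (ENNReal.ofReal (t / 2)) x)
      have h5 : ENNReal.ofReal t = ENNReal.ofReal (t / 2) + ENNReal.ofReal (t / 2) := by
        rw [← ENNReal.ofReal_add (by positivity) (by positivity), add_halves]
      rw [h5] at h4
      exact lt_of_add_lt_add_right h4
    have h2 := (measure_mono h1).trans (measure_maxFun_gt_le (l := ENNReal.ofReal (t / 2))
      hv.aemeasurable le_rfl (by simpa using ht0) ENNReal.ofReal_ne_top)
    simp only [ENNReal.rpow_one] at h2
    rw [lintegral_mul_const' _ _ ENNReal.ofReal_ne_top]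
    calc _ ≤ ENNReal.ofReal (4 ^ n) * ((ENNReal.ofReal (t / 2))⁻¹ * ∫⁻ y, v y) *
          ENNReal.ofReal (t ^ (p - 1)) := by gcongr
      _ = (ENNReal.ofReal (4 ^ n) * ((ENNReal.ofReal (t / 2))⁻¹ * ENNReal.ofReal (t ^ (p - 1)))) *
          ∫⁻ y, v y := by ring
      _ = (ENNReal.ofReal (4 ^ n * 2) * ENNReal.ofReal (t ^ (p - 1 - 1))) * ∫⁻ y, v y := by
          rw [← ENNReal.ofReal_inv_of_pos (by positivity), ← ENNReal.ofReal_mul (by positivity),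
            ← ENNReal.ofReal_mul (by positivity), ← ENNReal.ofReal_mul (by positivity)]
          congr 2
          rw [Real.rpow_sub_one ht0.ne' (p - 1)]
          field_simp
      _ = _ := by ring
  have hmeas : Measurable (fun z : ℝ × E n => {x | ENNReal.ofReal (z.1 / 2) < u x}.indicator u z.2 *
      ENNReal.ofReal (z.1 ^ (p - 1 - 1))) := by
    refine Measurable.mul ?_ (by fun_prop)
    have : (fun z : ℝ × E n => {x | ENNReal.ofReal (z.1 / 2) < u x}.indicator u z.2) =
        {z : ℝ × E n | ENNReal.ofReal (z.1 / 2) < u z.2}.indicator (fun z => u z.2) := by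
      ext z; simp [indicator_apply]
    rw [this]
    exact (hu.comp measurable_snd).indicator
      (measurableSet_lt (by fun_prop) (hu.comp measurable_snd))
  calc _ ≤ ENNReal.ofReal p * ∫⁻ t in Ioi (0 : ℝ), ENNReal.ofReal (4 ^ n * 2) *
        ∫⁻ x, {x | ENNReal.ofReal (t / 2) < u x}.indicator u x * ENNReal.ofReal (t ^ (p - 1 - 1)) := by
        gcongr 1
        exact setLIntegral_mono' measurableSet_Ioi step
    _ = ENNReal.ofReal p * ENNReal.ofReal (4 ^ n * 2) * ∫⁻ x, ∫⁻ t in Ioi (0 : ℝ),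
        {x | ENNReal.ofReal (t / 2) < u x}.indicator u x * ENNReal.ofReal (t ^ (p - 1 - 1)) := by
        rw [lintegral_const_mul' _ _ ENNReal.ofReal_ne_top, ← mul_assoc, lintegral_lintegral_swap]
        exact hmeas.aemeasurable
    _ = ENNReal.ofReal p * ENNReal.ofReal (4 ^ n * 2) *
        ∫⁻ x, ENNReal.ofReal (2 ^ (p - 1) / (p - 1)) * u x ^ p := by
        congr 1
        refine lintegral_congr_ae ?_
        filter_upwards [hae] with x hx
        have hset : ∀ t ∈ Ioi (0 : ℝ), {x | ENNReal.ofReal (t / 2) < u x}.indicator u x *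
            ENNReal.ofReal (t ^ (p - 1 - 1)) = (Ioo 0 (2 * (u x).toReal)).indicator
              (fun t => u x * ENNReal.ofReal (t ^ (p - 1 - 1))) t := by
          intro t ht
          have ht0 : 0 < t := ht
          have : ENNReal.ofReal (t / 2) < u x ↔ t ∈ Ioo 0 (2 * (u x).toReal) := by
            rw [ENNReal.ofReal_lt_iff_lt_toReal (by positivity) hx, mem_Ioo]
            constructor
            · intro h; exact ⟨ht0, by linarith⟩
            · intro h; linarith [h.2]
          simp only [indicator_apply, mem_ofPred_eq, this]
          split_ifs <;> simp
        rw [setLIntegral_congr_fun measurableSet_Ioi hset, setLIntegral_indicator measurableSet_Ioo,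
          inter_eq_left.2 Ioo_subset_Ioi_self, lintegral_const_mul' _ _ hx,
          lintegral_Ioo_rpow (by positivity) (by linarith)]
        rw [← ENNReal.ofReal_toReal hx, ENNReal.ofReal_rpow_of_nonneg ENNReal.toReal_nonneg hp0.le,
          ← ENNReal.ofReal_mul ENNReal.toReal_nonneg, ← ENNReal.ofReal_mul
            (div_nonneg (by positivity) (by linarith)), ENNReal.toReal_ofReal ENNReal.toReal_nonneg]
        congr 1
        rcases (ENNReal.toReal_nonneg (a := u x)).eq_or_lt with h0 | h0
        · rw [← h0, Real.zero_rpow hp0.ne']; simp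
        · rw [Real.mul_rpow (by norm_num) h0.le, Real.rpow_sub_one h0.ne' p]
          field_simp
    _ = ENNReal.ofReal (p * (4 ^ n * 2) * (2 ^ (p - 1) / (p - 1))) * ∫⁻ x, u x ^ p := by
        rw [lintegral_const_mul' _ _ ENNReal.ofReal_ne_top, ← mul_assoc,
          ENNReal.ofReal_mul (p := p * (4 ^ n * 2)) (by positivity),
          ENNReal.ofReal_mul (p := p) (by positivity)]
    _ ≤ _ := by
        gcongr
        rw [ENNReal.coe_add, ENNReal.ofReal]
        exact le_self_add

end MaxFun

/-! ### Operations on test functions. -/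

section TestFunctions

variable {n : ℕ}

/-- The product of a test function with a smooth real function. -/
noncomputable def Test.smulSmooth (ψ : E n → ℝ) (hψ : ContDiff ℝ (⊤ : ℕ∞) ψ) (f : Test n) : Test n where
  toFun x := (ψ x : ℂ) * f x
  contDiff' := (Complex.ofRealCLM.contDiff.comp hψ).mul f.contDiff
  hasCompactSupport' := f.hasCompactSupport.mul_left
  tsupport_subset' := subset_univ _

@[simp] theorem Test.smulSmooth_apply (ψ : E n → ℝ) (hψ : ContDiff ℝ (⊤ : ℕ∞) ψ) (f : Test n)
    (x : E n) : f.smulSmooth ψ hψ x = (ψ x : ℂ) * f x := rfl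

/-- A smooth real function of compact support as a test function. -/
noncomputable def Test.ofReal (ψ : E n → ℝ) (hψ : ContDiff ℝ (⊤ : ℕ∞) ψ) (hc : HasCompactSupport ψ) :
    Test n where
  toFun x := (ψ x : ℂ)
  contDiff' := Complex.ofRealCLM.contDiff.comp hψ
  hasCompactSupport' := hc.comp_left (g := fun t : ℝ => (t : ℂ)) Complex.ofReal_zero
  tsupport_subset' := subset_univ _

@[simp] theorem Test.ofReal_apply (ψ : E n → ℝ) (hψ : ContDiff ℝ (⊤ : ℕ∞) ψ)
    (hc : HasCompactSupport ψ) (x : E n) : Test.ofReal ψ hψ hc x = (ψ x : ℂ) := rfl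

theorem Test.sum_apply {ι : Type*} (s : Finset ι) (b : ι → Test n) (x : E n) :
    (∑ j ∈ s, b j) x = ∑ j ∈ s, b j x := _root_.sum_apply s b x

theorem Test.integrable (f : Test n) : Integrable f (volume : Measure (E n)) :=
  f.continuous.integrable_of_hasCompactSupport f.hasCompactSupport

theorem Test.lintegral_enorm_ne_top (f : Test n) : ∫⁻ x, ‖f x‖ₑ ≠ ∞ :=
  f.integrable.2.ne

theorem Test.measurable_enorm (f : Test n) : Measurable fun x => ‖f x‖ₑ :=
  f.continuous.measurable.enorm

theorem Test.memLp (f : Test n) (p : ℝ≥0∞) : MemLp f p (volume : Measure (E n)) :=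
  f.continuous.memLp_of_hasCompactSupport f.hasCompactSupport

theorem Test.isCompact_le_norm (f : Test n) {a : ℝ} (ha : 0 < a) :
    IsCompact {x | a ≤ ‖f x‖} := by
  have := HasCompactSupport.isCompact_preimage (K := Ici a) f.hasCompactSupport.norm
    f.continuous.norm isClosed_Ici (by simpa using ha)
  exact this

end TestFunctions

/-! ### The smooth Calderón–Zygmund decomposition. -/

section Decomposition

variable {n : ℕ} [NeZero n]

/-- The bump is `1` on the ball of radius `R / 2`, so its integral is at least `2 ^ (-n)` times the
volume of the ball of radius `R`. Used for the mean corrections in the decomposition and later for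
the mollifiers. -/
theorem bump_normed_le (c : E n) {R : ℝ} (hR : 0 < R) (φ : ContDiffBump c) (hin : φ.rIn = R / 2)
    (hout : φ.rOut = R) (x : E n) :
    ENNReal.ofReal (φ.normed volume x) * volume (ball c R) ≤
      (ball c R).indicator (fun _ => ENNReal.ofReal (2 ^ n)) x := by
  by_cases hx : x ∈ ball c R
  · rw [indicator_of_mem hx]
    have h := φ.normed_le_div_measure_closedBall_rOut volume 2 (by rw [hin, hout]; linarith) x
    rw [finrank_euclideanSpace_fin, hout, measureReal_def,
      Measure.addHaar_closedBall_eq_addHaar_ball] at h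
    have hpos : 0 < (volume (ball c R)).toReal :=
      ENNReal.toReal_pos (volume_ball_ne_zero c hR) (volume_ball_ne_top c R)
    rw [le_div_iff₀ hpos] at h
    calc _ = ENNReal.ofReal (φ.normed volume x) * ENNReal.ofReal (volume (ball c R)).toReal := by
          rw [ENNReal.ofReal_toReal (volume_ball_ne_top c R)]
      _ ≤ _ := by
          rw [← ENNReal.ofReal_mul (φ.nonneg_normed x)]
          exact ENNReal.ofReal_le_ofReal h
  · have : φ.normed volume x = 0 := by
      rw [← Function.notMem_support, φ.support_normed_eq, hout]; exact hx
    simp [this]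

/-- **Smooth Calderón–Zygmund decomposition** of a test function at height `α`: all the pieces are
test functions, and there are finitely many of them. -/
theorem exists_smooth_decomposition (n : ℕ) [NeZero n] :
    ∃ C : ℝ≥0, 1 ≤ C ∧ ∀ (f : Test n) (α : ℝ≥0), 0 < α →
      ∃ (N : ℕ) (c : Fin N → E n) (R : Fin N → ℝ) (g : Test n) (b : Fin N → Test n),
        (∀ j, 0 < R j) ∧ f = g + ∑ j, b j ∧ (∀ x, ‖g x‖ₑ ≤ C * α) ∧
        ∫⁻ x, ‖g x‖ₑ ≤ C * ∫⁻ x, ‖f x‖ₑ ∧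
        (∀ j, tsupport (b j) ⊆ closedBall (c j) (8 * R j)) ∧
        (∀ j, ∫ x, b j x = 0) ∧
        (∀ j, ∫⁻ x, ‖b j x‖ₑ ≤ C * α * volume (ball (c j) (R j))) ∧
        α * ∑ j, volume (ball (c j) (R j)) ≤ ∫⁻ x, ‖f x‖ₑ := by
  -- `2 + 16 ^ n` serves the pointwise bound of the good part, `2 * 8 ^ n` the mass of each bad
  -- piece, and `1 + 2 * 8 ^ n` the mass of the good part.
  refine ⟨2 + 16 ^ n + 2 * 8 ^ n, by
    rw [add_assoc]; exact (by norm_num : (1 : ℝ≥0) ≤ 2).trans le_self_add, fun f α hα => ?_⟩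
  have hα' : (α : ℝ≥0∞) ≠ 0 := by simpa using hα.ne'
  set u : E n → ℝ≥0∞ := fun x => (α : ℝ≥0∞)⁻¹ * ‖f x‖ₑ with hu_def
  have hu_set : ∀ s : Set (E n), ∫⁻ x in s, u x = (α : ℝ≥0∞)⁻¹ * ∫⁻ x in s, ‖f x‖ₑ := fun s =>
    lintegral_const_mul' _ _ (ENNReal.inv_ne_top.2 hα')
  have hu_int : ∫⁻ x, u x = (α : ℝ≥0∞)⁻¹ * ∫⁻ x, ‖f x‖ₑ :=
    lintegral_const_mul' _ _ (ENNReal.inv_ne_top.2 hα')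
  have hu_fin : ∫⁻ x, u x ≠ ∞ := by
    rw [hu_int]; exact ENNReal.mul_ne_top (ENNReal.inv_ne_top.2 hα') f.lintegral_enorm_ne_top
  -- At a point of `K` the modulus of `f` exceeds `α` on a whole small ball, by continuity; this
  -- starts the search for a stopping radius. Compactness of `K` leaves finitely many balls, so the
  -- good part is again a test function and `T` is applied to a finite sum.
  set K : Set (E n) := {x | 2 * (α : ℝ) ≤ ‖f x‖} with hK_def
  have hα0 : (0 : ℝ) < α := hα
  have hK : IsCompact K := f.isCompact_le_norm (by positivity)
  -- stopping radii
  have hrad : ∀ x ∈ K, ∃ R, 0 < R ∧ volume (ball x R) ≤ ∫⁻ y in ball x R, u y ∧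
      ∫⁻ y in ball x (8 * R), u y < volume (ball x (8 * R)) := by
    intro x hx
    have hev : ∀ᶠ y in 𝓝 x, (α : ℝ) < ‖f y‖ :=
      f.continuous.norm.continuousAt.eventually (lt_mem_nhds (by
        have : 2 * (α : ℝ) ≤ ‖f x‖ := hx
        linarith))
    obtain ⟨R₀, hR₀, hball⟩ := Metric.eventually_nhds_iff_ball.1 hev
    refine exists_ball_scale x hu_fin (by norm_num) hR₀ ?_
    calc volume (ball x R₀) = ∫⁻ y in ball x R₀, 1 := by simp
      _ ≤ ∫⁻ y in ball x R₀, u y := by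
        refine setLIntegral_mono' measurableSet_ball fun y hy => ?_
        have h1 : (α : ℝ≥0∞) ≤ ‖f y‖ₑ := by
          rw [enorm_eq_nnnorm]
          exact_mod_cast (hball y hy).le
        calc (1 : ℝ≥0∞) = (α : ℝ≥0∞)⁻¹ * α := (ENNReal.inv_mul_cancel hα' ENNReal.coe_ne_top).symm
          _ ≤ (α : ℝ≥0∞)⁻¹ * ‖f y‖ₑ := by gcongr
  choose! r hr0 hr1 hr2 using hrad
  obtain ⟨t, htK, hcov⟩ := hK.elim_nhds_subcover (fun x => ball x (r x))
    (fun x hx => ball_mem_nhds x (hr0 x hx))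
  obtain ⟨w, hwt, hw, hdisj, hcov', hsum⟩ := exists_disjoint_balls (t : Set (E n)) id r
    (fun a ha => hr0 a (htK a ha)) hu_fin (fun a ha => hr1 a (htK a ha))
  have hwfin : w.Finite := t.finite_toSet.subset hwt
  set W := hwfin.toFinset with hW
  set e := W.equivFin.symm with he
  set c : Fin W.card → E n := fun j => (e j : E n) with hc_def
  set R : Fin W.card → ℝ := fun j => r (c j) with hR_def
  have hcw : ∀ j, c j ∈ w := fun j => hwfin.mem_toFinset.1 (e j).2
  have hcK : ∀ j, c j ∈ K := fun j => htK _ (hwt (hcw j))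
  have hR : ∀ j, 0 < R j := fun j => hr0 _ (hcK j)
  have hcinj : Function.Injective c := Subtype.val_injective.comp e.injective
  have hd : ∀ i j, i ≠ j → Disjoint (ball (c i) (R i)) (ball (c j) (R j)) := fun i j hij =>
    hdisj (hcw i) (hcw j) (fun h => hij (hcinj h))
  have hKcov : ∀ x ∈ K, ∃ j, x ∈ ball (c j) (4 * R j) := by
    intro x hx
    obtain ⟨a, ha, hxa⟩ := mem_iUnion₂.1 (hcov hx)
    obtain ⟨b, hb, hab⟩ := hcov' a ha
    refine ⟨e.symm ⟨b, hwfin.mem_toFinset.2 hb⟩, ?_⟩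
    simpa [hc_def, hR_def] using hab hxa
  have hvol : ∀ j, α * volume (ball (c j) (8 * R j)) ≥ ∫⁻ y in ball (c j) (8 * R j), ‖f y‖ₑ := by
    intro j
    have := (hr2 _ (hcK j)).le
    rw [hu_set, mul_comm (α : ℝ≥0∞)⁻¹, ← div_eq_mul_inv,
      ENNReal.div_le_iff_le_mul (.inl hα') (.inl ENNReal.coe_ne_top),
      mul_comm (volume _)] at this
    exact this
  have hvol8 : ∀ j, volume (ball (c j) (8 * R j)) = 8 ^ n * volume (ball (c j) (R j)) := by
    intro j
    rw [volume_ball_mul (c j) (c j) (by norm_num) (hR j).le, ENNReal.ofReal_pow (by norm_num)]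
    norm_num
  have hsumvol : α * ∑ j, volume (ball (c j) (R j)) ≤ ∫⁻ x, ‖f x‖ₑ := by
    have h1 : ∑ j, volume (ball (c j) (R j)) = ∑' a : w, volume (ball (a : E n) (r a)) := by
      have : ∑ j, volume (ball (c j) (R j)) = ∑ a : W, volume (ball (a : E n) (r a)) :=
        Equiv.sum_comp e (fun a : W => volume (ball (a : E n) (r a)))
      rw [this, Finset.sum_coe_sort W (fun a => volume (ball a (r a))), ← Finset.tsum_subtype']
      have : (W : Set (E n)) = w := hwfin.coe_toFinset
      rw [this]
    rw [h1]
    calc _ ≤ α * ∫⁻ y, u y := by gcongr; exact hsum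
      _ = _ := by rw [hu_int, ← mul_assoc, ENNReal.mul_inv_cancel hα' ENNReal.coe_ne_top, one_mul]
  -- the partition of unity
  set φ : ∀ j, ContDiffBump (c j) := fun j =>
    ⟨4 * R j, 8 * R j, by linarith [hR j], by linarith [hR j]⟩ with hφ
  set η : ∀ j, ContDiffBump (c j) := fun j =>
    ⟨R j / 2, R j, by linarith [hR j], by linarith [hR j]⟩ with hη
  -- `ψ j` is what remains of `φ j` after the earlier bumps have taken their share. The `ψ j` add up
  -- to `1 - ∏ (1 - φ j)`, which is `1` on `K` because the 4-fold balls cover `K`.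
  set ψ : Fin W.card → E n → ℝ := fun j x => φ j x * ∏ i with i < j, (1 - φ i x) with hψ
  have hψsm : ∀ j, ContDiff ℝ (⊤ : ℕ∞) (ψ j) := fun j =>
    (φ j).contDiff.mul (contDiff_prod fun i _ => contDiff_const.sub (φ i).contDiff)
  have hψ01 : ∀ j x, 0 ≤ ψ j x ∧ ψ j x ≤ (ball (c j) (8 * R j)).indicator 1 x := by
    intro j x
    have hp0 : 0 ≤ ∏ i with i < j, (1 - φ i x) :=
      Finset.prod_nonneg fun i _ => sub_nonneg.2 (φ i).le_one
    have hp1 : ∏ i with i < j, (1 - φ i x) ≤ 1 :=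
      Finset.prod_le_one (fun i _ => sub_nonneg.2 (φ i).le_one)
        (fun i _ => by linarith [(φ i).nonneg (x := x)])
    refine ⟨mul_nonneg (φ j).nonneg hp0, ?_⟩
    by_cases hx : x ∈ ball (c j) (8 * R j)
    · rw [indicator_of_mem hx]
      exact mul_le_one₀ (φ j).le_one hp0 hp1
    · have : φ j x = 0 := by
        rw [← Function.notMem_support, (φ j).support_eq]; exact hx
      simp [hψ, this, indicator_of_notMem hx]
  have hψsum : ∀ x, ∏ j, (1 - φ j x) = 1 - ∑ j, ψ j x := fun x =>
    Finset.prod_one_sub_ordered Finset.univ (fun j => φ j x)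
  -- the pieces
  set a : Fin W.card → ℂ := fun j => ∫ x, f.smulSmooth (ψ j) (hψsm j) x with ha_def
  set ηT : Fin W.card → Test n := fun j =>
    Test.ofReal ((η j).normed volume) (η j).contDiff_normed (η j).hasCompactSupport_normed
  -- `ηT j` has integral one and lives in the ball of radius `R j`. These balls are disjoint, so the
  -- mean corrections `a j • ηT j` do not pile up in the good part.
  set b : Fin W.card → Test n := fun j => f.smulSmooth (ψ j) (hψsm j) - a j • ηT j with hb
  have hfψ : ∀ j, ∫⁻ x, ‖f.smulSmooth (ψ j) (hψsm j) x‖ₑ ≤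
      8 ^ n * (α * volume (ball (c j) (R j))) := by
    intro j
    calc _ ≤ ∫⁻ x in ball (c j) (8 * R j), ‖f x‖ₑ := by
          rw [← lintegral_indicator measurableSet_ball]
          refine lintegral_mono fun x => ?_
          rw [Test.smulSmooth_apply, enorm_mul]
          by_cases hx : x ∈ ball (c j) (8 * R j)
          · rw [indicator_of_mem hx]
            refine mul_le_of_le_one_left' ?_
            have := hψ01 j x
            rw [indicator_of_mem hx] at this
            have h2 : ‖(ψ j x : ℂ)‖ ≤ 1 := by
              rw [Complex.norm_real, Real.norm_of_nonneg this.1]; exact this.2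
            rw [enorm_eq_nnnorm]
            exact ENNReal.coe_le_coe.2 h2
          · have := hψ01 j x
            rw [indicator_of_notMem hx] at this
            simp [le_antisymm this.2 this.1]
      _ ≤ α * volume (ball (c j) (8 * R j)) := hvol j
      _ = _ := by rw [hvol8]; ring
  have ha : ∀ j, ‖a j‖ₑ ≤ 8 ^ n * (α * volume (ball (c j) (R j))) := fun j =>
    (enorm_integral_le_lintegral_enorm _).trans (hfψ j)
  have hηint : ∀ j, ∫⁻ x, ‖ηT j x‖ₑ = 1 := by
    intro j
    have h1 : ∀ x, ‖ηT j x‖ₑ = ENNReal.ofReal ((η j).normed volume x) := by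
      intro x
      rw [show ηT j x = (((η j).normed volume x : ℝ) : ℂ) from rfl, ← ofReal_norm,
        Complex.norm_real, Real.norm_of_nonneg ((η j).nonneg_normed x)]
    simp_rw [h1]
    rw [← ofReal_integral_eq_lintegral_ofReal (η j).integrable_normed
      (Eventually.of_forall fun x => (η j).nonneg_normed x), (η j).integral_normed,
      ENNReal.ofReal_one]
  have hbL1 : ∀ j, ∫⁻ x, ‖b j x‖ₑ ≤ 2 * 8 ^ n * α * volume (ball (c j) (R j)) := by
    intro j
    calc ∫⁻ x, ‖b j x‖ₑ ≤ ∫⁻ x, (‖f.smulSmooth (ψ j) (hψsm j) x‖ₑ + ‖a j‖ₑ * ‖ηT j x‖ₑ) := by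
          refine lintegral_mono fun x => ?_
          rw [hb, sub_apply, smul_apply, smul_eq_mul, ← enorm_mul]
          exact enorm_sub_le
      _ = (∫⁻ x, ‖f.smulSmooth (ψ j) (hψsm j) x‖ₑ) + ‖a j‖ₑ := by
          rw [lintegral_add_left (Test.measurable_enorm _), lintegral_const_mul' _ _ enorm_ne_top,
            hηint, mul_one]
      _ ≤ 8 ^ n * (α * volume (ball (c j) (R j))) + 8 ^ n * (α * volume (ball (c j) (R j))) :=
          add_le_add (hfψ j) (ha j)
      _ = _ := by ring
  refine ⟨W.card, c, R, f - ∑ j, b j, b, hR, by simp, ?_, ?_, ?_, ?_, ?_, hsumvol⟩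
  · intro x
    have hgx : (f - ∑ j, b j) x = (∏ j, (1 - φ j x) : ℝ) * f x + ∑ j, a j * ηT j x := by
      rw [sub_apply, Test.sum_apply, hψsum]
      simp only [hb, sub_apply, smul_apply, smul_eq_mul, Test.smulSmooth_apply,
        Finset.sum_sub_distrib, ← Finset.sum_mul]
      push_cast
      ring
    rw [hgx]
    have h1 : ‖((∏ j, (1 - φ j x) : ℝ) : ℂ) * f x‖ₑ ≤ 2 * α := by
      have hp0 : 0 ≤ ∏ i, (1 - φ i x) :=
        Finset.prod_nonneg fun i _ => sub_nonneg.2 (φ i).le_one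
      have hp1 : ∏ i, (1 - φ i x) ≤ 1 :=
        Finset.prod_le_one (fun i _ => sub_nonneg.2 (φ i).le_one)
          (fun i _ => by linarith [(φ i).nonneg (x := x)])
      have : ‖((∏ j, (1 - φ j x) : ℝ) : ℂ) * f x‖ ≤ 2 * α := by
        by_cases hx : x ∈ K
        · obtain ⟨j, hj⟩ := hKcov x hx
          have h0 : ∏ j, (1 - φ j x) = 0 := Finset.prod_eq_zero (Finset.mem_univ j) (by
            rw [(φ j).one_of_mem_closedBall (ball_subset_closedBall hj), sub_self])
          rw [h0]; simp
        · rw [norm_mul, Complex.norm_real, Real.norm_of_nonneg hp0]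
          have : ‖f x‖ < 2 * α := not_le.1 hx
          calc _ ≤ 1 * ‖f x‖ := by gcongr
            _ ≤ _ := by linarith
      rw [enorm_eq_nnnorm]; exact_mod_cast this
    have h2 : ∀ j, ‖a j * ηT j x‖ₑ ≤ (ball (c j) (R j)).indicator (fun _ => 16 ^ n * (α : ℝ≥0∞)) x := by
      intro j
      have h3 : ‖ηT j x‖ₑ = ENNReal.ofReal ((η j).normed volume x) := by
        rw [show ηT j x = (((η j).normed volume x : ℝ) : ℂ) from rfl, ← ofReal_norm,
          Complex.norm_real, Real.norm_of_nonneg ((η j).nonneg_normed x)]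
      rw [enorm_mul, h3]
      calc _ ≤ 8 ^ n * (α * volume (ball (c j) (R j))) * ENNReal.ofReal ((η j).normed volume x) := by
            gcongr; exact ha j
        _ = 8 ^ n * α * (ENNReal.ofReal ((η j).normed volume x) * volume (ball (c j) (R j))) := by
            ring
        _ ≤ 8 ^ n * α * (ball (c j) (R j)).indicator (fun _ => ENNReal.ofReal (2 ^ n)) x := by
            gcongr; exact bump_normed_le (c j) (hR j) (η j) rfl rfl x
        _ ≤ _ := by
            by_cases hx : x ∈ ball (c j) (R j)
            · rw [indicator_of_mem hx, indicator_of_mem hx, ENNReal.ofReal_pow (by norm_num)]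
              refine le_of_eq ?_
              rw [show (16 : ℝ≥0∞) = 8 * 2 by norm_num, mul_pow]
              norm_num
              ring
            · simp [indicator_of_notMem hx]
    have h4 : ‖∑ j, a j * ηT j x‖ₑ ≤ 16 ^ n * α := by
      refine (enorm_sum_le _ _).trans ((Finset.sum_le_sum fun j _ => h2 j).trans ?_)
      by_cases hx : ∃ j, x ∈ ball (c j) (R j)
      · obtain ⟨j, hj⟩ := hx
        rw [Finset.sum_eq_single j, indicator_of_mem hj]
        · intro i _ hij
          exact indicator_of_notMem (fun hi => (disjoint_left.1 (hd i j hij)) hi hj) _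
        · simp
      · push Not at hx
        rw [Finset.sum_eq_zero fun j _ => indicator_of_notMem (hx j) _]
        exact zero_le
    calc _ ≤ 2 * (α : ℝ≥0∞) + 16 ^ n * α := (enorm_add_le _ _).trans (add_le_add h1 h4)
      _ ≤ _ := by
        rw [← add_mul]
        refine mul_le_mul_left ?_ _
        push_cast
        exact le_self_add
  · calc ∫⁻ x, ‖(f - ∑ j, b j) x‖ₑ ≤ ∫⁻ x, (‖f x‖ₑ + ∑ j, ‖b j x‖ₑ) := by
          refine lintegral_mono fun x => ?_
          rw [sub_apply, Test.sum_apply]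
          exact enorm_sub_le.trans (by gcongr; exact enorm_sum_le _ _)
      _ = (∫⁻ x, ‖f x‖ₑ) + ∑ j, ∫⁻ x, ‖b j x‖ₑ := by
          rw [lintegral_add_left f.measurable_enorm,
            lintegral_finsetSum _ (fun j _ => (b j).measurable_enorm)]
      _ ≤ (∫⁻ x, ‖f x‖ₑ) + ∑ j, 2 * 8 ^ n * α * volume (ball (c j) (R j)) := by
          gcongr with j; exact hbL1 j
      _ = (∫⁻ x, ‖f x‖ₑ) + 2 * 8 ^ n * (α * ∑ j, volume (ball (c j) (R j))) := by
          rw [← Finset.mul_sum]; ring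
      _ ≤ (∫⁻ x, ‖f x‖ₑ) + 2 * 8 ^ n * ∫⁻ x, ‖f x‖ₑ := by gcongr
      _ = (1 + 2 * 8 ^ n) * ∫⁻ x, ‖f x‖ₑ := by ring
      _ ≤ _ := by
          refine mul_le_mul_left ?_ _
          push_cast
          exact add_le_add_left ((by norm_num : (1 : ℝ≥0∞) ≤ 2).trans le_self_add) _
  · intro j
    refine closure_minimal ?_ isClosed_closedBall
    intro x hx
    by_contra hx'
    refine hx ?_
    have hx8 : 8 * R j < dist x (c j) := not_le.1 hx'
    have h1 : φ j x = 0 := by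
      rw [← Function.notMem_support, (φ j).support_eq]
      intro h
      exact absurd (mem_ball.1 h) (not_lt.2 hx8.le)
    have h2 : (η j).normed volume x = 0 := by
      rw [← Function.notMem_support, (η j).support_normed_eq]
      intro h
      have h3 : dist x (c j) < R j := h
      linarith [hR j]
    rw [hb, sub_apply, smul_apply, Test.smulSmooth_apply]
    simp [hψ, h1, ηT, h2]
  · intro j
    have h1 : ∫ x, b j x = ∫ x, (f.smulSmooth (ψ j) (hψsm j) x - a j * ηT j x) := by
      congr 1
    rw [h1, integral_sub (Test.integrable _) ((Test.integrable _).const_mul _),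
      integral_const_mul]
    have h2 : ∫ x, ηT j x = 1 := by
      have : ∫ x, ηT j x = ∫ x, (((η j).normed volume x : ℝ) : ℂ) := rfl
      rw [this, integral_complex_ofReal, (η j).integral_normed, Complex.ofReal_one]
    rw [h2, mul_one, sub_self]
  · intro j
    refine (hbL1 j).trans (mul_le_mul_left (mul_le_mul_left ?_ _) _)
    push_cast
    exact le_add_self

end Decomposition

/-! ### Regularity, continuity and integrability of the kernel. -/

section Kernel

/-- By monotonicity `ω q / 2` is at most the integral of `ω t / t` over `[q, 2 q)`, and the dyadic
intervals of this form are disjoint in `(0, 1)`. -/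
theorem IsDiniModulus.summable {ω : ℝ → ℝ} (hω : IsDiniModulus ω) :
    Summable fun l : ℕ => ω ((1 / 2) ^ (l + 1)) := by
  set s : ℕ → Set ℝ := fun l => Ico ((1 / 2 : ℝ) ^ (l + 1 + 1)) ((1 / 2) ^ (l + 1)) with hs
  have hanti : Antitone fun l : ℕ => (1 / 2 : ℝ) ^ (l + 1) := fun i j hij =>
    pow_le_pow_of_le_one (by norm_num) (by norm_num) (by omega)
  have hdisj : Pairwise (Function.onFun Disjoint s) := hanti.pairwise_disjoint_on_Ico_succ
  have hsub : ⋃ l, s l ⊆ Ioo (0 : ℝ) 1 := by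
    refine iUnion_subset fun l t ht => ⟨lt_of_lt_of_le (by positivity) ht.1, ht.2.trans_le ?_⟩
    exact pow_le_one₀ (by norm_num) (by norm_num)
  have hint := hω.dini.mono_set hsub
  have hsum := (hasSum_integral_iUnion (fun l => measurableSet_Ico) hdisj hint).summable
  have hpos : ∀ l : ℕ, (1 / 2 : ℝ) ^ (l + 1) ∈ Ico (0 : ℝ) 1 := fun l =>
    ⟨by positivity, pow_lt_one₀ (by norm_num) (by norm_num) (by omega)⟩
  -- The first term is dropped so that the interval `s l` starts at the sampling point.
  rw [← summable_nat_add_iff 1]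
  refine Summable.of_nonneg_of_le (fun l => hω.nonneg _ (hpos _)) (fun l => ?_) (hsum.mul_left 2)
  set q : ℝ := (1 / 2) ^ (l + 1 + 1) with hq
  have hq0 : 0 < q := by positivity
  have h2q : (1 / 2 : ℝ) ^ (l + 1) = 2 * q := by rw [hq, pow_succ]; ring
  have hsl : s l = Ico q (2 * q) := by simp only [hs, h2q, ← hq]
  have hq1 : 2 * q ≤ 1 := by rw [← h2q]; exact pow_le_one₀ (by norm_num) (by norm_num)
  have h1 : ∫ t in s l, ω q / (2 * q) ≤ ∫ t in s l, ω t / t := by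
    refine setIntegral_mono_on (by rw [hsl]; simp) (hint.mono_set (subset_iUnion s l))
      measurableSet_Ico fun t ht => ?_
    rw [hsl] at ht
    have ht0 : 0 < t := hq0.trans_le ht.1
    have ht1 : t < 1 := ht.2.trans_le hq1
    have hωq : 0 ≤ ω q := hω.nonneg _ ⟨hq0.le, by linarith⟩
    calc ω q / (2 * q) ≤ ω q / t := div_le_div_of_nonneg_left hωq ht0 ht.2.le
      _ ≤ ω t / t := by
        gcongr
        exact hω.mono ⟨hq0.le, by linarith⟩ ⟨ht0.le, ht1⟩ ht.1
  have h2 : ∫ t in s l, ω q / (2 * q) = ω q / 2 := by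
    rw [hsl, setIntegral_const, measureReal_def, Real.volume_Ico,
      ENNReal.toReal_ofReal (by linarith), smul_eq_mul]
    field_simp
    ring
  linarith

variable {n m : ℕ}

/-- Kernel regularity with the modulus of continuity sampled along a dyadic sequence. -/
def IsRegularKernel (K : E n → (Fin m → E n) → ℂ) (a : ℕ → ℝ≥0) : Prop :=
  ∀ (x : E n) (y : Fin m → E n) (h : E n) (l : ℕ), (∃ i, y i ≠ x) →
    (∃ i, ‖h‖ ≤ ‖x - y i‖ / 2) → 2 ^ (l + 1) * ‖h‖ ≤ ∑ i, ‖x - y i‖ →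
    ‖K (x + h) y - K x y‖ ≤ a l / (∑ i, ‖x - y i‖) ^ (m * n) ∧
    ∀ i, ‖K x (Function.update y i (y i + h)) - K x y‖ ≤ a l / (∑ i, ‖x - y i‖) ^ (m * n)

theorem sum_norm_pos {x : E n} {y : Fin m → E n} (h : ∃ i, y i ≠ x) :
    0 < ∑ i, ‖x - y i‖ := by
  obtain ⟨i, hi⟩ := h
  exact Finset.sum_pos' (fun _ _ => norm_nonneg _) ⟨i, Finset.mem_univ i,
    norm_pos_iff.2 (sub_ne_zero.2 hi.symm)⟩

/-- Monotonicity replaces `ω (‖h‖ / S)` by its value at `2 ^ (-(l + 1))`. Sampling starts at `1 / 2`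
because `ω` is controlled only on `[0, 1)`. -/
theorem IsCZKernel.exists_isRegularKernel {K : E n → (Fin m → E n) → ℂ} (hK : IsCZKernel K) :
    ∃ a : ℕ → ℝ≥0, Summable a ∧ IsRegularKernel K a := by
  obtain ⟨C, ω, hC, hω, -, hreg⟩ := hK
  have hpos : ∀ l : ℕ, (1 / 2 : ℝ) ^ (l + 1) ∈ Ico (0 : ℝ) 1 := fun l =>
    ⟨by positivity, pow_lt_one₀ (by norm_num) (by norm_num) (by omega)⟩
  refine ⟨fun l => NNReal.mk (C * ω ((1 / 2) ^ (l + 1))) (mul_nonneg hC.le (hω.nonneg _ (hpos l))),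
    ?_, ?_⟩
  · rw [← NNReal.summable_coe]
    exact hω.summable.mul_left C
  · intro x y h l hy hh hl
    have hS := sum_norm_pos hy
    set S := ∑ i, ‖x - y i‖
    have h1 := hreg x y h hy hh
    have h2 : ‖h‖ / S ≤ (1 / 2) ^ (l + 1) := by
      rw [div_le_iff₀ hS, one_div, inv_pow, inv_mul_eq_div, le_div_iff₀ (by positivity)]
      linarith
    have h3 : ω (‖h‖ / S) ≤ ω ((1 / 2) ^ (l + 1)) :=
      hω.mono ⟨by positivity, h2.trans_lt (hpos l).2⟩ (hpos l) h2
    have h4 : C / S ^ (m * n) * ω (‖h‖ / S) ≤ C * ω ((1 / 2) ^ (l + 1)) / S ^ (m * n) := by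
      rw [div_mul_eq_mul_div]; gcongr
    have hs0 : 0 ≤ ∑ i, ‖K x (Function.update y i (y i + h)) - K x y‖ :=
      Finset.sum_nonneg fun _ _ => norm_nonneg _
    refine ⟨?_, fun i => ?_⟩
    · change _ ≤ C * ω ((1 / 2) ^ (l + 1)) / S ^ (m * n)
      linarith
    · change _ ≤ C * ω ((1 / 2) ^ (l + 1)) / S ^ (m * n)
      have := Finset.single_le_sum (f := fun i => ‖K x (Function.update y i (y i + h)) - K x y‖)
        (fun _ _ => norm_nonneg _) (Finset.mem_univ i)
      have h5 := norm_nonneg (K (x + h) y - K x y)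
      linarith

/-- The variables are moved one at a time, and a move costs a multiple of `a l` with `l` as large as
desired once the increment is small, since `∑ ‖x - y i‖` stays away from zero. As the kernel is not
assumed measurable, this is what makes the kernel integrals meaningful. -/
theorem IsRegularKernel.continuousOn {K : E n → (Fin m → E n) → ℂ} {a : ℕ → ℝ≥0}
    (hK : IsRegularKernel K a) (ha : Summable a) (x : E n) :
    ContinuousOn (K x) {y | ∃ i, y i ≠ x} := by
  intro y₀ hy₀
  refine ContinuousAt.continuousWithinAt ?_
  have key : ∀ s : Finset (Fin m),
      Tendsto (fun y : Fin m → E n => K x (s.piecewise y y₀)) (𝓝 y₀) (𝓝 (K x y₀)) := by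
    intro s
    induction s using Finset.induction_on with
    | empty => simp
    | insert i s hi ih =>
      have hcont : Continuous fun y : Fin m → E n => s.piecewise y y₀ := by
        refine continuous_pi fun j => ?_
        by_cases hj : j ∈ s
        · simpa [hj] using continuous_apply j
        · simpa [hj] using continuous_const
      have hp0 : s.piecewise y₀ y₀ = y₀ := by ext j; by_cases hj : j ∈ s <;> simp [hj]
      have hSc : Tendsto (fun y : Fin m → E n => ∑ j, ‖x - s.piecewise y y₀ j‖) (𝓝 y₀)
          (𝓝 (∑ j, ‖x - y₀ j‖)) := by
        have : Continuous fun y : Fin m → E n => ∑ j, ‖x - s.piecewise y y₀ j‖ := by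
          refine continuous_finsetSum _ fun j _ => (continuous_const.sub ?_).norm
          exact (continuous_apply j).comp hcont
        have h := this.tendsto y₀
        rwa [hp0] at h
      have hS := sum_norm_pos hy₀
      generalize ∑ j, ‖x - y₀ j‖ = S at hS hSc
      obtain ⟨k, hk⟩ := hy₀
      have hk0 : 0 < ‖x - y₀ k‖ := norm_pos_iff.2 (sub_ne_zero.2 hk.symm)
      have hkc : ∀ᶠ y in 𝓝 y₀, ‖x - y₀ k‖ / 2 < ‖x - s.piecewise y y₀ k‖ := by
        have : Continuous fun y : Fin m → E n => ‖x - s.piecewise y y₀ k‖ :=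
          (continuous_const.sub ((continuous_apply k).comp hcont)).norm
        have h := this.tendsto y₀
        rw [hp0] at h
        exact h.eventually (lt_mem_nhds (by linarith))
      have hdiff : Tendsto (fun y : Fin m → E n => K x ((insert i s).piecewise y y₀) -
          K x (s.piecewise y y₀)) (𝓝 y₀) (𝓝 0) := by
        rw [Metric.tendsto_nhds]
        intro ε hε
        have ha0 : Tendsto (fun l => (a l : ℝ)) atTop (𝓝 0) :=
          (NNReal.summable_coe.2 ha).tendsto_atTop_zero
        obtain ⟨l, hl⟩ : ∃ l, (a l : ℝ) / (S / 2) ^ (m * n) < ε := by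
          have := ha0.div_const ((S / 2) ^ (m * n))
          rw [zero_div] at this
          exact (this.eventually (gt_mem_nhds hε)).exists
        have hh : Tendsto (fun y : Fin m → E n => ‖y i - y₀ i‖) (𝓝 y₀) (𝓝 0) := by
          have : Continuous fun y : Fin m → E n => ‖y i - y₀ i‖ :=
            ((continuous_apply i).sub continuous_const).norm
          simpa using this.tendsto y₀
        have d0 : 0 < S / 2 := half_pos hS
        have d1 : S / 2 < S := half_lt_self hS
        have d2 : 0 < ‖x - y₀ k‖ / 4 := div_pos hk0 (by norm_num)
        have d3 : 0 < S / 2 / 2 ^ (l + 1) := div_pos d0 (by positivity)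
        have g1 := hSc.eventually (lt_mem_nhds d1)
        have g2 := hh.eventually (gt_mem_nhds d2)
        have g3 := hh.eventually (gt_mem_nhds d3)
        filter_upwards [hkc, g1, g2, g3] with y h1 h2 h3 h4
        have hne : s.piecewise y y₀ k ≠ x := by
          intro h; rw [h, sub_self, norm_zero] at h1; linarith
        have e1 : ‖y i - y₀ i‖ ≤ ‖x - s.piecewise y y₀ k‖ / 2 :=
          (h3.trans (by linarith)).le
        have e2 : 2 ^ (l + 1) * ‖y i - y₀ i‖ ≤ ∑ j, ‖x - s.piecewise y y₀ j‖ := by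
          rw [lt_div_iff₀ (by positivity), mul_comm] at h4
          exact (h4.trans h2).le
        have hr := (hK x (s.piecewise y y₀) (y i - y₀ i) l ⟨k, hne⟩ ⟨k, e1⟩ e2).2 i
        have hup : Function.update (s.piecewise y y₀) i (s.piecewise y y₀ i + (y i - y₀ i)) =
            (insert i s).piecewise y y₀ := by
          rw [Finset.piecewise_insert]
          congr 1
          simp [hi]
        rw [hup] at hr
        rw [dist_zero_right]
        exact hr.trans_lt (lt_of_le_of_lt (div_le_div_of_nonneg_left (a l).2 (pow_pos d0 _)
          (pow_le_pow_left₀ d0.le h2.le _)) hl)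
      have := hdiff.add ih
      simpa using this
  rw [ContinuousAt]
  simpa using key Finset.univ

theorem integrable_of_continuousOn_mul_prod {G : (Fin m → E n) → ℂ} {f : Fin m → Test n}
    (hG : ContinuousOn G (univ.pi fun k => tsupport (f k))) :
    Integrable fun y : Fin m → E n => G y * ∏ k, f k (y k) := by
  set P : Set (Fin m → E n) := univ.pi fun k => tsupport (f k)
  have hP : IsCompact P := isCompact_univ_pi fun k => (f k).hasCompactSupport
  have hsupp : Function.support (fun y : Fin m → E n => G y * ∏ k, f k (y k)) ⊆ P := by
    intro y hy k _
    have h1 : ∏ k, f k (y k) ≠ 0 := right_ne_zero_of_mul hy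
    exact subset_tsupport _ (Finset.prod_ne_zero_iff.1 h1 k (Finset.mem_univ k))
  rw [← integrableOn_iff_integrable_of_support_subset hsupp]
  refine ContinuousOn.integrableOn_compact hP (hG.mul ?_)
  exact (continuous_finsetProd _ fun k _ =>
    (f k).continuous.comp (continuous_apply k)).continuousOn

/-- For such `x` the compact product of the supports avoids the point `(x, …, x)`, so `K x` is
continuous on it. -/
theorem IsRegularKernel.integrable {K : E n → (Fin m → E n) → ℂ} {a : ℕ → ℝ≥0}
    (hK : IsRegularKernel K a) (ha : Summable a) {x : E n} {f : Fin m → Test n}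
    (hx : x ∉ ⋂ i, tsupport (f i)) :
    Integrable fun y : Fin m → E n => K x y * ∏ k, f k (y k) := by
  refine integrable_of_continuousOn_mul_prod ((hK.continuousOn ha x).mono fun y hy => ?_)
  rw [mem_iInter] at hx
  push Not at hx
  obtain ⟨i, hi⟩ := hx
  exact ⟨i, fun h => hi (h ▸ hy i (mem_univ i))⟩

/-- The value of the kernel with the `i`-th variable frozen integrates to zero against a product
whose `i`-th factor has mean zero. -/
theorem integral_update_mul_prod_eq_zero (G : (Fin m → E n) → ℂ) (f : Fin m → Test n) (i : Fin m)
    (hi : ∫ z, f i z = 0) (c : E n) :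
    ∫ y : Fin m → E n, G (Function.update y i c) * ∏ k, f k (y k) = 0 := by
  obtain ⟨m, rfl⟩ : ∃ m', m = m' + 1 := ⟨m - 1, by have := i.2; omega⟩
  have hmp := (volume_preserving_piFinSuccAbove (fun _ : Fin (m + 1) => E n) i).symm
  rw [← hmp.integral_comp (MeasurableEquiv.measurableEmbedding _)]
  have h1 : ∀ z : E n × (Fin m → E n),
      G (Function.update ((MeasurableEquiv.piFinSuccAbove (fun _ => E n) i).symm z) i c) *
        ∏ k, f k (((MeasurableEquiv.piFinSuccAbove (fun _ => E n) i).symm z) k) =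
      f i z.1 * (G (i.insertNth c z.2) * ∏ k, f (i.succAbove k) (z.2 k)) := by
    intro z
    have h2 : (MeasurableEquiv.piFinSuccAbove (fun _ : Fin (m + 1) => E n) i).symm z =
        i.insertNth (α := fun _ => E n) z.1 z.2 := rfl
    rw [h2, Fin.update_insertNth, Fin.prod_univ_succAbove _ i]
    simp only [Fin.insertNth_apply_same, Fin.insertNth_apply_succAbove]
    ring
  simp_rw [h1]
  change ∫ z : E n × (Fin m → E n), _ ∂((volume : Measure (E n)).prod volume) = 0
  -- `integral_prod_mul` holds without integrability, so `G` may be arbitrary.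
  rw [integral_prod_mul (fun z => f i z)
    (fun w : Fin m → E n => G (i.insertNth c w) * ∏ k, f (i.succAbove k) (w k)), hi, zero_mul]

theorem lintegral_pi_prod : ∀ {m : ℕ} (F : Fin m → E n → ℝ≥0∞), (∀ k, Measurable (F k)) →
    ∫⁻ y : Fin m → E n, ∏ k, F k (y k) = ∏ k, ∫⁻ z, F k z := by
  intro m
  induction m with
  | zero =>
    intro F _
    rw [volume_pi]
    simp
  | succ m ih =>
    intro F hF
    have hmp := (volume_preserving_piFinSuccAbove (fun _ : Fin (m + 1) => E n) 0).symm
    rw [← hmp.lintegral_comp_emb (MeasurableEquiv.measurableEmbedding _)]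
    have h1 : ∀ z : E n × (Fin m → E n),
        ∏ k, F k (((MeasurableEquiv.piFinSuccAbove (fun _ => E n) 0).symm z) k) =
        F 0 z.1 * ∏ k : Fin m, F k.succ (z.2 k) := by
      intro z
      rw [Fin.prod_univ_succ]
      rfl
    simp_rw [h1]
    change ∫⁻ z : E n × (Fin m → E n), _ ∂((volume : Measure (E n)).prod volume) = _
    rw [lintegral_prod_mul (f := F 0) (g := fun w : Fin m → E n => ∏ k : Fin m, F k.succ (w k))
      (hF 0).aemeasurable (Finset.measurable_prod _ fun k _ =>
        (hF k.succ).comp (measurable_pi_apply k)).aemeasurable, ih _ fun k => hF _,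
      Fin.prod_univ_succ]

/-- Dyadic decomposition of an integral over `(ℝⁿ)^m` according to the size of
`∑ i, ‖x - y i‖`. -/
theorem lintegral_le_tsum_of_dyadic (x : E n) {ρ : ℝ} (hρ : 0 < ρ) {u : (Fin m → E n) → ℝ≥0∞}
    {Φ : ℕ → ℝ≥0∞} {F : Fin m → E n → ℝ≥0∞} (hF : ∀ k, Measurable (F k))
    (h0 : ∀ y, ∑ i, ‖x - y i‖ < ρ → u y = 0)
    (h : ∀ l y, 2 ^ l * ρ ≤ ∑ i, ‖x - y i‖ → ∑ i, ‖x - y i‖ < 2 ^ (l + 1) * ρ →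
      u y ≤ Φ l * ∏ k, F k (y k)) :
    ∫⁻ y, u y ≤ ∑' l, Φ l * ∏ k, ∫⁻ z in ball x (2 ^ (l + 1) * ρ), F k z := by
  have hmeas : ∀ l k, Measurable ((ball x (2 ^ (l + 1) * ρ)).indicator (F k)) := fun l k =>
    (hF k).indicator measurableSet_ball
  have hle : ∀ y, u y ≤ ∑' l, Φ l * ∏ k, (ball x (2 ^ (l + 1) * ρ)).indicator (F k) (y k) := by
    intro y
    rcases lt_or_ge (∑ i, ‖x - y i‖) ρ with hS | hS
    · rw [h0 y hS]; exact zero_le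
    -- `l` is the dyadic shell of `y`. No single distance exceeds the sum, so every coordinate lies
    -- in the ball of radius `2 ^ (l + 1) * ρ` about `x`.
    · obtain ⟨l, hl1, hl2⟩ := exists_nat_pow_near (x := (∑ i, ‖x - y i‖) / ρ)
        ((one_le_div hρ).2 hS) (one_lt_two)
      rw [le_div_iff₀ hρ] at hl1
      rw [div_lt_iff₀ hρ] at hl2
      refine le_trans ?_ (ENNReal.le_tsum l)
      refine (h l y hl1 hl2).trans (le_of_eq ?_)
      congr 1
      refine Finset.prod_congr rfl fun k _ => ?_
      rw [indicator_of_mem]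
      rw [mem_ball, dist_comm, dist_eq_norm]
      refine lt_of_le_of_lt ?_ hl2
      exact Finset.single_le_sum (f := fun i => ‖x - y i‖) (fun _ _ => norm_nonneg _)
        (Finset.mem_univ k)
  calc ∫⁻ y, u y
      ≤ ∫⁻ y : Fin m → E n, ∑' l, Φ l * ∏ k, (ball x (2 ^ (l + 1) * ρ)).indicator (F k) (y k) :=
        lintegral_mono hle
    _ = ∑' l, ∫⁻ y : Fin m → E n, Φ l * ∏ k, (ball x (2 ^ (l + 1) * ρ)).indicator (F k) (y k) :=
        lintegral_tsum fun l => (Measurable.const_mul (Finset.measurable_prod _ fun k _ =>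
          (hmeas l k).comp (measurable_pi_apply k)) _).aemeasurable
    _ = ∑' l, Φ l * ∏ k, ∫⁻ z in ball x (2 ^ (l + 1) * ρ), F k z := by
        refine tsum_congr fun l => ?_
        have hm : Measurable fun y : Fin m → E n =>
            ∏ k, (ball x (2 ^ (l + 1) * ρ)).indicator (F k) (y k) :=
          Finset.measurable_prod _ fun k _ => (hmeas l k).comp (measurable_pi_apply k)
        rw [lintegral_const_mul _ hm, lintegral_pi_prod _ (hmeas l)]
        simp_rw [lintegral_indicator measurableSet_ball]

end Kernel

/-! ### Kernel estimates in terms of maximal functions. -/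

section KernelBounds

variable {n m : ℕ} [NeZero n]

/-- The ratio between the volume of a ball of radius `2 ρ` and `ρ ^ n`. -/
noncomputable def ballConst (n : ℕ) : ℝ≥0∞ :=
  ENNReal.ofReal (2 ^ n) * volume (ball (0 : E n) 1)

theorem ballConst_ne_top : ballConst n ≠ ∞ :=
  ENNReal.mul_ne_top ENNReal.ofReal_ne_top (volume_ball_ne_top _ _)

/-- Powers of the distance are traded for volumes of balls, so that each of the `m` inverse volumes
can turn an integral over a ball into an average. -/
theorem ofReal_div_pow_le (m : ℕ) (x : E n) (a : ℝ≥0) {ρ S : ℝ} (hρ : 0 < ρ) (hS : ρ ≤ S) :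
    ENNReal.ofReal (a / S ^ (m * n)) ≤
      a * (ballConst n * (volume (ball x (2 * ρ)))⁻¹) ^ m := by
  have h0 := volume_ball_ne_zero (0 : E n) one_pos
  have h1 := volume_ball_ne_top (0 : E n) 1
  have h2 : ballConst n * (volume (ball x (2 * ρ)))⁻¹ = ENNReal.ofReal (ρ ^ n)⁻¹ := by
    have hp : ENNReal.ofReal (2 ^ n) * volume (ball (0 : E n) 1) ≠ 0 :=
      mul_ne_zero (by simp) h0
    rw [ballConst, volume_ball_eq x (by positivity), mul_pow, ENNReal.ofReal_mul (by positivity),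
      mul_right_comm _ (ENNReal.ofReal (ρ ^ n)), ENNReal.mul_inv (.inl hp)
        (.inl (ENNReal.mul_ne_top ENNReal.ofReal_ne_top h1)), ← mul_assoc,
      ENNReal.mul_inv_cancel hp (ENNReal.mul_ne_top ENNReal.ofReal_ne_top h1), one_mul,
      ENNReal.ofReal_inv_of_pos (by positivity)]
  rw [h2, ← ENNReal.ofReal_pow (by positivity), ← ENNReal.ofReal_coe_nnreal,
    ← ENNReal.ofReal_mul a.coe_nonneg]
  refine ENNReal.ofReal_le_ofReal ?_
  rw [div_eq_mul_inv, inv_pow, ← pow_mul, mul_comm n m]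
  gcongr

theorem enorm_le_ofReal_of_norm_le {z : ℂ} {t : ℝ} (h : ‖z‖ ≤ t) : ‖z‖ₑ ≤ ENNReal.ofReal t := by
  rw [← ofReal_norm]; exact ENNReal.ofReal_le_ofReal h

theorem enorm_prod (s : Finset (Fin m)) (g : Fin m → ℂ) : ‖∏ k ∈ s, g k‖ₑ = ∏ k ∈ s, ‖g k‖ₑ := by
  simp only [enorm_eq_nnnorm, nnnorm_prod, ENNReal.ofNNReal_finsetProd]

/-- Oscillation over a ball of the kernel integral, when one of the functions vanishes on the
double of that ball. -/
theorem enorm_integral_sub_integral_le {K : E n → (Fin m → E n) → ℂ} {a : ℕ → ℝ≥0}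
    (hK : IsRegularKernel K a) (ha : Summable a) {c x z : E n} {R : ℝ} (hx : x ∈ ball c R)
    (hz : z ∈ ball c R) {f F : Fin m → Test n} (hfF : ∀ k y, ‖f k y‖ₑ ≤ ‖F k y‖ₑ) (k₀ : Fin m)
    (hk₀ : ∀ y ∈ ball c (2 * R), f k₀ y = 0) :
    ‖(∫ y : Fin m → E n, K x y * ∏ k, f k (y k)) - ∫ y : Fin m → E n, K c y * ∏ k, f k (y k)‖ₑ ≤
      ballConst n ^ m * (∑' l, (a l : ℝ≥0∞)) * ∏ k, maxFun (fun y => ‖F k y‖ₑ) z := by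
  have hR : 0 < R := pos_of_mem_ball hx
  have hsub : tsupport (f k₀) ⊆ (ball c (2 * R))ᶜ :=
    closure_minimal (fun y hy hy' => hy (hk₀ y hy')) isOpen_ball.isClosed_compl
  have hmem : ∀ w ∈ ball c R, w ∉ ⋂ i, tsupport (f i) := fun w hw hw' =>
    hsub (mem_iInter.1 hw' k₀) (ball_subset_ball (by linarith) hw)
  have hρ : (0 : ℝ) < 2 * R := by linarith
  have hxc : ‖x - c‖ < R := by rw [← dist_eq_norm]; exact hx
  rw [← integral_sub (hK.integrable ha (hmem x hx)) (hK.integrable ha (hmem c (mem_ball_self hR)))]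
  refine (enorm_integral_le_lintegral_enorm _).trans ?_
  -- With `ρ = 2 R`, the sum of distances on shell `l` is at least `2 ^ (l + 1) * R`, and the
  -- displacement `x - c` is shorter than `R`; hence `a l` applies on shell `l`. The region inside
  -- the first shell contributes nothing because `f k₀` vanishes there.
  refine (lintegral_le_tsum_of_dyadic c hρ (F := fun k y => ‖F k y‖ₑ)
    (Φ := fun l => a l * (ballConst n * (volume (ball c (2 * (2 ^ l * (2 * R)))))⁻¹) ^ m)
    (fun k => (F k).measurable_enorm) ?_ ?_).trans ?_
  · intro y hy
    have h1 : y k₀ ∈ ball c (2 * R) := by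
      rw [mem_ball, dist_comm, dist_eq_norm]
      exact (Finset.single_le_sum (f := fun i => ‖c - y i‖) (fun _ _ => norm_nonneg _)
        (Finset.mem_univ k₀)).trans_lt hy
    rw [Finset.prod_eq_zero (Finset.mem_univ k₀) (hk₀ _ h1)]
    simp
  · intro l y hl _
    rw [← sub_mul, enorm_mul, enorm_prod]
    by_cases h0 : f k₀ (y k₀) = 0
    · rw [Finset.prod_eq_zero (Finset.mem_univ k₀) (by rw [h0, enorm_zero])]
      simp
    have h1 : 2 * R ≤ ‖c - y k₀‖ := by
      rw [← dist_eq_norm, dist_comm]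
      exact not_lt.1 fun h => h0 (hk₀ _ h)
    refine mul_le_mul' ?_ (Finset.prod_le_prod' fun k _ => hfF k _)
    have hne : y k₀ ≠ c := by
      rintro h; rw [h, sub_self, norm_zero] at h1; linarith
    have h2 := (hK c y (x - c) l ⟨k₀, hne⟩ ⟨k₀, by linarith⟩ (le_trans (by
      rw [pow_succ, mul_assoc]; gcongr) hl)).1
    rw [add_sub_cancel] at h2
    exact (enorm_le_ofReal_of_norm_le h2).trans
      (ofReal_div_pow_le m c (a l) (mul_pos (by positivity) hρ) hl)
  · rw [mul_assoc, ← ENNReal.tsum_mul_right, ← ENNReal.tsum_mul_left]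
    refine ENNReal.tsum_le_tsum fun l => ?_
    have hrad : 2 * (2 ^ l * (2 * R)) = 2 ^ (l + 1) * (2 * R) := by ring
    rw [hrad]
    set V := volume (ball c (2 ^ (l + 1) * (2 * R)))
    have hV0 : V ≠ 0 := volume_ball_ne_zero _ (by positivity)
    have hV : V ≠ ∞ := volume_ball_ne_top _ _
    have hzb : z ∈ ball c (2 ^ (l + 1) * (2 * R)) := by
      refine ball_subset_ball ?_ hz
      have : (1 : ℝ) ≤ 2 ^ (l + 1) := one_le_pow₀ (by norm_num)
      nlinarith
    calc _ ≤ a l * (ballConst n * V⁻¹) ^ m * ∏ k, (V * maxFun (fun y => ‖F k y‖ₑ) z) := by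
          gcongr with k
          exact lintegral_ball_le_maxFun _ hzb
      _ = ballConst n ^ m * (a l * ∏ k, maxFun (fun y => ‖F k y‖ₑ) z) * (V⁻¹ ^ m * V ^ m) := by
          rw [Finset.prod_mul_distrib, Finset.prod_const, Finset.card_univ, Fintype.card_fin,
            mul_pow]
          ring
      _ = _ := by rw [← mul_pow, ENNReal.inv_mul_cancel hV0 hV, one_pow, mul_one]

/-- Decay of the kernel integral away from the support of a factor of mean zero. -/
theorem enorm_integral_le_of_integral_eq_zero {K : E n → (Fin m → E n) → ℂ} {a : ℕ → ℝ≥0}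
    (hK : IsRegularKernel K a) (ha : Summable a) {c x : E n} {R : ℝ} (hR : 0 < R) {j : ℕ}
    (hx : 2 ^ j * (32 * R) ≤ ‖x - c‖) (f : Fin m → Test n) (i : Fin m)
    (hsupp : tsupport (f i) ⊆ closedBall c (8 * R)) (hi : ∫ z, f i z = 0) :
    ‖∫ y : Fin m → E n, K x y * ∏ k, f k (y k)‖ₑ ≤
      2 * ballConst n ^ m * a j * (volume (ball c (2 ^ j * (32 * R))))⁻¹ * (∫⁻ z, ‖f i z‖ₑ) *
        ∏ k ∈ Finset.univ.erase i, maxFun (fun y => ‖f k y‖ₑ) x := by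
  have h32 : 32 * R ≤ ‖x - c‖ := by
    have : (1 : ℝ) ≤ 2 ^ j := one_le_pow₀ (by norm_num)
    nlinarith
  have hxmem : x ∉ ⋂ i, tsupport (f i) := by
    intro h
    have h1 := hsupp (mem_iInter.1 h i)
    rw [mem_closedBall, dist_eq_norm] at h1
    linarith
  have hcx : c ≠ x := by
    rintro rfl; rw [sub_self, norm_zero] at h32; linarith
  have hint2 : Integrable fun y : Fin m → E n => K x (Function.update y i c) * ∏ k, f k (y k) := by
    refine integrable_of_continuousOn_mul_prod ((hK.continuousOn ha x).comp
      (f := fun y : Fin m → E n => Function.update y i c) ?_ fun y _ => ⟨i, by simpa using hcx⟩)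
    exact (continuous_id.update i continuous_const).continuousOn
  -- Mean zero allows subtracting the kernel with `y i` frozen at the centre `c`.
  have hsplit : ∫ y : Fin m → E n, K x y * ∏ k, f k (y k) =
      ∫ y : Fin m → E n, (K x y * ∏ k, f k (y k) - K x (Function.update y i c) * ∏ k, f k (y k)) := by
    rw [integral_sub (hK.integrable ha hxmem) hint2,
      integral_update_mul_prod_eq_zero _ f i hi c, sub_zero]
  rw [hsplit]
  refine (enorm_integral_le_lintegral_enorm _).trans ?_
  -- On the support of `f i` one has `‖x - y i‖ ≥ ‖x - c‖ - 8 R ≥ ρ`. The factor `32` gives `2 ^ (j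
  -- + 1) * (8 R) = 2 ^ j * (32 R) / 2 ≤ ρ`, so the same `a j` applies on every shell.
  set ρ : ℝ := ‖x - c‖ / 2 with hρ_def
  have hρ : 0 < ρ := by rw [hρ_def]; linarith
  have hdist : ∀ w : E n, f i w ≠ 0 → ‖c - w‖ ≤ 8 * R ∧ ‖x - c‖ - 8 * R ≤ ‖x - w‖ := by
    intro w hw
    have h1 := hsupp (subset_tsupport _ hw)
    rw [mem_closedBall, dist_comm, dist_eq_norm] at h1
    have h2 : ‖x - c‖ ≤ ‖x - w‖ + ‖w - c‖ := norm_sub_le_norm_sub_add_norm_sub _ _ _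
    rw [norm_sub_rev w c] at h2
    exact ⟨h1, by linarith⟩
  refine (lintegral_le_tsum_of_dyadic x hρ (F := fun k y => ‖f k y‖ₑ)
    (Φ := fun l => a j * (ballConst n * (volume (ball x (2 * (2 ^ l * ρ))))⁻¹) ^ m)
    (fun k => (f k).measurable_enorm) ?_ ?_).trans ?_
  · intro y hy
    have h0 : f i (y i) = 0 := by
      by_contra h0
      have h1 := (hdist _ h0).2
      have h2 := Finset.single_le_sum (f := fun k => ‖x - y k‖) (fun _ _ => norm_nonneg _)
        (Finset.mem_univ i)
      linarith
    rw [Finset.prod_eq_zero (Finset.mem_univ i) h0]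
    simp
  · intro l y hl _
    rw [← sub_mul, enorm_mul, enorm_prod]
    by_cases h0 : f i (y i) = 0
    · rw [Finset.prod_eq_zero (Finset.mem_univ i) (by rw [h0, enorm_zero])]
      simp
    obtain ⟨h1, h2⟩ := hdist _ h0
    refine mul_le_mul' ?_ le_rfl
    have hne : y i ≠ x := by
      rintro h; rw [h, sub_self, norm_zero] at h2; linarith
    have hlρ : ρ ≤ ∑ k, ‖x - y k‖ := by
      refine le_trans ?_ hl
      have : (1 : ℝ) ≤ 2 ^ l := one_le_pow₀ (by norm_num)
      nlinarith
    have h3 : 2 ^ (j + 1) * ‖c - y i‖ ≤ ∑ k, ‖x - y k‖ := by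
      calc 2 ^ (j + 1) * ‖c - y i‖ ≤ 2 ^ (j + 1) * (8 * R) := by gcongr
        _ = 2 ^ j * (32 * R) / 2 := by ring
        _ ≤ ρ := by rw [hρ_def]; gcongr
        _ ≤ _ := hlρ
    have h4 := (hK x y (c - y i) j ⟨i, hne⟩ ⟨i, by linarith⟩ h3).2 i
    rw [add_sub_cancel, norm_sub_rev] at h4
    exact (enorm_le_ofReal_of_norm_le h4).trans
      (ofReal_div_pow_le m x (a j) (mul_pos (by positivity) hρ) hl)
  · set W := volume (ball c (2 ^ j * (32 * R)))
    set P := ∏ k ∈ Finset.univ.erase i, maxFun (fun y => ‖f k y‖ₑ) x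
    set B := ∫⁻ z, ‖f i z‖ₑ
    calc _ ≤ ∑' l : ℕ, ballConst n ^ m * a j * W⁻¹ * B * P * (2⁻¹ : ℝ≥0∞) ^ l := by
          refine ENNReal.tsum_le_tsum fun l => ?_
          have hrad : 2 * (2 ^ l * ρ) = 2 ^ (l + 1) * ρ := by ring
          rw [hrad]
          set V := volume (ball x (2 ^ (l + 1) * ρ)) with hV_def
          have hV0 : V ≠ 0 := volume_ball_ne_zero _ (by positivity)
          have hV : V ≠ ∞ := volume_ball_ne_top _ _
          -- The radius is `2 ^ l * ‖x - c‖`. As `n ≥ 1`, the volume grows at least like `2 ^ l`,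
          -- which makes the sum over the shells geometric.
          have hVW : V⁻¹ ≤ W⁻¹ * (2⁻¹ : ℝ≥0∞) ^ l := by
            have h1 : 2 ^ l * W ≤ V := by
              rw [hV_def, show (2 : ℝ) ^ (l + 1) * ρ = 2 ^ l * ‖x - c‖ by rw [hρ_def]; ring,
                volume_ball_mul x c (by positivity) (norm_nonneg _)]
              refine mul_le_mul' ?_ (measure_mono (ball_subset_ball hx))
              rw [ENNReal.ofReal_pow (by positivity), ENNReal.ofReal_pow (by norm_num)]
              norm_num
              exact le_self_pow₀ (one_le_pow₀ (by norm_num)) (NeZero.ne n)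
            rw [← ENNReal.inv_pow, ← ENNReal.mul_inv (.inr (by simp)) (.inr (by simp)), mul_comm]
            exact ENNReal.inv_le_inv.2 h1
          have hxb : x ∈ ball x (2 ^ (l + 1) * ρ) := mem_ball_self (by positivity)
          have hprod : ∏ k, ∫⁻ z in ball x (2 ^ (l + 1) * ρ), ‖f k z‖ₑ ≤ B * (V ^ (m - 1) * P) := by
            rw [← Finset.mul_prod_erase _ _ (Finset.mem_univ i)]
            refine mul_le_mul' (setLIntegral_le_lintegral _ _) ?_
            calc _ ≤ ∏ k ∈ Finset.univ.erase i, (V * maxFun (fun y => ‖f k y‖ₑ) x) :=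
                  Finset.prod_le_prod' fun k _ => lintegral_ball_le_maxFun _ hxb
              _ = _ := by
                  rw [Finset.prod_mul_distrib, Finset.prod_const, Finset.card_erase_of_mem
                    (Finset.mem_univ i), Finset.card_univ, Fintype.card_fin]
          have hm : m = m - 1 + 1 := by have := i.2; omega
          have hVm : (ballConst n * V⁻¹) ^ m * V ^ (m - 1) = ballConst n ^ m * V⁻¹ := by
            have h1 : V⁻¹ ^ m * V ^ (m - 1) = V⁻¹ := by
              conv_lhs => rw [hm]
              rw [pow_succ, Nat.add_sub_cancel, mul_right_comm, ← mul_pow,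
                ENNReal.inv_mul_cancel hV0 hV, one_pow, one_mul]
            rw [mul_pow, mul_assoc, h1]
          calc _ ≤ a j * (ballConst n * V⁻¹) ^ m * (B * (V ^ (m - 1) * P)) := by gcongr
            _ = a j * ((ballConst n * V⁻¹) ^ m * V ^ (m - 1)) * B * P := by ring
            _ = a j * (ballConst n ^ m * V⁻¹) * B * P := by rw [hVm]
            _ ≤ a j * (ballConst n ^ m * (W⁻¹ * (2⁻¹ : ℝ≥0∞) ^ l)) * B * P := by gcongr
            _ = _ := by ring
      _ = _ := by
          rw [ENNReal.tsum_mul_left, ENNReal.tsum_geometric, ENNReal.one_sub_inv_two, inv_inv]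
          ring

end KernelBounds

/-! ### Lowering the exponents of a weak type bound to one. -/

section WeakType

variable {n m : ℕ}

/-- `T` is of weak type: `|{|T f| > l}| ≤ A (∏ ‖f_k‖_{q_k} / l) ^ t` on test functions. -/
def HasWeakBound (T : MultilinearMap ℂ (fun _ : Fin m => Test n) (Fun n)) (q : Fin m → ℝ≥0∞)
    (t : ℝ) : Prop :=
  ∃ A : ℝ≥0, ∀ (f : Fin m → Test n) (l : ℝ≥0), 0 < l →
    volume {x | (l : ℝ≥0∞) < ‖T f x‖ₑ} ≤ A * ((∏ k, eLpNorm (f k) (q k) volume) / l) ^ t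

/-- `T` is given by the kernel `K` off the intersection of the supports. -/
def IsRepresentedBy (T : MultilinearMap ℂ (fun _ : Fin m => Test n) (Fun n))
    (K : E n → (Fin m → E n) → ℂ) : Prop :=
  ∀ f : Fin m → Test n, ∀ᵐ x : E n, x ∉ ⋂ i, tsupport (f i) →
    T f x = ∫ y : Fin m → E n, K x y * ∏ i, f i (y i)

theorem Test.eq_zero_of_eLpNorm_eq_zero {f : Test n} {q : ℝ≥0∞} (hq : q ≠ 0)
    (h : eLpNorm f q volume = 0) : f = 0 := by
  rw [eLpNorm_eq_zero_iff f.continuous.aestronglyMeasurable hq] at h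
  have h1 : (f : E n → ℂ) = fun _ => 0 :=
    (Continuous.ae_eq_iff_eq volume f.continuous continuous_const).1 h
  ext x
  exact congrFun h1 x

/-- Homogeneity: normalizing each function rescales the level `l`. A test function of norm zero
vanishes, and then so does `T f`. -/
theorem HasWeakBound.of_le_one {T : MultilinearMap ℂ (fun _ : Fin m => Test n) (Fun n)}
    {q : Fin m → ℝ≥0∞} (hq : ∀ k, q k ≠ 0) {t : ℝ} {A : ℝ≥0}
    (h : ∀ f : Fin m → Test n, (∀ k, eLpNorm (f k) (q k) volume ≤ 1) → ∀ l : ℝ≥0, 0 < l →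
      volume {x | (l : ℝ≥0∞) < ‖T f x‖ₑ} ≤ A * (l : ℝ≥0∞)⁻¹ ^ t) : HasWeakBound T q t := by
  refine ⟨A, fun f l hl => ?_⟩
  by_cases h0 : ∃ k, eLpNorm (f k) (q k) volume = 0
  · obtain ⟨k, hk⟩ := h0
    have h1 : T f = 0 := T.map_coord_zero k (Test.eq_zero_of_eLpNorm_eq_zero (hq k) hk)
    have h2 : volume {x | (l : ℝ≥0∞) < ‖T f x‖ₑ} = 0 := by
      rw [h1]
      refine measure_mono_null ?_ (ae_iff.1 (AEEqFun.coeFn_zero (α := E n) (β := ℂ) (μ := volume)))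
      intro x hx hx0
      have : (l : ℝ≥0∞) < ‖(0 : Fun n) x‖ₑ := hx
      rw [hx0] at this
      simp at this
    rw [h2]
    exact zero_le
  push Not at h0
  have hfin : ∀ k, eLpNorm (f k) (q k) volume ≠ ∞ := fun k => ((f k).memLp (q k)).2.ne
  set N : Fin m → ℝ≥0 := fun k => (eLpNorm (f k) (q k) volume).toNNReal with hN_def
  have hN : ∀ k, (N k : ℝ≥0∞) = eLpNorm (f k) (q k) volume := fun k =>
    ENNReal.coe_toNNReal (hfin k)
  have hN0 : ∀ k, N k ≠ 0 := fun k hk => h0 k (by rw [← hN, hk, ENNReal.coe_zero])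
  set P : ℝ≥0 := ∏ k, N k
  have hP0 : P ≠ 0 := Finset.prod_ne_zero_iff.2 fun k _ => hN0 k
  set u : Fin m → Test n := fun k => ((N k : ℂ)⁻¹) • f k with hu_def
  have hu : ∀ k, eLpNorm (u k) (q k) volume ≤ 1 := by
    intro k
    have : (u k : E n → ℂ) = ((N k : ℂ)⁻¹) • (f k : E n → ℂ) := rfl
    rw [this, eLpNorm_const_smul, ← hN]
    have h3 : ‖((N k : ℂ)⁻¹)‖ₑ = (N k : ℝ≥0∞)⁻¹ := by
      rw [enorm_inv (by exact_mod_cast hN0 k)]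
      congr 1
      rw [enorm_eq_nnnorm]
      congr 1
      ext
      simp
    rw [h3, ENNReal.inv_mul_cancel (by exact_mod_cast hN0 k) ENNReal.coe_ne_top]
  have hf : f = fun k => (N k : ℂ) • u k := by
    ext1 k
    rw [hu_def, smul_smul, mul_inv_cancel₀ (by exact_mod_cast hN0 k), one_smul]
  have hT : T f = (P : ℂ) • T u := by
    conv_lhs => rw [hf]
    rw [MultilinearMap.map_smul_univ]
    congr 1
    simp [P]
  have hset : volume {x | (l : ℝ≥0∞) < ‖T f x‖ₑ} = volume {x | ((l / P : ℝ≥0) : ℝ≥0∞) < ‖T u x‖ₑ} := by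
    rw [hT]
    refine measure_congr ?_
    filter_upwards [AEEqFun.coeFn_smul (P : ℂ) (T u)] with x hx
    refine propext ?_
    change (l : ℝ≥0∞) < ‖((P : ℂ) • T u : Fun n) x‖ₑ ↔ ((l / P : ℝ≥0) : ℝ≥0∞) < ‖T u x‖ₑ
    rw [hx, Pi.smul_apply, enorm_smul, enorm_eq_nnnorm, enorm_eq_nnnorm, ← ENNReal.coe_mul,
      ENNReal.coe_lt_coe, ENNReal.coe_lt_coe, div_lt_iff₀ (pos_iff_ne_zero.2 hP0), mul_comm]
    simp
  rw [hset]
  refine (h u hu (l / P) (div_pos hl (pos_iff_ne_zero.2 hP0))).trans (le_of_eq ?_)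
  congr 2
  have hPq : ∏ k, eLpNorm (f k) (q k) volume = (P : ℝ≥0∞) := by
    rw [ENNReal.ofNNReal_finsetProd]
    exact Finset.prod_congr rfl fun k _ => (hN k).symm
  rw [hPq, ← ENNReal.coe_div hl.ne', ← ENNReal.coe_inv (div_pos hl (pos_iff_ne_zero.2 hP0)).ne',
    inv_div]

/-- Interpolation between `L¹` and `L^∞`, by pulling `M ^ (r - 1)` out of `‖g‖ ^ r`. It places the
good part in the original `L^q`. -/
theorem eLpNorm_le_of_enorm_le_of_lintegral_le {g : E n → ℂ} {M I : ℝ≥0∞} {q : ℝ≥0∞}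
    (hq : 1 ≤ q) (hM : ∀ x, ‖g x‖ₑ ≤ M) (hM' : M ≠ ∞) (hI : ∫⁻ x, ‖g x‖ₑ ≤ I) :
    eLpNorm g q volume ≤ M ^ (1 - q⁻¹.toReal) * I ^ q⁻¹.toReal := by
  by_cases hq' : q = ∞
  · subst hq'
    simp only [ENNReal.inv_top, ENNReal.toReal_zero, sub_zero, ENNReal.rpow_one, ENNReal.rpow_zero,
      mul_one, eLpNorm_exponent_top]
    exact eLpNormEssSup_le_of_ae_enorm_bound (Eventually.of_forall hM)
  have hq0 : q ≠ 0 := (zero_lt_one.trans_le hq).ne'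
  have hr : 1 ≤ q.toReal := by
    rw [← ENNReal.toReal_one]; exact ENNReal.toReal_mono hq' hq
  rw [eLpNorm_eq_lintegral_rpow_enorm_toReal hq0 hq', one_div, ENNReal.toReal_inv]
  set r := q.toReal
  have hr0 : 0 < r := by linarith
  have h1 : ∫⁻ x, ‖g x‖ₑ ^ r ≤ M ^ (r - 1) * I := by
    calc ∫⁻ x, ‖g x‖ₑ ^ r ≤ ∫⁻ x, M ^ (r - 1) * ‖g x‖ₑ := by
          refine lintegral_mono fun x => ?_
          have : ‖g x‖ₑ ^ r = ‖g x‖ₑ ^ (r - 1) * ‖g x‖ₑ := by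
            conv_rhs => rw [← ENNReal.rpow_one ‖g x‖ₑ, ← ENNReal.rpow_mul, one_mul]
            rw [← ENNReal.rpow_add_of_nonneg _ _ (by linarith) zero_le_one, sub_add_cancel]
          rw [this]
          gcongr
          · exact hM x
      _ = M ^ (r - 1) * ∫⁻ x, ‖g x‖ₑ :=
          lintegral_const_mul' _ _ (ENNReal.rpow_ne_top_of_nonneg (by linarith) hM')
      _ ≤ _ := by gcongr
  calc (∫⁻ x, ‖g x‖ₑ ^ r) ^ r⁻¹ ≤ (M ^ (r - 1) * I) ^ r⁻¹ := by gcongr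
    _ = _ := by
      rw [ENNReal.mul_rpow_of_nonneg _ _ (by positivity), ← ENNReal.rpow_mul]
      congr 2
      field_simp

variable [NeZero n]

/-- Weak type bound for the maximal function of a function in the unit ball of `L^q`. -/
theorem measure_maxFun_gt_le_of_eLpNorm_le_one {f : Test n} {q : ℝ≥0∞} (hq : 1 ≤ q)
    (hf : eLpNorm f q volume ≤ 1) {l : ℝ≥0∞} (hl : l ≠ 0) (hl' : l ≠ ∞) :
    volume {x | l ^ q⁻¹.toReal < maxFun (fun y => ‖f y‖ₑ) x} ≤ ENNReal.ofReal (4 ^ n) * l⁻¹ := by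
  by_cases hq' : q = ∞
  · subst hq'
    have h1 : ∀ x, maxFun (fun y => ‖f y‖ₑ) x ≤ 1 := fun x => by
      refine maxFun_le_of_ae_le ?_ x
      rw [eLpNorm_exponent_top] at hf
      filter_upwards [enorm_ae_le_eLpNormEssSup f volume] with y hy using hy.trans hf
    have : {x | l ^ (∞⁻¹ : ℝ≥0∞).toReal < maxFun (fun y => ‖f y‖ₑ) x} = ∅ := by
      ext x
      simpa using h1 x
    rw [this, measure_empty]
    exact zero_le
  have hq0 : q ≠ 0 := (zero_lt_one.trans_le hq).ne'
  have hr : 1 ≤ q.toReal := by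
    rw [← ENNReal.toReal_one]; exact ENNReal.toReal_mono hq' hq
  rw [eLpNorm_eq_lintegral_rpow_enorm_toReal hq0 hq', one_div] at hf
  rw [ENNReal.toReal_inv]
  set r := q.toReal
  have hr0 : 0 < r := by linarith
  have hf' : ∫⁻ x, ‖f x‖ₑ ^ r ≤ 1 := by
    have := ENNReal.rpow_le_rpow hf hr0.le
    rwa [← ENNReal.rpow_mul, inv_mul_cancel₀ hr0.ne', ENNReal.rpow_one, ENNReal.one_rpow] at this
  refine (measure_maxFun_gt_le f.measurable_enorm.aemeasurable hr
    (by simp [ENNReal.rpow_eq_zero_iff, hl, hl']) (by simp [ENNReal.rpow_eq_top_iff, hl, hl'])).trans ?_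
  gcongr
  rw [ENNReal.inv_rpow, ← ENNReal.rpow_mul, inv_mul_cancel₀ hr0.ne', ENNReal.rpow_one]
  exact mul_le_of_le_one_right' hf'

/-- A function dominating the kernel integrals of a mean-zero function concentrated in `ball c R`
which is integrable off `ball c (32 R)`. -/
noncomputable def tailFun (a : ℕ → ℝ≥0) (c : E n) (R : ℝ) (x : E n) : ℝ≥0∞ :=
  ∑' j : ℕ, (ball c (2 ^ (j + 1) * (32 * R)) \ ball c (2 ^ j * (32 * R))).indicator
    (fun _ => a j * (volume (ball c (2 ^ j * (32 * R))))⁻¹) x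

theorem measurable_tailFun (a : ℕ → ℝ≥0) (c : E n) (R : ℝ) : Measurable (tailFun a c R) :=
  Measurable.tsum fun _ => measurable_const.indicator (measurableSet_ball.diff measurableSet_ball)

/-- A shell has volume at most `2 ^ n` times that of its inner ball, so shell `j` contributes at
most `2 ^ n * a j`. -/
theorem lintegral_tailFun_le (a : ℕ → ℝ≥0) (c : E n) {R : ℝ} (hR : 0 < R) :
    ∫⁻ x, tailFun a c R x ≤ 2 ^ n * ∑' j, (a j : ℝ≥0∞) := by
  unfold tailFun
  rw [lintegral_tsum fun _ =>
    (measurable_const.indicator (measurableSet_ball.diff measurableSet_ball)).aemeasurable,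
    ← ENNReal.tsum_mul_left]
  refine ENNReal.tsum_le_tsum fun j => ?_
  rw [lintegral_indicator_const (measurableSet_ball.diff measurableSet_ball)]
  have h1 : volume (ball c (2 ^ (j + 1) * (32 * R))) =
      2 ^ n * volume (ball c (2 ^ j * (32 * R))) := by
    rw [pow_succ', mul_assoc, volume_ball_mul c c (by norm_num) (by positivity),
      ENNReal.ofReal_pow (by norm_num)]
    norm_num
  calc _ ≤ a j * (volume (ball c (2 ^ j * (32 * R))))⁻¹ *
        (2 ^ n * volume (ball c (2 ^ j * (32 * R)))) := by
        rw [← h1]; gcongr; exact sdiff_subset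
    _ = 2 ^ n * a j * ((volume (ball c (2 ^ j * (32 * R))))⁻¹ *
        volume (ball c (2 ^ j * (32 * R)))) := by ring
    _ = _ := by
        rw [ENNReal.inv_mul_cancel (volume_ball_ne_zero _ (by positivity))
          (volume_ball_ne_top _ _), mul_one]

theorem enorm_integral_le_tailFun {K : E n → (Fin m → E n) → ℂ} {a : ℕ → ℝ≥0}
    (hK : IsRegularKernel K a) (ha : Summable a) {c x : E n} {R : ℝ} (hR : 0 < R)
    (hx : x ∉ ball c (32 * R)) (f : Fin m → Test n) (i : Fin m)
    (hsupp : tsupport (f i) ⊆ closedBall c (8 * R)) (hi : ∫ z, f i z = 0) :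
    ‖∫ y : Fin m → E n, K x y * ∏ k, f k (y k)‖ₑ ≤
      2 * ballConst n ^ m * tailFun a c R x * (∫⁻ z, ‖f i z‖ₑ) *
        ∏ k ∈ Finset.univ.erase i, maxFun (fun y => ‖f k y‖ₑ) x := by
  have h32 : 32 * R ≤ ‖x - c‖ := by
    rw [← dist_eq_norm]; exact not_lt.1 hx
  obtain ⟨j, hj1, hj2⟩ := exists_nat_pow_near (x := ‖x - c‖ / (32 * R))
    ((one_le_div (by positivity)).2 h32) one_lt_two
  rw [le_div_iff₀ (by positivity)] at hj1
  rw [div_lt_iff₀ (by positivity)] at hj2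
  refine (enorm_integral_le_of_integral_eq_zero hK ha hR hj1 f i hsupp hi).trans ?_
  rw [mul_assoc (2 * ballConst n ^ m)]
  gcongr
  unfold tailFun
  refine le_trans (le_of_eq ?_) (ENNReal.le_tsum j)
  rw [indicator_of_mem]
  refine ⟨?_, ?_⟩
  · rw [mem_ball, dist_eq_norm]; exact hj2
  · rw [mem_ball, dist_eq_norm]; exact not_lt.2 hj1

/-- Lowering one exponent of a weak type bound to `1`. -/
theorem HasWeakBound.update_one {T : MultilinearMap ℂ (fun _ : Fin m => Test n) (Fun n)}
    {K : E n → (Fin m → E n) → ℂ} {a : ℕ → ℝ≥0} (hK : IsRegularKernel K a) (ha : Summable a)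
    (hT : IsRepresentedBy T K) {q : Fin m → ℝ≥0∞} (hq : ∀ k, 1 ≤ q k) (i : Fin m) {t t' : ℝ}
    (ht : 0 < t) (ht' : 0 < t') (htq : t⁻¹ = ∑ k, (q k)⁻¹.toReal)
    (htq' : t'⁻¹ = 1 + ∑ k ∈ Finset.univ.erase i, (q k)⁻¹.toReal)
    (hw : HasWeakBound T q t) : HasWeakBound T (Function.update q i 1) t' := by
  obtain ⟨A, hA⟩ := hw
  obtain ⟨C, hC1, hC⟩ := exists_smooth_decomposition n
  set A₁ : ℝ≥0∞ := ∑' j, (a j : ℝ≥0∞)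
  have hA₁ : A₁ ≠ ∞ := ENNReal.tsum_coe_ne_top_iff_summable.2 ha
  set Q : ℝ≥0∞ := 2 * ballConst n ^ m * (2 ^ n * A₁ * C)
  have hQ : Q ≠ ∞ := by
    refine ENNReal.mul_ne_top (ENNReal.mul_ne_top (by simp) (ENNReal.pow_ne_top ballConst_ne_top))
      (ENNReal.mul_ne_top (ENNReal.mul_ne_top (by simp) hA₁) ENNReal.coe_ne_top)
  set B : ℝ≥0∞ := A * (C * 2) ^ t + (ENNReal.ofReal (32 ^ n) + (2 * Q +
    m * ENNReal.ofReal (4 ^ n))) with hB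
  have hBtop : B ≠ ∞ := by
    refine ENNReal.add_ne_top.2 ⟨ENNReal.mul_ne_top ENNReal.coe_ne_top
      (ENNReal.rpow_ne_top_of_nonneg ht.le (ENNReal.mul_ne_top ENNReal.coe_ne_top (by simp))),
      ENNReal.add_ne_top.2 ⟨ENNReal.ofReal_ne_top, ENNReal.add_ne_top.2
      ⟨ENNReal.mul_ne_top (by simp) hQ, ENNReal.mul_ne_top (by simp) ENNReal.ofReal_ne_top⟩⟩⟩
  refine HasWeakBound.of_le_one (A := B.toNNReal) ?_ fun f hf l hl => ?_
  · intro k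
    by_cases hk : k = i
    · subst hk; simp
    · rw [Function.update_of_ne hk]; exact (zero_lt_one.trans_le (hq k)).ne'
  rw [ENNReal.coe_toNNReal hBtop]
  have hfi : ∫⁻ x, ‖f i x‖ₑ ≤ 1 := by
    have := hf i
    rwa [Function.update_self, eLpNorm_one_eq_lintegral_enorm] at this
  have hfk : ∀ k, k ≠ i → eLpNorm (f k) (q k) volume ≤ 1 := by
    intro k hk
    have := hf k
    rwa [Function.update_of_ne hk] at this
  set L : ℝ≥0∞ := (l : ℝ≥0∞) with hL_def
  have hL0 : L ≠ 0 := by simpa [L] using hl.ne'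
  have hL : L ≠ ∞ := ENNReal.coe_ne_top
  -- The height is forced by `hprod`: off the exceptional sets the bad part is at most `α / 2` times
  -- the product of `α ^ (1 / q k)` over `k ≠ i`, that is `α ^ (1 / t') / 2 = l / 2`.
  set α : ℝ≥0 := l ^ t' with hα_def
  have hα : 0 < α := NNReal.rpow_pos hl
  have hαL : (α : ℝ≥0∞) = L ^ t' := ENNReal.coe_rpow_of_ne_zero hl.ne' t'
  have hα0 : (α : ℝ≥0∞) ≠ 0 := by simpa using hα.ne'
  have hαinv : (α : ℝ≥0∞)⁻¹ = L⁻¹ ^ t' := by rw [hαL, ENNReal.inv_rpow]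
  obtain ⟨N, c, R, g, b, hR, hfgb, hg, hgL1, hsupp, hmean, hbL1, hvol⟩ := hC (f i) α hα
  have hgL1' : ∫⁻ x, ‖g x‖ₑ ≤ C := hgL1.trans (mul_le_of_le_one_right' hfi)
  have hvol' : ∑ j, volume (ball (c j) (R j)) ≤ (α : ℝ≥0∞)⁻¹ := by
    rw [← one_mul (α : ℝ≥0∞)⁻¹, ← div_eq_mul_inv,
      ENNReal.le_div_iff_mul_le (.inl hα0) (.inl ENNReal.coe_ne_top), mul_comm]
    exact hvol.trans hfi
  -- splitting of `T f`
  have hTf : T f = T (Function.update f i g) + ∑ j, T (Function.update f i (b j)) := by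
    rw [← MultilinearMap.map_update_sum, ← MultilinearMap.map_update_add, ← hfgb,
      Function.update_eq_self]
  have hTfae : ∀ᵐ x, T f x = T (Function.update f i g) x + ∑ j, T (Function.update f i (b j)) x := by
    have h2 : ∀ s : Finset (Fin N), ((∑ j ∈ s, T (Function.update f i (b j)) : Fun n) : E n → ℂ)
        =ᵐ[volume] fun x => ∑ j ∈ s, T (Function.update f i (b j)) x := by
      intro s
      induction s using Finset.induction_on with
      | empty => exact AEEqFun.coeFn_zero
      | insert j s hj ih =>
        rw [Finset.sum_insert hj]
        filter_upwards [AEEqFun.coeFn_add (T (Function.update f i (b j)))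
          (∑ j ∈ s, T (Function.update f i (b j))), ih] with x h1 h2
        rw [h1, Pi.add_apply, h2, Finset.sum_insert hj]
    rw [hTf]
    filter_upwards [AEEqFun.coeFn_add (T (Function.update f i g))
      (∑ j, T (Function.update f i (b j))), h2 Finset.univ] with x h1 h2
    rw [h1, Pi.add_apply, h2]
  -- exceptional sets
  set S₁ : Set (E n) := {x | ((l / 2 : ℝ≥0) : ℝ≥0∞) < ‖T (Function.update f i g) x‖ₑ}
  set S₂ : Set (E n) := ⋃ j, ball (c j) (32 * R j)
  -- The tails of the bad pieces, without the maximal functions of the other slots, which `S₄`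
  -- controls. The integral of `H` is at most `Q`, and Chebyshev bounds `S₃`.
  set H : E n → ℝ≥0∞ := fun x =>
    ∑ j, 2 * ballConst n ^ m * tailFun a (c j) (R j) x * ∫⁻ z, ‖b j z‖ₑ with hH_def
  set S₃ : Set (E n) := {x | (α : ℝ≥0∞) / 2 ≤ H x}
  set S₄ : Set (E n) := ⋃ k ∈ Finset.univ.erase i,
    {x | (α : ℝ≥0∞) ^ (q k)⁻¹.toReal < maxFun (fun y => ‖f k y‖ₑ) x}
  have hbad : ∀ᵐ x, x ∉ S₂ → ∀ j, ‖T (Function.update f i (b j)) x‖ₑ ≤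
      2 * ballConst n ^ m * tailFun a (c j) (R j) x * (∫⁻ z, ‖b j z‖ₑ) *
        ∏ k ∈ Finset.univ.erase i, maxFun (fun y => ‖f k y‖ₑ) x := by
    have hrep := ae_all_iff.2 fun j => hT (Function.update f i (b j))
    filter_upwards [hrep] with x hx hxS j
    have hxj : x ∉ ball (c j) (32 * R j) := fun h => hxS (mem_iUnion.2 ⟨j, h⟩)
    have hbj : Function.update f i (b j) i = b j := Function.update_self ..
    have hmem : x ∉ ⋂ k, tsupport (Function.update f i (b j) k) := by
      intro h
      have h1 := mem_iInter.1 h i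
      rw [hbj] at h1
      refine hxj (closedBall_subset_ball ?_ (hsupp j h1))
      linarith [hR j]
    rw [hx j hmem]
    refine (enorm_integral_le_tailFun hK ha (hR j) hxj _ i (by rw [hbj]; exact hsupp j)
      (by rw [hbj]; exact hmean j)).trans (le_of_eq ?_)
    rw [hbj]
    congr 1
    refine Finset.prod_congr rfl fun k hk => ?_
    rw [Function.update_of_ne (Finset.ne_of_mem_erase hk)]
  have hprod : (α : ℝ≥0∞) * ∏ k ∈ Finset.univ.erase i, (α : ℝ≥0∞) ^ (q k)⁻¹.toReal = L := by
    have h1 : ∀ s : Finset (Fin m), ∏ k ∈ s, (α : ℝ≥0∞) ^ (q k)⁻¹.toReal =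
        (α : ℝ≥0∞) ^ ∑ k ∈ s, (q k)⁻¹.toReal := by
      intro s
      induction s using Finset.induction_on with
      | empty => simp
      | insert j s hj ih =>
        rw [Finset.prod_insert hj, Finset.sum_insert hj, ih,
          ENNReal.rpow_add _ _ hα0 ENNReal.coe_ne_top]
    rw [h1]
    nth_rw 1 [← ENNReal.rpow_one (α : ℝ≥0∞)]
    rw [← ENNReal.rpow_add _ _ hα0 ENNReal.coe_ne_top, ← htq', hαL, ← ENNReal.rpow_mul,
      mul_inv_cancel₀ ht'.ne', ENNReal.rpow_one]
  have hsub : ∀ᵐ x, x ∈ {x | L < ‖T f x‖ₑ} → x ∈ S₁ ∪ (S₂ ∪ (S₃ ∪ S₄)) := by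
    filter_upwards [hTfae, hbad] with x h1 h2 hx
    by_contra hc
    simp only [mem_union, not_or] at hc
    obtain ⟨c1, c2, c3, c4⟩ := hc
    have e1 : ‖T (Function.update f i g) x‖ₑ ≤ L / 2 := by
      have : ‖T (Function.update f i g) x‖ₑ ≤ ((l / 2 : ℝ≥0) : ℝ≥0∞) := not_lt.1 c1
      rwa [ENNReal.coe_div two_ne_zero] at this
    have e3 : H x ≤ α / 2 := (not_le.1 c3).le
    have e4 : ∀ k ∈ Finset.univ.erase i,
        maxFun (fun y => ‖f k y‖ₑ) x ≤ (α : ℝ≥0∞) ^ (q k)⁻¹.toReal := by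
      intro k hk
      by_contra hlt
      exact c4 (mem_iUnion₂.2 ⟨k, hk, not_le.1 hlt⟩)
    have e5 : ‖∑ j, T (Function.update f i (b j)) x‖ₑ ≤ L / 2 := by
      calc _ ≤ ∑ j, ‖T (Function.update f i (b j)) x‖ₑ := enorm_sum_le _ _
        _ ≤ ∑ j, 2 * ballConst n ^ m * tailFun a (c j) (R j) x * (∫⁻ z, ‖b j z‖ₑ) *
            ∏ k ∈ Finset.univ.erase i, maxFun (fun y => ‖f k y‖ₑ) x :=
            Finset.sum_le_sum fun j _ => h2 c2 j
        _ = H x * ∏ k ∈ Finset.univ.erase i, maxFun (fun y => ‖f k y‖ₑ) x := by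
            rw [← Finset.sum_mul]
        _ ≤ α / 2 * ∏ k ∈ Finset.univ.erase i, (α : ℝ≥0∞) ^ (q k)⁻¹.toReal :=
            mul_le_mul' e3 (Finset.prod_le_prod' e4)
        _ = _ := by
            rw [← hprod, ENNReal.div_eq_inv_mul, ENNReal.div_eq_inv_mul, mul_assoc]
    have hx' : L < ‖T f x‖ₑ := hx
    rw [h1] at hx'
    refine absurd hx' (not_lt.2 ((enorm_add_le _ _).trans ((add_le_add e1 e5).trans ?_)))
    rw [ENNReal.add_halves]
  -- measures of the exceptional sets
  have m1 : volume S₁ ≤ A * (C * 2) ^ t * L⁻¹ ^ t' := by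
    refine (hA _ (l / 2) (half_pos hl)).trans ?_
    have h1 : ∏ k, eLpNorm (Function.update f i g k) (q k) volume ≤
        C * (α : ℝ≥0∞) ^ (1 - (q i)⁻¹.toReal) := by
      rw [← Finset.mul_prod_erase _ _ (Finset.mem_univ i), Function.update_self]
      have h2 : ∏ k ∈ Finset.univ.erase i, eLpNorm (Function.update f i g k) (q k) volume ≤ 1 := by
        refine Finset.prod_le_one' fun k hk => ?_
        rw [Function.update_of_ne (Finset.ne_of_mem_erase hk)]
        exact hfk k (Finset.ne_of_mem_erase hk)
      refine (mul_le_of_le_one_right' h2).trans ?_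
      refine (eLpNorm_le_of_enorm_le_of_lintegral_le (hq i) hg
        (ENNReal.mul_ne_top ENNReal.coe_ne_top ENNReal.coe_ne_top) hgL1').trans (le_of_eq ?_)
      have hθ : (q i)⁻¹.toReal ≤ 1 := by
        rw [← ENNReal.toReal_one]
        exact ENNReal.toReal_mono (by simp) (ENNReal.inv_le_one.2 (hq i))
      rw [ENNReal.mul_rpow_of_nonneg _ _ (by linarith), mul_right_comm,
        ← ENNReal.rpow_add _ _ (by
          have := zero_lt_one.trans_le hC1
          simpa using this.ne') ENNReal.coe_ne_top, sub_add_cancel, ENNReal.rpow_one]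
    rw [mul_assoc]
    gcongr
    calc ((∏ k, eLpNorm (Function.update f i g k) (q k) volume) / ((l / 2 : ℝ≥0) : ℝ≥0∞)) ^ t
        ≤ (C * (α : ℝ≥0∞) ^ (1 - (q i)⁻¹.toReal) / ((l / 2 : ℝ≥0) : ℝ≥0∞)) ^ t := by
          gcongr
      _ = (C * 2 * L ^ (-(t' / t))) ^ t := by
          congr 1
          rw [ENNReal.coe_div two_ne_zero, ← hL_def, ENNReal.coe_ofNat, div_eq_mul_inv,
            ENNReal.inv_div (.inl (by simp)) (.inl (by simp)), hαL, ← ENNReal.rpow_mul,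
            div_eq_mul_inv, ← ENNReal.rpow_neg_one L]
          -- Lowering `q i` to `1` raises the reciprocal of the target exponent by `1 - 1 / q i = 1
          -- / t' - 1 / t`.
          have h3 : -(t' / t) = t' * (1 - (q i)⁻¹.toReal) + -1 := by
            have h4 : ∑ k, (q k)⁻¹.toReal =
                (q i)⁻¹.toReal + ∑ k ∈ Finset.univ.erase i, (q k)⁻¹.toReal :=
              (Finset.add_sum_erase _ _ (Finset.mem_univ i)).symm
            have h5 : 1 - (q i)⁻¹.toReal = t'⁻¹ - t⁻¹ := by rw [htq, htq', h4]; ring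
            rw [h5]
            field_simp
            ring
          rw [h3, ENNReal.rpow_add _ _ hL0 hL]
          ring
      _ = (C * 2) ^ t * L⁻¹ ^ t' := by
          rw [ENNReal.mul_rpow_of_nonneg _ _ ht.le, ← ENNReal.rpow_mul, ENNReal.inv_rpow,
            ← ENNReal.rpow_neg]
          congr 2
          field_simp
  have m2 : volume S₂ ≤ ENNReal.ofReal (32 ^ n) * L⁻¹ ^ t' := by
    calc volume S₂ ≤ ∑ j, volume (ball (c j) (32 * R j)) := measure_iUnion_fintype_le _ _
      _ = ENNReal.ofReal (32 ^ n) * ∑ j, volume (ball (c j) (R j)) := by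
          rw [Finset.mul_sum]
          exact Finset.sum_congr rfl fun j _ => volume_ball_mul _ _ (by norm_num) (hR j).le
      _ ≤ _ := by rw [← hαinv]; gcongr
  have m3 : volume S₃ ≤ 2 * Q * L⁻¹ ^ t' := by
    have hHm : Measurable H := Finset.measurable_sum _ fun j _ =>
      ((measurable_tailFun a (c j) (R j)).const_mul _).mul_const _
    have hHint : ∫⁻ x, H x ≤ Q := by
      rw [hH_def, lintegral_finsetSum _ fun j _ =>
        ((measurable_tailFun a (c j) (R j)).const_mul _).mul_const _]
      calc _ ≤ ∑ j, 2 * ballConst n ^ m * (2 ^ n * A₁) *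
            (C * α * volume (ball (c j) (R j))) := by
            refine Finset.sum_le_sum fun j _ => ?_
            rw [lintegral_mul_const _ ((measurable_tailFun a (c j) (R j)).const_mul _),
              lintegral_const_mul _ (measurable_tailFun a (c j) (R j))]
            gcongr
            · exact lintegral_tailFun_le a (c j) (hR j)
            · exact hbL1 j
        _ = Q * (α * ∑ j, volume (ball (c j) (R j))) := by
            rw [← Finset.mul_sum, ← Finset.mul_sum]; simp only [Q]; ring
        _ ≤ Q := mul_le_of_le_one_right' (hvol.trans hfi)
    have h1 := meas_ge_le_lintegral_div (μ := volume) hHm.aemeasurable (ε := (α : ℝ≥0∞) / 2)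
      (by simp [hα.ne']) (ENNReal.div_ne_top ENNReal.coe_ne_top (by simp))
    refine h1.trans ?_
    rw [← hαinv, div_eq_mul_inv, ENNReal.inv_div (.inl (by simp)) (.inl (by simp)), div_eq_mul_inv]
    calc _ ≤ Q * (2 * (α : ℝ≥0∞)⁻¹) := by gcongr
      _ = _ := by ring
  have m4 : volume S₄ ≤ m * ENNReal.ofReal (4 ^ n) * L⁻¹ ^ t' := by
    calc volume S₄ ≤ ∑ k ∈ Finset.univ.erase i,
          volume {x | (α : ℝ≥0∞) ^ (q k)⁻¹.toReal < maxFun (fun y => ‖f k y‖ₑ) x} :=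
          measure_biUnion_finset_le _ _
      _ ≤ ∑ k ∈ Finset.univ.erase i, ENNReal.ofReal (4 ^ n) * (α : ℝ≥0∞)⁻¹ :=
          Finset.sum_le_sum fun k hk => measure_maxFun_gt_le_of_eLpNorm_le_one (hq k)
            (hfk k (Finset.ne_of_mem_erase hk)) hα0 ENNReal.coe_ne_top
      _ ≤ ∑ k : Fin m, ENNReal.ofReal (4 ^ n) * (α : ℝ≥0∞)⁻¹ :=
          Finset.sum_le_sum_of_subset (Finset.erase_subset _ _)
      _ = _ := by rw [Finset.sum_const, Finset.card_univ, Fintype.card_fin, nsmul_eq_mul, hαinv,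
                    mul_assoc]
  calc volume {x | L < ‖T f x‖ₑ} ≤ volume (S₁ ∪ (S₂ ∪ (S₃ ∪ S₄))) := measure_mono_ae hsub
    _ ≤ volume S₁ + (volume S₂ + (volume S₃ + volume S₄)) :=
        (measure_union_le _ _).trans (by
          gcongr
          exact (measure_union_le _ _).trans (by gcongr; exact measure_union_le _ _))
    _ ≤ A * (C * 2) ^ t * L⁻¹ ^ t' + (ENNReal.ofReal (32 ^ n) * L⁻¹ ^ t' + (2 * Q * L⁻¹ ^ t' +
        m * ENNReal.ofReal (4 ^ n) * L⁻¹ ^ t')) := by gcongr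
    _ = _ := by rw [hB]; ring

/-- The weak type endpoint `L¹ × ⋯ × L¹ → L^{1/m,∞}`. -/
theorem HasWeakBound.all_one {T : MultilinearMap ℂ (fun _ : Fin m => Test n) (Fun n)}
    {K : E n → (Fin m → E n) → ℂ} {a : ℕ → ℝ≥0} (hK : IsRegularKernel K a) (ha : Summable a)
    (hT : IsRepresentedBy T K) {q : Fin m → ℝ≥0∞} (hq : ∀ k, 1 ≤ q k)
    (hpos : 0 < ∑ k, (q k)⁻¹.toReal) (hw : HasWeakBound T q (∑ k, (q k)⁻¹.toReal)⁻¹) :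
    HasWeakBound T (fun _ => 1) (m : ℝ)⁻¹ := by
  -- `s` collects the slots whose exponent has already been lowered.
  have key : ∀ s : Finset (Fin m), (0 < ∑ k, (s.piecewise (fun _ => 1) q k)⁻¹.toReal) ∧
      HasWeakBound T (s.piecewise (fun _ => 1) q)
        (∑ k, (s.piecewise (fun _ => 1) q k)⁻¹.toReal)⁻¹ := by
    intro s
    induction s using Finset.induction_on with
    | empty => rw [Finset.piecewise_empty]; exact ⟨hpos, hw⟩
    | insert i s hi ih =>
      rw [Finset.piecewise_insert]
      set q' := s.piecewise (fun _ => (1 : ℝ≥0∞)) q with hq'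
      have hq1 : ∀ k, 1 ≤ q' k := by
        intro k
        by_cases hk : k ∈ s
        · simp [hq', hk]
        · simpa [hq', hk] using hq k
      have hsum : ∑ k, (Function.update q' i 1 k)⁻¹.toReal =
          1 + ∑ k ∈ Finset.univ.erase i, (q' k)⁻¹.toReal := by
        rw [← Finset.add_sum_erase _ _ (Finset.mem_univ i), Function.update_self]
        congr 1
        · simp
        · exact Finset.sum_congr rfl fun k hk => by
            rw [Function.update_of_ne (Finset.ne_of_mem_erase hk)]
      have hp : 0 < ∑ k, (Function.update q' i 1 k)⁻¹.toReal := by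
        rw [hsum]
        have : 0 ≤ ∑ k ∈ Finset.univ.erase i, (q' k)⁻¹.toReal :=
          Finset.sum_nonneg fun _ _ => ENNReal.toReal_nonneg
        linarith
      refine ⟨hp, HasWeakBound.update_one hK ha hT hq1 i (inv_pos.2 ih.1) (inv_pos.2 hp)
        (inv_inv _) ?_ ih.2⟩
      rw [inv_inv, hsum]
  have h := (key Finset.univ).2
  rw [Finset.piecewise_univ] at h
  simpa using h

end WeakType

/-! ### Good-`λ` comparison of the operator with the product of maximal functions. -/

section GoodLambda

variable {n m : ℕ}

theorem AEEqFun_coeFn_sum {ι : Type*} (s : Finset ι) (g : ι → Fun n) :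
    ((∑ j ∈ s, g j : Fun n) : E n → ℂ) =ᵐ[volume] fun x => ∑ j ∈ s, g j x := by
  classical
  induction s using Finset.induction_on with
  | empty => exact AEEqFun.coeFn_zero
  | insert j s hj ih =>
    rw [Finset.sum_insert hj]
    filter_upwards [AEEqFun.coeFn_add (g j) (∑ j ∈ s, g j), ih] with x h1 h2
    rw [h1, Pi.add_apply, h2, Finset.sum_insert hj]

variable [NeZero n]

/-- `T f` has small oscillation on balls where the product of the maximal functions is small
somewhere. -/
theorem exists_oscillation_bound {T : MultilinearMap ℂ (fun _ : Fin m => Test n) (Fun n)}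
    {K : E n → (Fin m → E n) → ℂ} {a : ℕ → ℝ≥0} (hm : m ≠ 0) (hK : IsRegularKernel K a)
    (ha : Summable a) (hT : IsRepresentedBy T K) (hw : HasWeakBound T (fun _ => 1) (m : ℝ)⁻¹)
    {ε : ℝ≥0} (hε : 0 < ε) :
    ∃ γ : ℝ≥0, 0 < γ ∧ ∀ (f : Fin m → Test n) (l : ℝ≥0), 0 < l → ∀ (c : E n) (R : ℝ),
      (∃ z ∈ ball c R, ∏ k, maxFun (fun y => ‖f k y‖ₑ) z ≤ γ * l) →
      ∃ w : ℂ, volume {x | x ∈ ball c R ∧ (l : ℝ≥0∞) < ‖T f x - w‖ₑ} ≤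
        ε * volume (ball c R) := by
  obtain ⟨A, hA⟩ := hw
  set A₁ : ℝ≥0∞ := ∑' j, (a j : ℝ≥0∞)
  have hA₁ : A₁ ≠ ∞ := ENNReal.tsum_coe_ne_top_iff_summable.2 ha
  set D : ℝ≥0 := (2 ^ m * (ballConst n ^ m * A₁)).toNNReal with hD
  have hDtop : 2 ^ m * (ballConst n ^ m * A₁) ≠ ∞ := ENNReal.mul_ne_top (by simp)
    (ENNReal.mul_ne_top (ENNReal.pow_ne_top ballConst_ne_top) hA₁)
  have hDcoe : (D : ℝ≥0∞) = 2 ^ m * (ballConst n ^ m * A₁) := ENNReal.coe_toNNReal hDtop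
  -- The first bound gives `D * γ ≤ 1 / 2`, where `D` collects the oscillations of the at most `2 ^
  -- m` terms with a nonlocal factor. The second makes the weak type bound for the local term at
  -- level `l / 2` at most `ε` times the volume of the ball.
  set γ : ℝ≥0 := min (2 * (D + 1))⁻¹ ((ε / (A * 4 ^ n + 1)) ^ m / 2) with hγ
  have hγ0 : 0 < γ := lt_min (by positivity) (by positivity)
  refine ⟨γ, hγ0, fun f l hl c R ⟨z, hz, hGz⟩ => ?_⟩
  have hR : 0 < R := pos_of_mem_ball hz
  set G := ∏ k, maxFun (fun y => ‖f k y‖ₑ) z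
  have hl0 : (l : ℝ≥0∞) ≠ 0 := by simpa using hl.ne'
  let φ : ContDiffBump c := ⟨2 * R, 4 * R, by linarith, by linarith⟩
  have hφ : ContDiff ℝ (⊤ : ℕ∞) (fun x => 1 - φ x) := contDiff_const.sub φ.contDiff
  set u : Fin m → Test n := fun k => (f k).smulSmooth φ φ.contDiff with hu
  set v : Fin m → Test n := fun k => (f k).smulSmooth (fun x => 1 - φ x) hφ with hv
  have huf : ∀ k y, ‖u k y‖ₑ ≤ ‖f k y‖ₑ := by
    intro k y
    rw [hu, Test.smulSmooth_apply, enorm_mul]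
    refine mul_le_of_le_one_left' ?_
    rw [← ofReal_norm, Complex.norm_real, Real.norm_of_nonneg φ.nonneg]
    exact ENNReal.ofReal_le_one.2 φ.le_one
  have hvf : ∀ k y, ‖v k y‖ₑ ≤ ‖f k y‖ₑ := by
    intro k y
    rw [hv, Test.smulSmooth_apply, enorm_mul]
    refine mul_le_of_le_one_left' ?_
    rw [← ofReal_norm, Complex.norm_real, Real.norm_of_nonneg (sub_nonneg.2 φ.le_one)]
    exact ENNReal.ofReal_le_one.2 (by linarith [φ.nonneg (x := y)])
  have hv0 : ∀ k, ∀ y ∈ ball c (2 * R), v k y = 0 := by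
    intro k y hy
    rw [hv, Test.smulSmooth_apply, φ.one_of_mem_closedBall (ball_subset_closedBall hy)]
    simp
  have hfuv : f = u + v := by
    ext k y
    change f k y = u k y + v k y
    rw [hu, hv, Test.smulSmooth_apply, Test.smulSmooth_apply]
    push_cast
    ring
  set P : Finset (Finset (Fin m)) := Finset.univ.erase Finset.univ
  set g : Finset (Fin m) → Fin m → Test n := fun s => s.piecewise u v with hg
  have hTsum : T f = T u + ∑ s ∈ P, T (g s) := by
    rw [hfuv, MultilinearMap.map_add_univ, ← Finset.add_sum_erase _ _ (Finset.mem_univ Finset.univ),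
      Finset.piecewise_univ]
  have hgf : ∀ s k y, ‖g s k y‖ₑ ≤ ‖f k y‖ₑ := by
    intro s k y
    by_cases hk : k ∈ s
    · simpa [hg, hk] using huf k y
    · simpa [hg, hk] using hvf k y
  have hg0 : ∀ s ∈ P, ∃ k, ∀ y ∈ ball c (2 * R), g s k y = 0 := by
    intro s hs
    obtain ⟨k, hk⟩ : ∃ k, k ∉ s := by
      by_contra! h
      exact Finset.ne_of_mem_erase hs (Finset.eq_univ_iff_forall.2 h)
    refine ⟨k, fun y hy => ?_⟩
    simpa [hg, hk] using hv0 k y hy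
  set I : E n → Finset (Fin m) → ℂ := fun x s => ∫ y : Fin m → E n, K x y * ∏ k, g s k (y k)
  -- The constant is the value at the centre of all terms that contain a nonlocal factor `v k`.
  refine ⟨∑ s ∈ P, I c s, ?_⟩
  have hrep : ∀ᵐ x, x ∈ ball c R → ∀ s ∈ P, T (g s) x = I x s := by
    have h1 := ae_all_iff.2 fun s => hT (g s)
    filter_upwards [h1] with x hx hxc s hs
    refine hx s fun hmem => ?_
    obtain ⟨k, hk⟩ := hg0 s hs
    have hsub : tsupport (g s k) ⊆ (ball c (2 * R))ᶜ :=
      closure_minimal (fun y hy hy' => hy (hk y hy')) isOpen_ball.isClosed_compl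
    exact hsub (mem_iInter.1 hmem k) (ball_subset_ball (by linarith) hxc)
  have hsub : ∀ᵐ x, x ∈ {x | x ∈ ball c R ∧ (l : ℝ≥0∞) < ‖T f x - ∑ s ∈ P, I c s‖ₑ} →
      x ∈ {x | ((l / 2 : ℝ≥0) : ℝ≥0∞) < ‖T u x‖ₑ} := by
    filter_upwards [hrep, AEEqFun.coeFn_add (T u) (∑ s ∈ P, T (g s)),
      AEEqFun_coeFn_sum P fun s => T (g s)] with x h1 h2 h3 ⟨hxc, hx⟩
    by_contra hc
    have hc' : ‖T u x‖ₑ ≤ ((l / 2 : ℝ≥0) : ℝ≥0∞) := not_lt.1 hc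
    rw [hTsum, h2, Pi.add_apply, h3, Finset.sum_congr rfl (h1 hxc), add_sub_assoc,
      ← Finset.sum_sub_distrib] at hx
    have h4 : ‖∑ s ∈ P, (I x s - I c s)‖ₑ ≤ ((l / 2 : ℝ≥0) : ℝ≥0∞) := by
      calc _ ≤ ∑ s ∈ P, ‖I x s - I c s‖ₑ := enorm_sum_le _ _
        _ ≤ ∑ s ∈ P, ballConst n ^ m * A₁ * G := by
            refine Finset.sum_le_sum fun s hs => ?_
            obtain ⟨k, hk⟩ := hg0 s hs
            exact enorm_integral_sub_integral_le hK ha hxc hz (hgf s) k hk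
        _ ≤ ∑ s : Finset (Fin m), ballConst n ^ m * A₁ * G :=
            Finset.sum_le_sum_of_subset (Finset.erase_subset _ _)
        _ = D * G := by
            rw [Finset.sum_const, Finset.card_univ, Fintype.card_finset, Fintype.card_fin,
              nsmul_eq_mul, hDcoe]
            push_cast
            ring
        _ ≤ D * (γ * l) := by gcongr
        _ ≤ _ := by
            rw [← ENNReal.coe_mul, ← ENNReal.coe_mul, ENNReal.coe_le_coe, ← mul_assoc,
              div_eq_inv_mul]
            gcongr
            calc D * γ ≤ (D + 1) * (2 * (D + 1))⁻¹ := by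
                  gcongr
                  · exact le_self_add
                  · exact min_le_left _ _
              _ = 2⁻¹ := by field_simp
    refine absurd hx (not_lt.2 ((enorm_add_le _ _).trans ((add_le_add hc' h4).trans ?_)))
    rw [← ENNReal.coe_add, add_halves]
  refine (measure_mono_ae hsub).trans ((hA u (l / 2) (half_pos hl)).trans ?_)
  set V := volume (ball c (4 * R))
  have hV : V = 4 ^ n * volume (ball c R) := by
    rw [← ENNReal.ofReal_ofNat, ← ENNReal.ofReal_pow (by norm_num)]
    exact volume_ball_mul c c (by norm_num) hR.le
  have hu1 : ∀ k, eLpNorm (u k) 1 volume ≤ V * maxFun (fun y => ‖f k y‖ₑ) z := by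
    intro k
    rw [eLpNorm_one_eq_lintegral_enorm]
    refine le_trans ?_ (lintegral_ball_le_maxFun _ (ball_subset_ball (by linarith) hz))
    rw [← lintegral_indicator measurableSet_ball]
    refine lintegral_mono fun y => ?_
    by_cases hy : y ∈ ball c (4 * R)
    · rw [indicator_of_mem hy]; exact huf k y
    · have : φ y = 0 := by rw [← Function.notMem_support, φ.support_eq]; exact hy
      simp [hu, this]
  have hprod : ∏ k, eLpNorm (u k) 1 volume ≤ V ^ m * (γ * l) := by
    calc _ ≤ ∏ k, (V * maxFun (fun y => ‖f k y‖ₑ) z) := Finset.prod_le_prod' fun k _ => hu1 k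
      _ = V ^ m * G := by
        rw [Finset.prod_mul_distrib, Finset.prod_const, Finset.card_univ, Fintype.card_fin]
      _ ≤ _ := by gcongr
  have hm0 : (0 : ℝ) < m := by exact_mod_cast Nat.pos_of_ne_zero hm
  calc _ ≤ A * (V ^ m * (γ * l) / ((l / 2 : ℝ≥0) : ℝ≥0∞)) ^ (m : ℝ)⁻¹ := by gcongr
    _ = A * (V ^ m * (2 * γ : ℝ≥0)) ^ (m : ℝ)⁻¹ := by
        congr 2
        rw [ENNReal.coe_div two_ne_zero, div_eq_mul_inv, ENNReal.inv_div (.inl (by simp))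
          (.inl (by simp)), ENNReal.coe_ofNat, mul_assoc, div_eq_mul_inv]
        congr 1
        calc γ * l * (2 * (l : ℝ≥0∞)⁻¹) = 2 * γ * (l * (l : ℝ≥0∞)⁻¹) := by ring
          _ = _ := by
            rw [ENNReal.mul_inv_cancel hl0 ENNReal.coe_ne_top, mul_one, ENNReal.coe_mul,
              ENNReal.coe_ofNat]
    _ ≤ A * (V ^ m * ((ε / (A * 4 ^ n + 1)) ^ m : ℝ≥0)) ^ (m : ℝ)⁻¹ := by
        gcongr
        calc 2 * γ ≤ 2 * ((ε / (A * 4 ^ n + 1)) ^ m / 2) := by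
              gcongr; exact min_le_right _ _
          _ = _ := by field_simp
    _ = A * (V * (ε / (A * 4 ^ n + 1) : ℝ≥0)) := by
        rw [ENNReal.coe_pow, ← mul_pow, ← ENNReal.rpow_natCast, ← ENNReal.rpow_mul,
          mul_inv_cancel₀ hm0.ne', ENNReal.rpow_one]
    _ = (A * 4 ^ n * (ε / (A * 4 ^ n + 1)) : ℝ≥0) * volume (ball c R) := by
        rw [hV]; push_cast; ring
    _ ≤ _ := by
        gcongr
        rw [← mul_div_assoc, div_le_iff₀ (by positivity), mul_comm]
        gcongr
        exact le_self_add

/-- Lebesgue density, phrased with twice the indicator so that it supplies the starting radius for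
`exists_ball_scale`. -/
theorem ae_exists_ball_half_density {S : Set (E n)} (hS : MeasurableSet S) :
    ∀ᵐ x, x ∈ S → ∃ R, 0 < R ∧
      volume (ball x R) ≤ ∫⁻ y in ball x R, S.indicator (fun _ => 2) y := by
  have h := Besicovitch.ae_tendsto_measure_inter_div (volume : Measure (E n)) S
  rw [ae_restrict_iff' hS] at h
  filter_upwards [h] with x hx hxS
  have h1 : ∀ᶠ r in 𝓝[>] (0 : ℝ), (2⁻¹ : ℝ≥0∞) <
      volume (S ∩ closedBall x r) / volume (closedBall x r) :=
    (hx hxS).eventually (lt_mem_nhds (by simp))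
  obtain ⟨R, hR, hR0⟩ := (h1.and self_mem_nhdsWithin).exists
  have hR0' : 0 < R := hR0
  refine ⟨R, hR0', ?_⟩
  rw [setLIntegral_indicator hS, setLIntegral_const]
  have h2 : volume (S ∩ closedBall x R) = volume (S ∩ ball x R) :=
    measure_congr ((ae_eq_refl S).inter (ball_ae_eq_closedBall x R).symm)
  have h3 : volume (closedBall x R) = volume (ball x R) :=
    measure_congr (ball_ae_eq_closedBall x R).symm
  rw [h2, h3, ENNReal.lt_div_iff_mul_lt (.inl (volume_ball_ne_zero x hR0'))
    (.inl (volume_ball_ne_top x R))] at hR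
  calc volume (ball x R) = 2 * (2⁻¹ * volume (ball x R)) := by
        rw [← mul_assoc, ENNReal.mul_inv_cancel (by simp) (by simp), one_mul]
    _ ≤ _ := by gcongr

/-- The good-`λ` inequality. -/
theorem measure_goodLambda_le {F : E n → ℂ} (hF : Measurable F) {G : E n → ℝ≥0∞}
    {l γ ε : ℝ≥0} (hε : ε ≤ 1 / 4) (hfin : volume {x | (l : ℝ≥0∞) < ‖F x‖ₑ} ≠ ∞)
    (hosc : ∀ (c : E n) (R : ℝ), (∃ z ∈ ball c R, G z ≤ γ * l) →
      ∃ w : ℂ, volume {x | x ∈ ball c R ∧ (l : ℝ≥0∞) < ‖F x - w‖ₑ} ≤ ε * volume (ball c R)) :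
    volume {x | 3 * (l : ℝ≥0∞) < ‖F x‖ₑ ∧ G x ≤ γ * l} ≤
      ε * (4 ^ n * 2) * volume {x | (l : ℝ≥0∞) < ‖F x‖ₑ} := by
  set S : Set (E n) := {x | (l : ℝ≥0∞) < ‖F x‖ₑ}
  set B : Set (E n) := {x | 3 * (l : ℝ≥0∞) < ‖F x‖ₑ ∧ G x ≤ γ * l}
  have hS : MeasurableSet S := measurableSet_lt measurable_const hF.enorm
  have hBS : B ⊆ S := fun x hx => lt_of_le_of_lt (le_mul_of_one_le_left' (by norm_num)) hx.1
  set u : E n → ℝ≥0∞ := S.indicator (fun _ => 2)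
  have hu : ∫⁻ y, u y = 2 * volume S := lintegral_indicator_const hS 2
  have hu_fin : ∫⁻ y, u y ≠ ∞ := by rw [hu]; exact ENNReal.mul_ne_top (by simp) hfin
  set t : Set (E n) := {x | ∃ R, 0 < R ∧ volume (ball x R) ≤ ∫⁻ y in ball x R, u y}
  have hBt : ∀ᵐ x, x ∈ B → x ∈ t := by
    filter_upwards [ae_exists_ball_half_density hS] with x hx hxB using hx (hBS hxB)
  -- `S` fills at least half of the stopping ball but less than half of its 4-fold enlargement,
  -- which is the ball that Vitali uses for covering.
  have hr : ∀ x ∈ t, ∃ R, 0 < R ∧ volume (ball x R) ≤ ∫⁻ y in ball x R, u y ∧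
      ∫⁻ y in ball x (4 * R), u y < volume (ball x (4 * R)) := fun x ⟨R₀, h0, h1⟩ =>
    exists_ball_scale x hu_fin (by norm_num) h0 h1
  choose! r hr0 hr1 hr2 using hr
  obtain ⟨w, hwt, hw, -, hcov, hsum⟩ := exists_disjoint_balls t id r hr0 hu_fin hr1
  have hball : ∀ b ∈ w, volume (B ∩ ball b (4 * r b)) ≤ ε * volume (ball b (4 * r b)) := by
    intro b hb
    rcases (B ∩ ball b (4 * r b)).eq_empty_or_nonempty with h0 | ⟨z, hzB, hz⟩
    · rw [h0, measure_empty]; exact zero_le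
    obtain ⟨v, hv⟩ := hosc b (4 * r b) ⟨z, hz, hzB.2⟩
    set V := volume (ball b (4 * r b))
    set X := {x | x ∈ ball b (4 * r b) ∧ (l : ℝ≥0∞) < ‖F x - v‖ₑ}
    have hV0 : V ≠ 0 := volume_ball_ne_zero _ (pos_of_mem_ball hz)
    have hV : V ≠ ∞ := volume_ball_ne_top _ _
    have h1 : 2 * volume (S ∩ ball b (4 * r b)) < V := by
      have := hr2 b (hwt hb)
      rwa [setLIntegral_indicator hS, setLIntegral_const] at this
    have h2 : volume X ≤ V / 4 := by
      refine hv.trans ?_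
      rw [div_eq_mul_inv, mul_comm V]
      gcongr
      have : (ε : ℝ≥0∞) ≤ ((1 / 4 : ℝ≥0) : ℝ≥0∞) := ENNReal.coe_le_coe.2 hε
      simpa using this
    -- `S` takes less than half of the ball and `X` at most a quarter, so some `x` avoids both. Then
    -- `v` has modulus at most `2 l`, and `‖F y‖ > 3 l` forces `y ∈ X`.
    obtain ⟨x, hxb, hxS, hxX⟩ : ∃ x ∈ ball b (4 * r b), x ∉ S ∧ x ∉ X := by
      by_contra! h
      have h3 : ball b (4 * r b) ⊆ (S ∩ ball b (4 * r b)) ∪ X := by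
        intro x hx
        by_cases hxS : x ∈ S
        · exact .inl ⟨hxS, hx⟩
        · exact .inr (h x hx hxS)
      have h4 : V ≤ volume (S ∩ ball b (4 * r b)) + V / 4 :=
        (measure_mono h3).trans ((measure_union_le _ _).trans (by gcongr))
      have h5 : volume (S ∩ ball b (4 * r b)) < V / 2 := by
        rw [ENNReal.lt_div_iff_mul_lt (.inl (by simp)) (.inl (by simp)), mul_comm]
        exact h1
      have h6 : V / 4 ≤ V / 2 := ENNReal.div_le_div_left (by norm_num) V
      have h7 : V / 4 ≠ ∞ := ENNReal.div_ne_top hV (by simp)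
      have h8 : volume (S ∩ ball b (4 * r b)) + V / 4 < V / 2 + V / 2 :=
        ENNReal.add_lt_add_of_lt_of_le h7 h5 h6
      rw [ENNReal.add_halves] at h8
      exact absurd h4 (not_le.2 h8)
    have hx1 : ‖F x‖ₑ ≤ l := not_lt.1 hxS
    have hx2 : ‖F x - v‖ₑ ≤ l := not_lt.1 fun h => hxX ⟨hxb, h⟩
    refine (measure_mono ?_).trans hv
    rintro y ⟨hyB, hyb⟩
    refine ⟨hyb, ?_⟩
    by_contra hy
    have hy' : ‖F y - v‖ₑ ≤ l := not_lt.1 hy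
    have e1 : F y = (F y - v) - (F x - v) + F x := by ring
    have e2 : ‖F y‖ₑ ≤ 3 * l := by
      calc ‖F y‖ₑ = ‖(F y - v) - (F x - v) + F x‖ₑ := by rw [← e1]
        _ ≤ (‖F y - v‖ₑ + ‖F x - v‖ₑ) + ‖F x‖ₑ :=
            (enorm_add_le _ _).trans (by gcongr; exact enorm_sub_le)
        _ ≤ (l + l) + l := by gcongr
        _ = 3 * l := by ring
    exact absurd hyB.1 (not_lt.2 e2)
  calc volume B ≤ volume (⋃ b ∈ w, B ∩ ball b (4 * r b)) := by
        refine measure_mono_ae ?_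
        filter_upwards [hBt] with x hx hxB
        obtain ⟨b, hb, hsub⟩ := hcov x (hx hxB)
        exact mem_iUnion₂.2 ⟨b, hb, hxB, hsub (mem_ball_self (hr0 x (hx hxB)))⟩
    _ ≤ ∑' b : w, volume (B ∩ ball (b : E n) (4 * r b)) := measure_biUnion_le _ hw _
    _ ≤ ∑' b : w, ε * 4 ^ n * volume (ball (b : E n) (r b)) := by
        refine ENNReal.tsum_le_tsum fun b => (hball b b.2).trans (le_of_eq ?_)
        rw [volume_ball_mul (b : E n) b (by norm_num) (hr0 _ (hwt b.2)).le,
          ENNReal.ofReal_pow (by norm_num), ENNReal.ofReal_ofNat, mul_assoc]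
    _ = ε * 4 ^ n * ∑' b : w, volume (ball (b : E n) (r b)) := ENNReal.tsum_mul_left
    _ ≤ ε * 4 ^ n * (2 * volume S) := by
        rw [← hu]; gcongr; exact hsum
    _ = _ := by ring

/-- Truncated powers of a function in weak `L^t` are integrable above the exponent `t`. -/
theorem lintegral_min_rpow_ne_top {F : E n → ℝ≥0∞} (hF : Measurable F) {s t : ℝ} (ht : 0 ≤ t)
    (hts : t < s) {A : ℝ≥0∞} (hA : A ≠ ∞)
    (h : ∀ l : ℝ≥0, 0 < l → volume {x | (l : ℝ≥0∞) < F x} ≤ A * (l : ℝ≥0∞)⁻¹ ^ t) (Λ : ℝ≥0) :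
    ∫⁻ x, (min (F x) Λ) ^ s ≠ ∞ := by
  have hs : 0 < s := ht.trans_lt hts
  rw [lintegral_rpow_eq_lintegral_meas_ofReal_lt (hF.min measurable_const).aemeasurable
    (Eventually.of_forall fun x => ((min_le_right _ _).trans_lt ENNReal.coe_lt_top).ne) hs]
  refine ENNReal.mul_ne_top ENNReal.ofReal_ne_top ?_
  -- Beyond `Λ` the level sets are empty; below it the integrand is at most `A * r ^ (s - t - 1)`,
  -- integrable at zero as `t < s`.
  have hle : ∀ r ∈ Ioi (0 : ℝ), volume {x | ENNReal.ofReal r < min (F x) Λ} *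
      ENNReal.ofReal (r ^ (s - 1)) ≤ (Ioo (0 : ℝ) Λ).indicator
        (fun r => A * ENNReal.ofReal (r ^ (s - t - 1))) r := by
    intro r hr
    have hr0 : 0 < r := hr
    by_cases hrΛ : r < Λ
    · rw [indicator_of_mem (show r ∈ Ioo (0 : ℝ) Λ from ⟨hr0, hrΛ⟩)]
      have h1 : volume {x | ENNReal.ofReal r < min (F x) Λ} ≤
          A * (ENNReal.ofReal r)⁻¹ ^ t := by
        refine le_trans (measure_mono ?_) (h r.toNNReal (Real.toNNReal_pos.2 hr0))
        exact fun x (hx : ENNReal.ofReal r < _) => lt_of_lt_of_le hx (min_le_left _ _)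
      calc _ ≤ A * (ENNReal.ofReal r)⁻¹ ^ t * ENNReal.ofReal (r ^ (s - 1)) := by gcongr
        _ = _ := by
          rw [mul_assoc, ← ENNReal.ofReal_inv_of_pos hr0, ENNReal.ofReal_rpow_of_pos
            (inv_pos.2 hr0), ← ENNReal.ofReal_mul (by positivity)]
          congr 2
          rw [Real.inv_rpow hr0.le, ← Real.rpow_neg hr0.le, ← Real.rpow_add hr0]
          congr 1; ring
    · have : {x | ENNReal.ofReal r < min (F x) Λ} = ∅ := by
        ext x
        simp only [mem_ofPred_eq, mem_empty_iff_false, iff_false, not_lt]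
        refine (min_le_right _ _).trans ?_
        rw [← ENNReal.ofReal_coe_nnreal]
        exact ENNReal.ofReal_le_ofReal (not_lt.1 hrΛ)
      rw [this, measure_empty, zero_mul]
      exact zero_le
  refine ne_top_of_le_ne_top ?_ (setLIntegral_mono' measurableSet_Ioi hle)
  rw [setLIntegral_indicator measurableSet_Ioo, inter_eq_left.2 Ioo_subset_Ioi_self,
    lintegral_const_mul' _ _ hA, lintegral_Ioo_rpow Λ.coe_nonneg (by linarith)]
  exact ENNReal.mul_ne_top hA ENNReal.ofReal_ne_top

/-- Integrating a good-`λ` inequality. -/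
theorem lintegral_rpow_le_of_goodLambda {F G : E n → ℝ≥0∞} (hF : Measurable F) (hG : Measurable G)
    {s : ℝ} (hs : 0 < s) {γ : ℝ≥0} (hγ : 0 < γ) (hGfin : ∀ᵐ x, G x ≠ ∞)
    (hfin : ∀ Λ : ℝ≥0, ∫⁻ x, (min (F x) Λ) ^ s ≠ ∞)
    (h : ∀ l : ℝ≥0, 0 < l → volume {x | 3 * (l : ℝ≥0∞) < F x} ≤
      (3 ^ s)⁻¹ / 2 * volume {x | (l : ℝ≥0∞) < F x} + volume {x | (γ * l : ℝ≥0∞) < G x}) :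
    ∫⁻ x, F x ^ s ≤ 2 * 3 ^ s * (γ : ℝ≥0∞)⁻¹ ^ s * ∫⁻ x, G x ^ s := by
  have hγ0 : (γ : ℝ≥0∞) ≠ 0 := by simpa using hγ.ne'
  have h3s : (3 : ℝ≥0∞) ^ s ≠ 0 := by simp [ENNReal.rpow_eq_zero_iff]
  have h3s' : (3 : ℝ≥0∞) ^ s ≠ ∞ := ENNReal.rpow_ne_top_of_nonneg hs.le (by simp)
  -- Truncation makes the integral finite, so that part of it can be absorbed. The bound does not
  -- depend on `Λ`, and monotone convergence removes the truncation.
  have key : ∀ Λ : ℝ≥0, ∫⁻ x, (min (F x) Λ) ^ s ≤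
      2 * 3 ^ s * (γ : ℝ≥0∞)⁻¹ ^ s * ∫⁻ x, G x ^ s := by
    intro Λ
    set H : E n → ℝ≥0∞ := fun x => min (F x) Λ with hH
    have hHm : Measurable H := hF.min measurable_const
    have hHtop : ∀ x, H x ≠ ∞ := fun x => ((min_le_right _ _).trans_lt ENNReal.coe_lt_top).ne
    have e1 : ∫⁻ x, (3⁻¹ * H x) ^ s = (3 ^ s)⁻¹ * ∫⁻ x, H x ^ s := by
      simp_rw [ENNReal.mul_rpow_of_nonneg _ _ hs.le, ENNReal.inv_rpow]
      exact lintegral_const_mul' _ _ (ENNReal.inv_ne_top.2 h3s)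
    have e2 : ∫⁻ x, ((γ : ℝ≥0∞)⁻¹ * G x) ^ s = (γ : ℝ≥0∞)⁻¹ ^ s * ∫⁻ x, G x ^ s := by
      simp_rw [ENNReal.mul_rpow_of_nonneg _ _ hs.le]
      exact lintegral_const_mul' _ _
        (ENNReal.rpow_ne_top_of_nonneg hs.le (ENNReal.inv_ne_top.2 hγ0))
    have hle : ∀ t ∈ Ioi (0 : ℝ), volume {x | ENNReal.ofReal t < 3⁻¹ * H x} *
        ENNReal.ofReal (t ^ (s - 1)) ≤
        (3 ^ s)⁻¹ / 2 * (volume {x | ENNReal.ofReal t < H x} * ENNReal.ofReal (t ^ (s - 1))) +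
        volume {x | ENNReal.ofReal t < (γ : ℝ≥0∞)⁻¹ * G x} * ENNReal.ofReal (t ^ (s - 1)) := by
      intro t ht
      have ht0 : 0 < t := ht
      rw [← mul_assoc, ← add_mul]
      gcongr
      have s1 : {x | ENNReal.ofReal t < 3⁻¹ * H x} = {x | 3 * ENNReal.ofReal t < H x} := by
        ext x
        simp only [mem_ofPred_eq]
        rw [mul_comm, ← div_eq_mul_inv, ENNReal.lt_div_iff_mul_lt (.inl (by simp))
          (.inl (by simp)), mul_comm]
      have s2 : {x | ENNReal.ofReal t < (γ : ℝ≥0∞)⁻¹ * G x} =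
          {x | (γ * ENNReal.ofReal t : ℝ≥0∞) < G x} := by
        ext x
        simp only [mem_ofPred_eq]
        rw [mul_comm, ← div_eq_mul_inv, ENNReal.lt_div_iff_mul_lt (.inl hγ0)
          (.inl ENNReal.coe_ne_top), mul_comm]
      rw [s1, s2]
      -- Below `Λ / 3` the truncation is invisible on both sides; from there on the left-hand set is
      -- empty.
      by_cases hc : 3 * ENNReal.ofReal t < Λ
      · have hc' : ENNReal.ofReal t < Λ :=
          lt_of_le_of_lt (le_mul_of_one_le_left' (by norm_num)) hc
        have s3 : {x | 3 * ENNReal.ofReal t < H x} = {x | 3 * ENNReal.ofReal t < F x} := by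
          ext x; simp [hH, hc]
        have s4 : {x | ENNReal.ofReal t < H x} = {x | ENNReal.ofReal t < F x} := by
          ext x; simp [hH, hc']
        rw [s3, s4]
        exact h t.toNNReal (Real.toNNReal_pos.2 ht0)
      · have : {x | 3 * ENNReal.ofReal t < H x} = ∅ := by
          ext x; simp [hH, hc]
        rw [this, measure_empty]
        exact zero_le
    have hmeas : Measurable fun t : ℝ =>
        volume {x | ENNReal.ofReal t < H x} * ENNReal.ofReal (t ^ (s - 1)) := by
      refine Measurable.mul ?_ (by fun_prop)
      have : Antitone fun t : ℝ => volume {x | ENNReal.ofReal t < H x} := fun t t' htt' =>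
        measure_mono fun x hx => (ENNReal.ofReal_le_ofReal htt').trans_lt hx
      exact this.measurable
    have hX : (3 ^ s)⁻¹ * ∫⁻ x, H x ^ s ≤ (3 ^ s)⁻¹ / 2 * (∫⁻ x, H x ^ s) +
        (γ : ℝ≥0∞)⁻¹ ^ s * ∫⁻ x, G x ^ s := by
      rw [← e1, ← e2, lintegral_rpow_eq_lintegral_meas_ofReal_lt
        (hHm.const_mul _).aemeasurable (Eventually.of_forall fun x =>
          ENNReal.mul_ne_top (by simp) (hHtop x)) hs,
        lintegral_rpow_eq_lintegral_meas_ofReal_lt hHm.aemeasurable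
          (Eventually.of_forall hHtop) hs,
        lintegral_rpow_eq_lintegral_meas_ofReal_lt (hG.const_mul _).aemeasurable
          (by filter_upwards [hGfin] with x hx using
            ENNReal.mul_ne_top (ENNReal.inv_ne_top.2 hγ0) hx) hs]
      calc _ ≤ ENNReal.ofReal s * ∫⁻ t in Ioi (0 : ℝ), ((3 ^ s)⁻¹ / 2 *
              (volume {x | ENNReal.ofReal t < H x} * ENNReal.ofReal (t ^ (s - 1))) +
            volume {x | ENNReal.ofReal t < (γ : ℝ≥0∞)⁻¹ * G x} * ENNReal.ofReal (t ^ (s - 1))) := by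
            gcongr 1
            exact setLIntegral_mono' measurableSet_Ioi hle
        _ = _ := by
            rw [lintegral_add_left (hmeas.const_mul _), lintegral_const_mul _ hmeas]
            ring
    set X := ∫⁻ x, H x ^ s
    set Y := (γ : ℝ≥0∞)⁻¹ ^ s * ∫⁻ x, G x ^ s
    have hXfin : X ≠ ∞ := hfin Λ
    -- Multiplying by `3 ^ s` turns the factor `(3 ^ s)⁻¹ / 2` into one half, which is absorbed.
    have h1 : X ≤ X / 2 + 3 ^ s * Y := by
      have := mul_le_mul_right hX (3 ^ s)
      rw [← mul_assoc, ENNReal.mul_inv_cancel h3s h3s', one_mul, mul_add, ← mul_assoc,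
        ← mul_div_assoc, ENNReal.mul_inv_cancel h3s h3s', one_div, ← ENNReal.div_eq_inv_mul] at this
      exact this
    have hX2 : X / 2 ≠ ∞ := ENNReal.div_ne_top hXfin (by simp)
    have h2 : X / 2 ≤ 3 ^ s * Y := by
      nth_rw 1 [← ENNReal.add_halves X] at h1
      exact (ENNReal.add_le_add_iff_left hX2).1 h1
    rw [ENNReal.div_le_iff_le_mul (.inl (by simp)) (.inl (by simp))] at h2
    calc X ≤ 3 ^ s * Y * 2 := h2
      _ = _ := by simp only [Y]; ring
  have hsup : ∫⁻ x, F x ^ s = ⨆ k : ℕ, ∫⁻ x, (min (F x) ((k : ℝ≥0) : ℝ≥0∞)) ^ s := by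
    rw [← lintegral_iSup (fun k => (hF.min measurable_const).pow_const s)]
    · refine lintegral_congr fun x => ?_
      have hmono : Monotone fun k : ℕ => (min (F x) ((k : ℝ≥0) : ℝ≥0∞)) ^ s := fun i j hij => by
        dsimp only
        gcongr
      refine tendsto_nhds_unique ?_ (tendsto_atTop_iSup hmono)
      refine (ENNReal.continuous_rpow_const.tendsto _).comp ?_
      have h1 : Tendsto (fun k : ℕ => min (F x) ((k : ℝ≥0) : ℝ≥0∞)) atTop (𝓝 (min (F x) ∞)) := by
        refine Tendsto.min tendsto_const_nhds ?_
        simpa using ENNReal.tendsto_nat_nhds_top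
      simpa using h1
    · intro i j hij x
      dsimp only
      gcongr
  rw [hsup]
  exact iSup_le fun k => key k

end GoodLambda

/-! ### Strong type bounds on test functions. -/

section StrongBound

variable {n m : ℕ} [NeZero n]

theorem hasWeakBound_of_eLpNorm_le {T : MultilinearMap ℂ (fun _ : Fin m => Test n) (Fun n)}
    {q : Fin m → ℝ≥0∞} {q₀ : ℝ≥0∞} (h0 : 0 < q₀) (h1 : q₀ < ∞) {C : ℝ≥0}
    (h : ∀ f : Fin m → Test n,
      eLpNorm (T f) q₀ volume ≤ C * ∏ i, eLpNorm (f i) (q i) volume) :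
    HasWeakBound T q q₀.toReal := by
  have hpos : 0 ≤ q₀.toReal := ENNReal.toReal_nonneg
  refine ⟨C ^ q₀.toReal, fun f l hl => ?_⟩
  have hl0 : (l : ℝ≥0∞) ≠ 0 := by simpa using hl.ne'
  calc volume {x | (l : ℝ≥0∞) < ‖T f x‖ₑ} ≤ volume {x | (l : ℝ≥0∞) ≤ ‖T f x‖ₑ} :=
        measure_mono fun x hx => le_of_lt (show (l : ℝ≥0∞) < ‖T f x‖ₑ from hx)
    _ ≤ (l : ℝ≥0∞)⁻¹ ^ q₀.toReal * eLpNorm (T f) q₀ volume ^ q₀.toReal :=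
        meas_ge_le_mul_pow_eLpNorm_enorm volume h0.ne' h1.ne (T f).aestronglyMeasurable hl0
          (by simp)
    _ ≤ (l : ℝ≥0∞)⁻¹ ^ q₀.toReal * (C * ∏ i, eLpNorm (f i) (q i) volume) ^ q₀.toReal := by
        gcongr; exact h f
    _ = _ := by
        rw [ENNReal.coe_rpow_of_nonneg _ hpos, ← ENNReal.mul_rpow_of_nonneg _ _ hpos,
          ← ENNReal.mul_rpow_of_nonneg _ _ hpos, div_eq_mul_inv]
        congr 1
        ring

/-- The integrated good-`λ` inequality. The condition `1 / m < s` is needed for its a priori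
finiteness, which comes from weak `L^{1/m}`. -/
theorem exists_lintegral_rpow_le {T : MultilinearMap ℂ (fun _ : Fin m => Test n) (Fun n)}
    {K : E n → (Fin m → E n) → ℂ} {a : ℕ → ℝ≥0} (hm : m ≠ 0) (hK : IsRegularKernel K a)
    (ha : Summable a) (hT : IsRepresentedBy T K) (hw : HasWeakBound T (fun _ => 1) (m : ℝ)⁻¹)
    {s : ℝ} (hs : (m : ℝ)⁻¹ < s) :
    ∃ C : ℝ≥0, ∀ f : Fin m → Test n,
      ∫⁻ x, ‖T f x‖ₑ ^ s ≤ C * ∫⁻ x, (∏ k, maxFun (fun y => ‖f k y‖ₑ) x) ^ s := by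
  have hs0 : 0 < s := lt_of_le_of_lt (by positivity) hs
  -- `1 / 4` is the requirement of `measure_goodLambda_le`; the second bound brings its factor `ε *
  -- (4 ^ n * 2)` below the absorbable `(3 ^ s)⁻¹ / 2`.
  set ε : ℝ≥0 := min (1 / 4) (((3 : ℝ≥0) ^ s)⁻¹ / 2 / (4 ^ n * 2)) with hε
  have h3 : (0 : ℝ≥0) < 3 ^ s := NNReal.rpow_pos (by norm_num)
  have hε0 : 0 < ε := lt_min (by positivity) (by positivity)
  have hε4 : ε ≤ 1 / 4 := min_le_left _ _
  have hε2 : ε * (4 ^ n * 2) ≤ ((3 : ℝ≥0) ^ s)⁻¹ / 2 := by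
    rw [← le_div_iff₀ (by positivity)]; exact min_le_right _ _
  clear_value ε
  obtain ⟨γ, hγ, hosc⟩ := exists_oscillation_bound hm hK ha hT hw hε0
  obtain ⟨A, hA⟩ := hw
  refine ⟨2 * 3 ^ s * γ⁻¹ ^ s, fun f => ?_⟩
  set G : E n → ℝ≥0∞ := fun x => ∏ k, maxFun (fun y => ‖f k y‖ₑ) x
  have hG : Measurable G := Finset.measurable_prod _ fun k _ => measurable_maxFun _
  have hGfin : ∀ᵐ x, G x ≠ ∞ := by
    have h1 : ∀ k, ∀ᵐ x, maxFun (fun y => ‖f k y‖ₑ) x ≠ ∞ := fun k =>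
      ae_maxFun_ne_top (f k).measurable_enorm.aemeasurable le_rfl
        (by simpa using (f k).lintegral_enorm_ne_top)
    filter_upwards [ae_all_iff.2 h1] with x hx
    exact ENNReal.prod_ne_top fun k _ => hx k
  have hF : Measurable fun x => ‖T f x‖ₑ := (T f).measurable.enorm
  set P := ∏ k, eLpNorm (f k) 1 volume
  have hP : P ≠ ∞ := ENNReal.prod_ne_top fun k _ => ((f k).memLp 1).2.ne
  have hweak : ∀ l : ℝ≥0, 0 < l → volume {x | (l : ℝ≥0∞) < ‖T f x‖ₑ} ≤
      A * P ^ (m : ℝ)⁻¹ * (l : ℝ≥0∞)⁻¹ ^ (m : ℝ)⁻¹ := by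
    intro l hl
    refine (hA f l hl).trans (le_of_eq ?_)
    rw [div_eq_mul_inv, ENNReal.mul_rpow_of_nonneg _ _ (by positivity), mul_assoc]
  have hAP : A * P ^ (m : ℝ)⁻¹ ≠ ∞ := ENNReal.mul_ne_top ENNReal.coe_ne_top
    (ENNReal.rpow_ne_top_of_nonneg (by positivity) hP)
  have key := lintegral_rpow_le_of_goodLambda hF hG hs0 hγ hGfin
    (fun Λ => lintegral_min_rpow_ne_top hF (by positivity) hs hAP hweak Λ) (fun l hl => by
      have hlfin : volume {x | (l : ℝ≥0∞) < ‖T f x‖ₑ} ≠ ∞ := by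
        refine ne_top_of_le_ne_top (ENNReal.mul_ne_top hAP
          (ENNReal.rpow_ne_top_of_nonneg (by positivity) (ENNReal.inv_ne_top.2 ?_))) (hweak l hl)
        simpa using hl.ne'
      have h1 := measure_goodLambda_le (T f).measurable (G := G) (γ := γ) hε4
        hlfin (hosc f l hl)
      have hsub : {x | 3 * (l : ℝ≥0∞) < ‖T f x‖ₑ} ⊆
          {x | 3 * (l : ℝ≥0∞) < ‖T f x‖ₑ ∧ G x ≤ γ * l} ∪ {x | (γ * l : ℝ≥0∞) < G x} := by
        intro x hx
        by_cases hx' : G x ≤ γ * l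
        · exact .inl ⟨hx, hx'⟩
        · exact .inr (not_le.1 hx')
      refine (measure_mono hsub).trans ((measure_union_le _ _).trans ?_)
      gcongr
      refine h1.trans ?_
      gcongr
      have h4 := ENNReal.coe_le_coe.2 hε2
      rw [ENNReal.coe_div two_ne_zero, ENNReal.coe_inv h3.ne',
        ENNReal.coe_rpow_of_nonneg _ hs0.le] at h4
      simpa using h4)
  refine key.trans (le_of_eq ?_)
  rw [ENNReal.coe_mul, ENNReal.coe_mul, ENNReal.coe_rpow_of_nonneg _ hs0.le,
    ENNReal.coe_rpow_of_nonneg _ hs0.le, ENNReal.coe_inv hγ.ne']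
  simp [G]

/-- A Calderón–Zygmund operator is bounded, on test functions, with respect to the norms of
`L^{s₁} × ⋯ × L^{s_m} → L^s`, for all `1 < s_i < ∞`. -/
theorem IsCZOperator.exists_strong_bound
    {T : MultilinearMap ℂ (fun _ : Fin m => Test n) (Fun n)} (hm : m ≠ 0) (hT : IsCZOperator T)
    {s : Fin m → ℝ≥0∞} (hs : ∀ i, s i ∈ Ioo (1 : ℝ≥0∞) ∞) :
    ∃ C : ℝ≥0, ∀ f : Fin m → Test n,
      eLpNorm (T f) (∑ i, (s i)⁻¹)⁻¹ volume ≤ C * ∏ i, eLpNorm (f i) (s i) volume := by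
  obtain ⟨⟨q, q₀, hq, hq₀, hq₀', hqsum, C, hC⟩, K, hKCZ, hrep⟩ := hT
  obtain ⟨a, ha, hK⟩ := hKCZ.exists_isRegularKernel
  have : NeZero m := ⟨hm⟩
  -- the weak type endpoint
  have hqsum' : q₀.toReal⁻¹ = ∑ k, (q k)⁻¹.toReal := by
    rw [← ENNReal.toReal_inv, hqsum, ENNReal.toReal_sum]
    exact fun k _ => ENNReal.inv_ne_top.2 (zero_lt_one.trans (hq k)).ne'
  have hq₀pos : 0 < q₀.toReal := ENNReal.toReal_pos hq₀.ne' hq₀'.ne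
  have hw := HasWeakBound.all_one hK ha hrep (fun k => (hq k).le)
    (by rw [← hqsum']; exact inv_pos.2 hq₀pos)
    (by rw [← hqsum', inv_inv]; exact hasWeakBound_of_eLpNorm_le hq₀ hq₀' hC)
  -- real exponents
  set p : Fin m → ℝ := fun k => (s k).toReal
  have hs0 : ∀ k, s k ≠ 0 := fun k => (zero_lt_one.trans (hs k).1).ne'
  have hp1 : ∀ k, 1 < p k := fun k => by
    rw [← ENNReal.toReal_one]; exact ENNReal.toReal_strict_mono (hs k).2.ne (hs k).1
  have hp0 : ∀ k, 0 < p k := fun k => zero_lt_one.trans (hp1 k)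
  set σ : ℝ := ∑ k, (p k)⁻¹ with hσ
  have hσ0 : 0 < σ := Finset.sum_pos (fun k _ => inv_pos.2 (hp0 k)) Finset.univ_nonempty
  -- All `p k > 1`, so the target exponent `σ⁻¹` lies above `1 / m`.
  have hσm : σ < m := by
    calc σ < ∑ k : Fin m, (1 : ℝ) :=
          Finset.sum_lt_sum_of_nonempty Finset.univ_nonempty fun k _ => inv_lt_one_of_one_lt₀ (hp1 k)
      _ = m := by simp
  have hs₀ : (∑ i, (s i)⁻¹)⁻¹.toReal = σ⁻¹ := by
    rw [ENNReal.toReal_inv, ENNReal.toReal_sum fun k _ => ENNReal.inv_ne_top.2 (hs0 k)]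
    simp [hσ, p, ENNReal.toReal_inv]
  have hsne : (∑ i, (s i)⁻¹)⁻¹ ≠ 0 := by
    intro h; rw [h, ENNReal.toReal_zero] at hs₀; exact (inv_pos.2 hσ0).ne hs₀
  have hsne' : (∑ i, (s i)⁻¹)⁻¹ ≠ ∞ := by
    intro h; rw [h, ENNReal.toReal_top] at hs₀; exact (inv_pos.2 hσ0).ne hs₀
  obtain ⟨C₁, hC₁⟩ := exists_lintegral_rpow_le hm hK ha hrep hw
    (s := σ⁻¹) ((inv_lt_inv₀ (by exact_mod_cast Nat.pos_of_ne_zero hm) hσ0).2 hσm)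
  choose C₂ hC₂ using fun k => exists_lintegral_maxFun_rpow_le n (hp1 k)
  refine ⟨C₁ ^ σ * ∏ k, C₂ k ^ (p k)⁻¹, fun f => ?_⟩
  rw [eLpNorm_eq_lintegral_rpow_enorm_toReal hsne hsne', hs₀, one_div, inv_inv]
  have hnorm : ∀ k, eLpNorm (f k) (s k) volume = (∫⁻ x, ‖f k x‖ₑ ^ p k) ^ (p k)⁻¹ := fun k => by
    rw [eLpNorm_eq_lintegral_rpow_enorm_toReal (hs0 k) (hs k).2.ne, one_div]
  -- Hölder with the weights `(p k)⁻¹ * σ⁻¹`, which add up to one.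
  have hol : ∫⁻ x, (∏ k, maxFun (fun y => ‖f k y‖ₑ) x) ^ σ⁻¹ ≤
      ∏ k, (∫⁻ x, maxFun (fun y => ‖f k y‖ₑ) x ^ p k) ^ ((p k)⁻¹ * σ⁻¹) := by
    have h1 := ENNReal.lintegral_prod_norm_pow_le (μ := volume) Finset.univ
      (f := fun k x => maxFun (fun y => ‖f k y‖ₑ) x ^ p k) (p := fun k => (p k)⁻¹ * σ⁻¹)
      (fun k _ => ((measurable_maxFun _).pow_const _).aemeasurable)
      (by rw [← Finset.sum_mul, ← hσ, mul_inv_cancel₀ hσ0.ne'])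
      (fun k _ => mul_nonneg (inv_pos.2 (hp0 k)).le (inv_pos.2 hσ0).le)
    refine le_trans (le_of_eq (lintegral_congr fun x => ?_)) h1
    rw [← ENNReal.prod_rpow_of_nonneg (inv_pos.2 hσ0).le]
    refine Finset.prod_congr rfl fun k _ => ?_
    rw [← ENNReal.rpow_mul, ← mul_assoc, mul_inv_cancel₀ (hp0 k).ne', one_mul]
  calc (∫⁻ x, ‖T f x‖ₑ ^ σ⁻¹) ^ σ
      ≤ (C₁ * ∏ k, (C₂ k * ∫⁻ x, ‖f k x‖ₑ ^ p k) ^ ((p k)⁻¹ * σ⁻¹)) ^ σ := by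
        gcongr
        refine (hC₁ f).trans ?_
        gcongr
        refine hol.trans (Finset.prod_le_prod' fun k _ => ?_)
        refine ENNReal.rpow_le_rpow (hC₂ k _ (f k).measurable_enorm)
          (mul_nonneg (inv_pos.2 (hp0 k)).le (inv_pos.2 hσ0).le)
    _ = C₁ ^ σ * ∏ k, (C₂ k * ∫⁻ x, ‖f k x‖ₑ ^ p k) ^ (p k)⁻¹ := by
        rw [ENNReal.mul_rpow_of_nonneg _ _ hσ0.le, ← ENNReal.prod_rpow_of_nonneg hσ0.le]
        congr 1
        refine Finset.prod_congr rfl fun k _ => ?_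
        rw [← ENNReal.rpow_mul, mul_assoc, inv_mul_cancel₀ hσ0.ne', mul_one]
    _ = _ := by
        rw [ENNReal.coe_mul, ENNReal.coe_rpow_of_nonneg _ hσ0.le, ENNReal.ofNNReal_finsetProd,
          mul_assoc, ← Finset.prod_mul_distrib]
        congr 1
        refine Finset.prod_congr rfl fun k _ => ?_
        rw [hnorm, ENNReal.mul_rpow_of_nonneg _ _ (inv_pos.2 (hp0 k)).le,
          ENNReal.coe_rpow_of_nonneg _ (inv_pos.2 (hp0 k)).le]

end StrongBound

/-! ### Approximation by mollified truncations. -/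

section Mollifier

variable {n : ℕ}

/-- A bump function supported in the ball of radius `1 / (k + 1)`. -/
noncomputable def mollifierBump (n k : ℕ) : ContDiffBump (0 : E n) where
  rIn := 1 / ((k : ℝ) + 1) / 2
  rOut := 1 / ((k : ℝ) + 1)
  rIn_pos := by positivity
  rIn_lt_rOut := half_lt_self (by positivity)

/-- A bump function equal to one on the ball of radius `k + 1`. -/
noncomputable def cutoffBump (n k : ℕ) : ContDiffBump (0 : E n) where
  rIn := k + 1
  rOut := k + 2
  rIn_pos := by positivity
  rIn_lt_rOut := by linarith

theorem locallyIntegrable_of_LpSum (f : LpSum n) : LocallyIntegrable (f : Fun n) := by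
  obtain ⟨f, hf⟩ := f
  change LocallyIntegrable f
  unfold LpSum at hf
  rw [iSup_subtype'] at hf
  induction hf using Submodule.iSup_induction' with
  | mem s g hg =>
    have : MemLp g s volume := Lp.mem_Lp_iff_memLp.1 hg
    exact this.locallyIntegrable s.2.1.le
  | zero => exact (locallyIntegrable_zero (μ := volume)).congr AEEqFun.coeFn_zero.symm
  | add g h _ _ hg hh => exact (hg.add hh).congr (AEEqFun.coeFn_add g h).symm

theorem integrable_cutoff_smul (k : ℕ) (f : LpSum n) :
    Integrable (fun x => cutoffBump n k x • (f : Fun n) x) :=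
  (locallyIntegrable_of_LpSum f).integrable_smul_left_of_hasCompactSupport
    (cutoffBump n k).continuous (cutoffBump n k).hasCompactSupport

theorem integrable_mollifier_smul (k : ℕ) (f : LpSum n) (x : E n) :
    Integrable fun t => (mollifierBump n k).normed volume (x - t) •
      (cutoffBump n k t • (f : Fun n) t) := by
  have h := (mollifierBump n k).hasCompactSupport_normed (μ := volume)
    |>.convolutionExists_left (ContinuousLinearMap.lsmul ℝ ℝ)
      (mollifierBump n k).continuous_normed (integrable_cutoff_smul k f).locallyIntegrable x
  exact convolutionExistsAt_iff_integrable_swap.1 h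

/-- The mollification of the truncation of a function. -/
noncomputable def mollify (k : ℕ) : LpSum n →ₗ[ℂ] Test n where
  toFun f :=
    { toFun x := ∫ t, (mollifierBump n k).normed volume (x - t) •
        (cutoffBump n k t • (f : Fun n) t)
      contDiff' := by
        have h := (mollifierBump n k).hasCompactSupport_normed (μ := volume)
          |>.contDiff_convolution_left (n := (⊤ : ℕ∞)) (ContinuousLinearMap.lsmul ℝ ℝ)
            (mollifierBump n k).contDiff_normed (integrable_cutoff_smul k f).locallyIntegrable
        convert h using 1
        ext x
        rw [convolution_lsmul_swap]
      hasCompactSupport' := by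
        have h := (mollifierBump n k).hasCompactSupport_normed (μ := volume)
          |>.convolution (μ := volume) (ContinuousLinearMap.lsmul ℝ ℝ)
            (g := fun x => cutoffBump n k x • (f : Fun n) x)
            ((cutoffBump n k).hasCompactSupport.smul_right)
        convert h using 1
        ext x
        rw [convolution_lsmul_swap]
      tsupport_subset' := subset_univ _ }
  map_add' f g := by
    ext x
    change ∫ t, (mollifierBump n k).normed volume (x - t) •
        (cutoffBump n k t • ((f : Fun n) + (g : Fun n) : Fun n) t) = (∫ t, _) + ∫ t, _
    rw [← integral_add (integrable_mollifier_smul k f x) (integrable_mollifier_smul k g x)]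
    refine integral_congr_ae ?_
    filter_upwards [AEEqFun.coeFn_add (f : Fun n) (g : Fun n)] with t ht
    simp [ht]
  map_smul' c f := by
    ext x
    change ∫ t, (mollifierBump n k).normed volume (x - t) •
        (cutoffBump n k t • (c • (f : Fun n) : Fun n) t) = c • ∫ t, _
    rw [← integral_smul]
    refine integral_congr_ae ?_
    filter_upwards [AEEqFun.coeFn_smul c (f : Fun n)] with t ht
    simp only [ht, Pi.smul_apply, smul_comm c]

theorem mollify_apply (k : ℕ) (f : LpSum n) (x : E n) :
    mollify k f x = ∫ t, (mollifierBump n k).normed volume (x - t) •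
        (cutoffBump n k t • (f : Fun n) t) := rfl

/-- A majorant uniform in `k`: the mollifier is at most `2 ^ n` over the volume of its ball, and the
cutoff is at most one. -/
theorem enorm_mollify_le [NeZero n] (k : ℕ) (f : LpSum n) (x : E n) :
    ‖mollify k f x‖ₑ ≤ ENNReal.ofReal (2 ^ n) * maxFun (fun y => ‖(f : Fun n) y‖ₑ) x := by
  set R : ℝ := 1 / ((k : ℝ) + 1) with hR_def
  have hR : 0 < R := by positivity
  set φ := mollifierBump n k with hφ
  have hvol : volume (ball (0 : E n) R) = volume (ball x R) := by
    rw [Measure.addHaar_ball_center volume x]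
  rw [← ENNReal.mul_le_mul_iff_left (volume_ball_ne_zero x hR) (volume_ball_ne_top x R)]
  calc ‖mollify k f x‖ₑ * volume (ball x R)
      ≤ (∫⁻ t, ENNReal.ofReal (φ.normed volume (x - t)) * ‖(f : Fun n) t‖ₑ) *
          volume (ball x R) := by
        gcongr
        rw [mollify_apply]
        refine (enorm_integral_le_lintegral_enorm _).trans (lintegral_mono fun t => ?_)
        rw [enorm_smul, enorm_smul, Real.enorm_of_nonneg (φ.nonneg_normed _),
          Real.enorm_of_nonneg (cutoffBump n k).nonneg]
        gcongr
        refine mul_le_of_le_one_left' ?_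
        rw [← ENNReal.ofReal_one]
        exact ENNReal.ofReal_le_ofReal (cutoffBump n k).le_one
    _ = ∫⁻ t, ENNReal.ofReal (φ.normed volume (x - t)) * ‖(f : Fun n) t‖ₑ *
          volume (ball x R) := (lintegral_mul_const' _ _ (volume_ball_ne_top x R)).symm
    _ ≤ ∫⁻ t, (ball x R).indicator (fun t => ENNReal.ofReal (2 ^ n) * ‖(f : Fun n) t‖ₑ) t := by
        refine lintegral_mono fun t => ?_
        have h := bump_normed_le 0 hR φ rfl rfl (x - t)
        rw [hvol] at h
        calc _ = ENNReal.ofReal (φ.normed volume (x - t)) * volume (ball x R) *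
              ‖(f : Fun n) t‖ₑ := by ring
          _ ≤ (ball 0 R).indicator (fun _ => ENNReal.ofReal (2 ^ n)) (x - t) *
              ‖(f : Fun n) t‖ₑ := by gcongr
          _ = _ := by
            by_cases ht : t ∈ ball x R
            · rw [indicator_of_mem ht, indicator_of_mem]
              rwa [mem_ball_zero_iff, ← dist_eq_norm, ← mem_ball']
            · rw [indicator_of_notMem ht, indicator_of_notMem, zero_mul]
              rwa [mem_ball_zero_iff, ← dist_eq_norm, ← mem_ball']
    _ = ENNReal.ofReal (2 ^ n) * ∫⁻ t in ball x R, ‖(f : Fun n) t‖ₑ := by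
        rw [lintegral_indicator measurableSet_ball, lintegral_const_mul' _ _ ENNReal.ofReal_ne_top]
    _ ≤ ENNReal.ofReal (2 ^ n) *
          (volume (ball x R) * maxFun (fun y => ‖(f : Fun n) y‖ₑ) x) := by
        gcongr
        exact lintegral_ball_le_maxFun _ (mem_ball_self hR)
    _ = _ := by ring

/-- Lebesgue differentiation; for `k ≥ ‖x‖` the cutoff equals `1` on the ball about `x` that the
mollifier sees, and drops out. -/
theorem ae_tendsto_mollify (f : LpSum n) :
    ∀ᵐ x, Tendsto (fun k => mollify k f x) atTop (𝓝 ((f : Fun n) x)) := by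
  have h0 : Tendsto (fun k : ℕ => (mollifierBump n k).rOut) atTop (𝓝 0) :=
    tendsto_one_div_add_atTop_nhds_zero_nat
  filter_upwards [ContDiffBump.ae_convolution_tendsto_right_of_locallyIntegrable (K := 2) h0
    (Eventually.of_forall fun k => le_of_eq (by
      change 1 / ((k : ℝ) + 1) = 2 * (1 / ((k : ℝ) + 1) / 2); ring))
    (locallyIntegrable_of_LpSum f)] with x hx
  refine hx.congr' ?_
  obtain ⟨N, hN⟩ := exists_nat_ge ‖x‖
  filter_upwards [eventually_ge_atTop N] with k hk
  rw [convolution_lsmul_swap, mollify_apply]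
  refine integral_congr_ae (Eventually.of_forall fun t => ?_)
  change _ • (f : Fun n) t = _ • cutoffBump n k t • (f : Fun n) t
  by_cases ht : x - t ∈ ball (0 : E n) (mollifierBump n k).rOut
  · have h1 : ‖x - t‖ < 1 / ((k : ℝ) + 1) := mem_ball_zero_iff.1 ht
    have h2 : 1 / ((k : ℝ) + 1) ≤ 1 := by
      rw [div_le_one (by positivity)]; linarith [(Nat.cast_nonneg k : (0 : ℝ) ≤ k)]
    have h3 : t ∈ closedBall (0 : E n) (cutoffBump n k).rIn := by
      rw [mem_closedBall_zero_iff]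
      change ‖t‖ ≤ k + 1
      have h4 : ‖t‖ ≤ ‖x‖ + ‖x - t‖ := by
        rw [norm_sub_rev x t]; exact norm_le_norm_add_norm_sub' t x
      have h5 : (N : ℝ) ≤ k := by exact_mod_cast hk
      linarith
    rw [(cutoffBump n k).one_of_mem_closedBall h3, one_smul]
  · have : (mollifierBump n k).normed volume (x - t) = 0 := by
      rwa [← Function.notMem_support, ContDiffBump.support_normed_eq]
    rw [this, zero_smul, zero_smul]

/-- The mollifications of a function of `L^s`, `1 < s < ∞`, converge to it in `L^s`. -/
theorem tendsto_eLpNorm_mollify_sub [NeZero n] {s : ℝ≥0∞} (hs : s ∈ Ioo (1 : ℝ≥0∞) ∞)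
    (f : LpSum n) (hf : (f : Fun n) ∈ Lp ℂ s volume) :
    Tendsto (fun k => eLpNorm (fun x => mollify k f x - (f : Fun n) x) s volume) atTop (𝓝 0) := by
  have hs0 : s ≠ 0 := (zero_lt_one.trans hs.1).ne'
  have hs1 : 1 < s.toReal := by
    rw [← ENNReal.toReal_one]; exact ENNReal.toReal_strict_mono hs.2.ne hs.1
  have hs0' : 0 < s.toReal := zero_lt_one.trans hs1
  have hfm : Measurable fun x => ‖(f : Fun n) x‖ₑ := (f : Fun n).measurable.enorm
  have hfint : ∫⁻ x, ‖(f : Fun n) x‖ₑ ^ s.toReal ≠ ∞ :=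
    (lintegral_rpow_enorm_lt_top_of_eLpNorm_lt_top hs0 hs.2.ne (Lp.mem_Lp_iff_eLpNorm_lt_top.1 hf)).ne
  obtain ⟨C, hC⟩ := exists_lintegral_maxFun_rpow_le n hs1
  set M := maxFun fun y => ‖(f : Fun n) y‖ₑ
  have hM : Measurable M := measurable_maxFun _
  have hMint : ∫⁻ x, M x ^ s.toReal ≠ ∞ :=
    ne_top_of_le_ne_top (ENNReal.mul_ne_top ENNReal.coe_ne_top hfint) (hC _ hfm)
  have key : Tendsto (fun k => ∫⁻ x, ‖mollify k f x - (f : Fun n) x‖ₑ ^ s.toReal) atTop (𝓝 0) := by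
    -- The majorant is integrable because the maximal function is bounded on `L^s` for `s > 1`.
    have h := tendsto_lintegral_of_dominated_convergence (μ := (volume : Measure (E n)))
      (F := fun k x => ‖mollify k f x - (f : Fun n) x‖ₑ ^ s.toReal) (f := fun _ => 0)
      (fun x => 2 ^ (s.toReal - 1) *
        ((ENNReal.ofReal (2 ^ n) * M x) ^ s.toReal + ‖(f : Fun n) x‖ₑ ^ s.toReal))
      (fun k => (((mollify k f).continuous.measurable.sub
        (f : Fun n).measurable).enorm.pow_const _))
      (fun k => Eventually.of_forall fun x => by
        refine le_trans ?_ (ENNReal.rpow_add_le_mul_rpow_add_rpow _ _ hs1.le)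
        refine ENNReal.rpow_le_rpow ?_ hs0'.le
        exact (enorm_sub_le).trans (add_le_add_left (enorm_mollify_le k f x) _)) ?_ ?_
    · simpa using h
    · rw [lintegral_const_mul' _ _ (ENNReal.rpow_ne_top_of_nonneg (by linarith) (by simp)),
        lintegral_add_left ((hM.const_mul _).pow_const _)]
      simp_rw [ENNReal.mul_rpow_of_nonneg _ _ hs0'.le]
      rw [lintegral_const_mul _ (hM.pow_const _)]
      refine ENNReal.mul_ne_top (ENNReal.rpow_ne_top_of_nonneg (by linarith) (by simp))
        (ENNReal.add_ne_top.2 ⟨ENNReal.mul_ne_top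
          (ENNReal.rpow_ne_top_of_nonneg hs0'.le ENNReal.ofReal_ne_top) hMint, hfint⟩)
    · filter_upwards [ae_tendsto_mollify f] with x hx
      have h1 : Tendsto (fun k => ‖mollify k f x - (f : Fun n) x‖ₑ) atTop (𝓝 0) := by
        have := (hx.sub_const ((f : Fun n) x)).enorm
        simpa using this
      have h2 := h1.ennrpow_const s.toReal
      rwa [ENNReal.zero_rpow_of_pos hs0'] at h2
  simp_rw [eLpNorm_eq_lintegral_rpow_enorm_toReal hs0 hs.2.ne]
  have h3 := key.ennrpow_const (1 / s.toReal)
  rwa [ENNReal.zero_rpow_of_pos (by positivity)] at h3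

end Mollifier

/-! ### Convergence in measure, and completeness of `L^s` including `s < 1`. -/

section ConvergenceInMeasure

variable {α ι F : Type*} {_ : MeasurableSpace α} {μ : Measure α} [NormedAddCommGroup F]

theorem tendstoInMeasure_add {l : Filter ι} {f f' : ι → α → F} {g g' : α → F}
    (h : TendstoInMeasure μ f l g) (h' : TendstoInMeasure μ f' l g') :
    TendstoInMeasure μ (fun i => f i + f' i) l (g + g') := by
  intro ε hε
  have h2 := (h _ (ENNReal.half_pos hε.ne')).add (h' _ (ENNReal.half_pos hε.ne'))
  rw [add_zero] at h2
  refine tendsto_of_tendsto_of_tendsto_of_le_of_le tendsto_const_nhds h2 (fun _ => bot_le)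
    fun i => (measure_mono fun x hx => ?_).trans (measure_union_le _ _)
  by_contra hcon
  simp only [mem_union, mem_ofPred_eq, not_or, not_le] at hcon
  have h3 : ε ≤ edist (f i x + f' i x) (g x + g' x) := hx
  exact absurd (h3.trans (edist_add_add_le _ _ _ _))
    (not_le.2 ((ENNReal.add_lt_add hcon.1 hcon.2).trans_eq (ENNReal.add_halves ε)))

theorem tendstoInMeasure_const_smul {𝕜 : Type*} [NormedField 𝕜] [NormedSpace 𝕜 F] {l : Filter ι}
    {f : ι → α → F} {g : α → F} (h : TendstoInMeasure μ f l g) (c : 𝕜) :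
    TendstoInMeasure μ (fun i => c • f i) l (c • g) := by
  intro ε hε
  refine tendsto_of_tendsto_of_tendsto_of_le_of_le tendsto_const_nhds
    (h (ε / ‖c‖ₑ) (ENNReal.div_pos hε.ne' enorm_ne_top)) (fun _ => bot_le)
    fun i => measure_mono fun x hx => ?_
  have h3 : ε ≤ edist (c • f i x) (c • g x) := hx
  rw [edist_eq_enorm_sub, ← smul_sub, enorm_smul] at h3
  change ε / ‖c‖ₑ ≤ edist (f i x) (g x)
  rw [edist_eq_enorm_sub]
  exact ENNReal.div_le_of_le_mul' h3

/-- Completeness of `L^s`, for all `0 < s ≤ ∞`. -/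
theorem exists_tendsto_eLpNorm_of_cauchy [CompleteSpace F] {s : ℝ≥0∞} (hs : s ≠ 0)
    {u : ℕ → α → F} (hu : ∀ k, AEStronglyMeasurable (u k) μ)
    (h : Tendsto (fun k : ℕ × ℕ => eLpNorm (u k.1 - u k.2) s μ) (atTop ×ˢ atTop) (𝓝 0)) :
    ∃ g : α → F, AEStronglyMeasurable g μ ∧
      Tendsto (fun k => eLpNorm (u k - g) s μ) atTop (𝓝 0) := by
  have hmeas : TendstoInMeasure μ (fun k : ℕ × ℕ => u k.1 - u k.2) (atTop ×ˢ atTop) 0 :=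
    tendstoInMeasure_of_tendsto_eLpNorm hs (fun k => (hu _).sub (hu _))
      aestronglyMeasurable_zero (by simpa using h)
  -- A subsequence so fast that, by Borel–Cantelli, at almost every point the consecutive distances
  -- are eventually below `2 ^ (-l)`.
  obtain ⟨φ, hφ, hφ'⟩ := extraction_forall_of_eventually
    (P := fun l k => ∀ i ≥ k, ∀ j ≥ k,
      μ {x | (2⁻¹ : ℝ≥0∞) ^ l ≤ edist (u i x) (u j x)} ≤ 2⁻¹ ^ l) (fun l => by
    have hpos : (0 : ℝ≥0∞) < 2⁻¹ ^ l := ENNReal.pow_pos (by simp) l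
    have h1 := (hmeas _ hpos).eventually (ge_mem_nhds hpos)
    rw [prod_atTop_atTop_eq, eventually_atTop] at h1
    obtain ⟨N, hN⟩ := h1
    filter_upwards [eventually_ge_atTop (max N.1 N.2)] with k hk i hi j hj
    have h2 := hN (i, j) ⟨(le_max_left _ _).trans (hk.trans hi), (le_max_right _ _).trans (hk.trans hj)⟩
    simpa [edist_eq_enorm_sub] using h2)
  have hsum : ∑' l, μ {x | (2⁻¹ : ℝ≥0∞) ^ l ≤ edist (u (φ l) x) (u (φ (l + 1)) x)} ≠ ∞ := by
    refine ne_top_of_le_ne_top ?_ (ENNReal.tsum_le_tsum fun l =>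
      hφ' l (φ l) le_rfl (φ (l + 1)) (hφ.monotone (Nat.le_succ l)))
    rw [ENNReal.tsum_geometric]
    simp
  have hlim : ∀ᵐ x ∂μ, ∃ y, Tendsto (fun l => u (φ l) x) atTop (𝓝 y) := by
    filter_upwards [ae_eventually_notMem hsum] with x hx
    obtain ⟨N, hN⟩ := eventually_atTop.1 hx
    have hc : CauchySeq fun l => u (φ (l + N)) x := by
      refine cauchySeq_of_edist_le_geometric_two 2 (by simp) fun l => ?_
      have h1 : edist (u (φ (l + N)) x) (u (φ (l + N + 1)) x) < 2⁻¹ ^ (l + N) :=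
        not_le.1 (hN (l + N) (by omega))
      rw [show l + 1 + N = l + N + 1 by omega]
      refine h1.le.trans ?_
      rw [pow_add, div_eq_mul_inv, ← ENNReal.inv_pow, mul_comm]
      gcongr
      exact (pow_le_one₀ bot_le (by simp)).trans (by norm_num)
    obtain ⟨y, hy⟩ := cauchySeq_tendsto_of_complete hc
    exact ⟨y, (tendsto_add_atTop_iff_nat N).1 hy⟩
  classical
  set g : α → F := fun x => if hx : ∃ y, Tendsto (fun l => u (φ l) x) atTop (𝓝 y)
    then hx.choose else 0
  have hg : ∀ᵐ x ∂μ, Tendsto (fun l => u (φ l) x) atTop (𝓝 (g x)) := by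
    filter_upwards [hlim] with x hx
    simp only [g, dif_pos hx]
    exact hx.choose_spec
  refine ⟨g, aestronglyMeasurable_of_tendsto_ae atTop (fun l => hu (φ l)) hg, ?_⟩
  rw [ENNReal.tendsto_nhds_zero]
  intro ε hε
  have h1 := h.eventually (ge_mem_nhds hε)
  rw [prod_atTop_atTop_eq, eventually_atTop] at h1
  obtain ⟨N, hN⟩ := h1
  filter_upwards [eventually_ge_atTop N.1] with k hk
  -- Fatou along the subsequence, with `u k` fixed.
  refine Lp.eLpNorm_le_of_ae_tendsto (u := atTop) (f := fun l => u k - u (φ l)) ?_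
    (fun l => (hu _).sub (hu _)) ?_
  · filter_upwards [eventually_ge_atTop N.2] with l hl
    exact hN (k, φ l) ⟨hk, hl.trans (hφ.id_le l)⟩
  · filter_upwards [hg] with x hx
    exact tendsto_const_nhds.sub hx

end ConvergenceInMeasure

/-! ### Continuity of multilinear maps, and induction over sums of Lebesgue spaces. -/

section Multilinear

variable {n m : ℕ}

/-- Joint continuity, in a quantitative form, of bounded multilinear maps. -/
theorem tendsto_eLpNorm_map_sub {V κ : Type*} [AddCommMonoid V] [Module ℂ V]
    (M : MultilinearMap ℂ (fun _ : Fin m => V) (Fun n)) (N : Fin m → V → ℝ≥0∞) {s : ℝ≥0∞}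
    {C : ℝ≥0} (hM : ∀ v, (∀ i, N i (v i) ≠ ∞) → eLpNorm (M v) s volume ≤ C * ∏ i, N i (v i))
    {l : Filter κ} {v w d : κ → Fin m → V} (hd : ∀ k i, v k i = w k i + d k i) {a : Fin m → ℝ≥0∞} (ha : ∀ i, a i ≠ ∞)
    (hv : ∀ i, Tendsto (fun k => N i (v k i)) l (𝓝 (a i)))
    (hw : ∀ i, Tendsto (fun k => N i (w k i)) l (𝓝 (a i)))
    (hvw : ∀ i, Tendsto (fun k => N i (d k i)) l (𝓝 0)) :
    Tendsto (fun k => eLpNorm (⇑(M (v k)) - ⇑(M (w k))) s volume) l (𝓝 0) := by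
  -- Slots in `S` carry `v`, the others `w`. Changing one more slot adds a term whose entry there is
  -- the difference `d`, and this term tends to zero. `d` is given separately because `V` has no
  -- subtraction.
  suffices H : ∀ S : Finset (Fin m), Tendsto (fun k =>
      eLpNorm (M (S.piecewise (v k) (w k)) - M (w k) : Fun n) s volume) l (𝓝 0) by
    refine (H Finset.univ).congr fun k => ?_
    rw [Finset.piecewise_univ]
    exact eLpNorm_congr_ae (AEEqFun.coeFn_sub _ _)
  intro S
  induction S using Finset.induction_on with
  | empty =>
    simp only [Finset.piecewise_empty, sub_self]
    rw [show (fun _ : κ => eLpNorm (0 : Fun n) s volume) = fun _ => 0 by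
      ext; rw [eLpNorm_congr_ae AEEqFun.coeFn_zero, eLpNorm_zero]]
    exact tendsto_const_nhds
  | insert j S hj ih =>
    set z : κ → Fin m → V := fun k => Function.update (S.piecewise (v k) (w k)) j (d k j)
    have hz : ∀ i, Tendsto (fun k => N i (z k i)) l (𝓝 (Function.update a j 0 i)) := by
      intro i
      rcases eq_or_ne i j with rfl | hij
      · simpa [z] using hvw i
      · by_cases hi : i ∈ S
        · simpa [z, hij, hi] using hv i
        · simpa [z, hij, hi] using hw i
    have ha' : ∀ i, Function.update a j 0 i ≠ ∞ := by
      intro i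
      rcases eq_or_ne i j with rfl | hij
      · simp
      · simpa [hij] using ha i
    have hMz : Tendsto (fun k => eLpNorm (M (z k)) s volume) l (𝓝 0) := by
      have h1 := ENNReal.Tendsto.const_mul (a := (C : ℝ≥0∞))
        (ENNReal.tendsto_finsetProd_of_ne_top Finset.univ (fun i _ => hz i) (fun i _ => ha' i))
        (.inr ENNReal.coe_ne_top)
      rw [Finset.prod_eq_zero (Finset.mem_univ j) (Function.update_self j 0 a), mul_zero] at h1
      refine tendsto_of_tendsto_of_tendsto_of_le_of_le' tendsto_const_nhds h1
        (Eventually.of_forall fun _ => bot_le) ?_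
      filter_upwards [eventually_all.2 fun i =>
        (hz i).eventually (gt_mem_nhds (lt_top_iff_ne_top.2 (ha' i)))] with k hk
      exact hM _ fun i => (hk i).ne
    -- `LpAddConst s` is the constant of the quasi-triangle inequality, larger than `1` when `0 < s
    -- < 1`.
    have h2 := ENNReal.Tendsto.const_mul (a := ENNReal.LpAddConst s) (hMz.add ih)
      (.inr (ENNReal.LpAddConst_lt_top s).ne)
    rw [add_zero, mul_zero] at h2
    refine tendsto_of_tendsto_of_tendsto_of_le_of_le tendsto_const_nhds h2 (fun _ => bot_le)
      fun k => ?_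
    have hsplit : M ((insert j S).piecewise (v k) (w k)) - M (w k) =
        M (z k) + (M (S.piecewise (v k) (w k)) - M (w k)) := by
      have h3 : S.piecewise (v k) (w k) = Function.update (S.piecewise (v k) (w k)) j (w k j) := by
        rw [eq_comm, Function.update_eq_self_iff, Finset.piecewise_eq_of_notMem _ _ _ hj]
      rw [Finset.piecewise_insert, hd, MultilinearMap.map_update_add, ← h3]
      abel
    change eLpNorm (M ((insert j S).piecewise (v k) (w k)) - M (w k) : Fun n) s volume ≤ _
    rw [hsplit, eLpNorm_congr_ae (AEEqFun.coeFn_add _ _)]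
    exact eLpNorm_add_le' (AEEqFun.aestronglyMeasurable _) (AEEqFun.aestronglyMeasurable _) s

/-- To prove a property of tuples in `LpSum`, it is enough to prove it for tuples in Lebesgue
spaces, and to show that it is additive in every slot. -/
theorem LpSum_pi_induction {P : (Fin m → LpSum n) → Prop}
    (base : ∀ f (s : Fin m → ℝ≥0∞), (∀ i, s i ∈ Ioo (1 : ℝ≥0∞) ∞) →
      (∀ i, (f i : Fun n) ∈ Lp ℂ (s i) volume) → P f)
    (add : ∀ f i x y, P (Function.update f i x) → P (Function.update f i y) →
      P (Function.update f i (x + y))) (f : Fin m → LpSum n) : P f := by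
  -- Slots in `S` may hold arbitrary sums; each of the others lies in a single Lebesgue space.
  suffices H : ∀ (S : Finset (Fin m)) (f : Fin m → LpSum n),
      (∀ i ∉ S, ∃ s ∈ Ioo (1 : ℝ≥0∞) ∞, (f i : Fun n) ∈ Lp ℂ s volume) → P f from
    H Finset.univ f fun i hi => absurd (Finset.mem_univ i) hi
  intro S
  induction S using Finset.induction_on with
  | empty =>
    intro f hf
    choose s hs hfs using fun i => hf i (Finset.notMem_empty i)
    exact base f s hs hfs
  | insert j S hj ih =>
    intro f hf
    have key : ∀ (u : Fun n) (hu : u ∈ LpSum n), P (Function.update f j ⟨u, hu⟩) := by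
      have base' : ∀ u : LpSum n, (∃ s ∈ Ioo (1 : ℝ≥0∞) ∞, (u : Fun n) ∈ Lp ℂ s volume) →
          P (Function.update f j u) := by
        intro u hu
        refine ih _ fun i hi => ?_
        rcases eq_or_ne i j with rfl | hij
        · simpa using hu
        · simpa [hij] using hf i (by simp [hij, hi])
      intro u hu
      have hu' : u ∈ ⨆ s : Ioo (1 : ℝ≥0∞) ∞, Lp.LpSubmodule ℂ ℂ s (volume : Measure (E n)) := by
        rw [iSup_subtype]; exact hu
      suffices ∃ hu : u ∈ LpSum n, P (Function.update f j ⟨u, hu⟩) from this.2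
      clear hu
      induction hu' using Submodule.iSup_induction' with
      | mem s x hx =>
        exact ⟨Submodule.mem_iSup_of_mem s.1 (Submodule.mem_iSup_of_mem s.2 hx),
          base' _ ⟨s, s.2, hx⟩⟩
      | zero =>
        exact ⟨zero_mem _, base' _ ⟨2, ⟨by norm_num, by norm_num⟩, zero_mem _⟩⟩
      | add x y _ _ hx hy =>
        obtain ⟨hx, hx'⟩ := hx
        obtain ⟨hy, hy'⟩ := hy
        exact ⟨add_mem hx hy, add f j ⟨x, hx⟩ ⟨y, hy⟩ hx' hy'⟩
    simpa using key (f j) (f j).2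

end Multilinear

/-! ### Existence and uniqueness of the extension. -/

section Extension

variable {n m : ℕ}

theorem coeFn_ofTest (f : Test n) : ((ofTest f : LpSum n) : Fun n) =ᵐ[volume] f :=
  AEEqFun.coeFn_mk _ _

theorem ofTest_mem_Lp (f : Test n) (s : ℝ≥0∞) : (ofTest f : Fun n) ∈ Lp ℂ s volume :=
  Lp.mem_Lp_iff_memLp.2 ((memLp_congr_ae (coeFn_ofTest f)).2 (f.memLp s))

theorem eLpNorm_ofTest (f : Test n) (s : ℝ≥0∞) :
    eLpNorm (ofTest f : Fun n) s volume = eLpNorm f s volume :=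
  eLpNorm_congr_ae (coeFn_ofTest f)

theorem tendsto_eLpNorm_mollify [NeZero n] {s : ℝ≥0∞} (hs : s ∈ Ioo (1 : ℝ≥0∞) ∞)
    (f : LpSum n) (hf : (f : Fun n) ∈ Lp ℂ s volume) :
    Tendsto (fun k => eLpNorm (mollify k f) s volume) atTop (𝓝 (eLpNorm (f : Fun n) s volume)) := by
  have h := tendsto_eLpNorm_mollify_sub hs f hf
  have hm : ∀ k, AEStronglyMeasurable (mollify k f) (volume : Measure (E n)) := fun k =>
    (mollify k f).continuous.aestronglyMeasurable
  have hfm : AEStronglyMeasurable (f : Fun n) (volume : Measure (E n)) :=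
    (f : Fun n).aestronglyMeasurable
  have hlow : Tendsto (fun k => eLpNorm (f : Fun n) s volume -
      eLpNorm (fun x => mollify k f x - (f : Fun n) x) s volume) atTop
      (𝓝 (eLpNorm (f : Fun n) s volume - 0)) :=
    ENNReal.Tendsto.sub tendsto_const_nhds h (.inr ENNReal.zero_ne_top)
  have hup := (tendsto_const_nhds (x := eLpNorm (f : Fun n) s volume)).add h
  rw [tsub_zero] at hlow
  rw [add_zero] at hup
  refine tendsto_of_tendsto_of_tendsto_of_le_of_le hlow hup (fun k => ?_) (fun k => ?_)
  · refine tsub_le_iff_right.2 ?_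
    calc eLpNorm (f : Fun n) s volume
        = eLpNorm (⇑(mollify k f) - (⇑(mollify k f) - ⇑(f : Fun n))) s volume := by
          rw [sub_sub_cancel]
      _ ≤ _ := eLpNorm_sub_le (hm k) ((hm k).sub hfm) hs.1.le
  · calc eLpNorm (mollify k f) s volume
        = eLpNorm (⇑(f : Fun n) + (⇑(mollify k f) - ⇑(f : Fun n))) s volume := by
          rw [add_sub_cancel]
      _ ≤ _ := eLpNorm_add_le hfm ((hm k).sub hfm) hs.1.le

theorem tendsto_eLpNorm_mollify_sub_mollify [NeZero n] {s : ℝ≥0∞} (hs : s ∈ Ioo (1 : ℝ≥0∞) ∞)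
    (f : LpSum n) (hf : (f : Fun n) ∈ Lp ℂ s volume) :
    Tendsto (fun k : ℕ × ℕ => eLpNorm (mollify k.1 f - mollify k.2 f : Test n) s volume)
      (atTop ×ˢ atTop) (𝓝 0) := by
  have h := tendsto_eLpNorm_mollify_sub hs f hf
  have h2 := (h.comp (tendsto_fst (g := (atTop : Filter ℕ)))).add
    (h.comp (tendsto_snd (f := (atTop : Filter ℕ))))
  rw [add_zero] at h2
  have hm : ∀ k, AEStronglyMeasurable (⇑(mollify k f) - ⇑(f : Fun n)) (volume : Measure (E n)) :=
    fun k => (mollify k f).continuous.aestronglyMeasurable.sub (f : Fun n).aestronglyMeasurable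
  refine tendsto_of_tendsto_of_tendsto_of_le_of_le tendsto_const_nhds h2 (fun _ => bot_le)
    fun k => ?_
  calc eLpNorm (mollify k.1 f - mollify k.2 f : Test n) s volume
      = eLpNorm ((⇑(mollify k.1 f) - ⇑(f : Fun n)) - (⇑(mollify k.2 f) - ⇑(f : Fun n))) s
          volume := by
        rw [sub_sub_sub_cancel_right]; rfl
    _ ≤ _ := eLpNorm_sub_le (hm _) (hm _) hs.1.le

theorem inv_sum_inv_ne_zero {s : Fin m → ℝ≥0∞} (hs : ∀ i, s i ∈ Ioo (1 : ℝ≥0∞) ∞) :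
    (∑ i, (s i)⁻¹)⁻¹ ≠ 0 :=
  ENNReal.inv_ne_zero.2 (ENNReal.sum_ne_top.2 fun i _ =>
    ENNReal.inv_ne_top.2 (zero_lt_one.trans (hs i).1).ne')

/-- `T` satisfies strong type estimates on test functions, in the full Banach range of exponents. -/
def HasStrongBounds (T : MultilinearMap ℂ (fun _ : Fin m => Test n) (Fun n)) : Prop :=
  ∀ s : Fin m → ℝ≥0∞, (∀ i, s i ∈ Ioo (1 : ℝ≥0∞) ∞) → ∃ C : ℝ≥0, ∀ f : Fin m → Test n,
    eLpNorm (T f) (∑ i, (s i)⁻¹)⁻¹ volume ≤ C * ∏ i, eLpNorm (f i) (s i) volume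

variable [NeZero n] {T : MultilinearMap ℂ (fun _ : Fin m => Test n) (Fun n)}

theorem mollify_update (f : Fin m → LpSum n) (i : Fin m) (k : ℕ) (z : LpSum n) :
    (fun j => mollify k (Function.update f i z j)) =
      Function.update (fun j => mollify k (f j)) i (mollify k z) := by
  ext1 j
  exact Function.apply_update (fun _ => mollify k) f i z j

/-- On a product of Lebesgue spaces the sequence is Cauchy in the target space. Sums of such
sequences with different target exponents still converge in measure, which is why the limit is taken
in that sense. -/
theorem HasStrongBounds.exists_tendstoInMeasure (hT : HasStrongBounds T) (f : Fin m → LpSum n) :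
    ∃ g : Fun n, TendstoInMeasure volume (fun k => ⇑(T fun i => mollify k (f i))) atTop g := by
  induction f using LpSum_pi_induction with
  | base f s hs hf =>
    obtain ⟨C, hC⟩ := hT s hs
    obtain ⟨g, hg, hlim⟩ := exists_tendsto_eLpNorm_of_cauchy (inv_sum_inv_ne_zero hs)
      (fun k => (T fun i => mollify k (f i)).aestronglyMeasurable)
      (tendsto_eLpNorm_map_sub T (fun i v => eLpNorm v (s i) volume) (fun v _ => hC v)
        (l := atTop ×ˢ atTop) (v := fun k : ℕ × ℕ => fun i => mollify k.1 (f i))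
        (w := fun k i => mollify k.2 (f i)) (fun k i => (add_sub_cancel _ _).symm) (a := fun i => eLpNorm (f i : Fun n) (s i) volume)
        (fun i => (Lp.mem_Lp_iff_eLpNorm_lt_top.1 (hf i)).ne)
        (fun i => (tendsto_eLpNorm_mollify (hs i) _ (hf i)).comp tendsto_fst)
        (fun i => (tendsto_eLpNorm_mollify (hs i) _ (hf i)).comp tendsto_snd)
        (fun i => tendsto_eLpNorm_mollify_sub_mollify (hs i) _ (hf i)))
    refine ⟨AEEqFun.mk g hg, ?_⟩
    exact (tendstoInMeasure_of_tendsto_eLpNorm (inv_sum_inv_ne_zero hs)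
      (fun k => (T fun i => mollify k (f i)).aestronglyMeasurable) hg hlim).congr_right
      (AEEqFun.coeFn_mk g hg).symm
  | add f i x y hx hy =>
    obtain ⟨g, hg⟩ := hx
    obtain ⟨h, hh⟩ := hy
    refine ⟨g + h, ?_⟩
    simp_rw [mollify_update] at hg hh ⊢
    simp_rw [map_add, MultilinearMap.map_update_add]
    exact ((tendstoInMeasure_add hg hh).congr_right (AEEqFun.coeFn_add _ _).symm).congr_left
      fun k => (AEEqFun.coeFn_add _ _).symm

theorem tendstoInMeasure_unique {u : ℕ → E n → ℂ} {g h : Fun n}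
    (hg : TendstoInMeasure volume u atTop g) (hh : TendstoInMeasure volume u atTop h) : g = h :=
  AEEqFun.ext (tendstoInMeasure_ae_unique hg hh)

/-- The extension of an operator from test functions to Lebesgue spaces. -/
noncomputable def HasStrongBounds.extend (hT : HasStrongBounds T) :
    MultilinearMap ℂ (fun _ : Fin m => LpSum n) (Fun n) :=
  MultilinearMap.mk' (fun f => (hT.exists_tendstoInMeasure f).choose)
    (fun f i x y => by
      refine tendstoInMeasure_unique (hT.exists_tendstoInMeasure _).choose_spec ?_
      have hx := (hT.exists_tendstoInMeasure (Function.update f i x)).choose_spec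
      have hy := (hT.exists_tendstoInMeasure (Function.update f i y)).choose_spec
      refine ((tendstoInMeasure_add hx hy).congr_right (AEEqFun.coeFn_add _ _).symm).congr_left
        fun k => ?_
      rw [mollify_update, mollify_update, mollify_update, map_add, MultilinearMap.map_update_add]
      exact (AEEqFun.coeFn_add _ _).symm)
    (fun f i c x => by
      refine tendstoInMeasure_unique (hT.exists_tendstoInMeasure _).choose_spec ?_
      have hx := (hT.exists_tendstoInMeasure (Function.update f i x)).choose_spec
      refine ((tendstoInMeasure_const_smul hx c).congr_right
        (AEEqFun.coeFn_smul _ _).symm).congr_left fun k => ?_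
      rw [mollify_update, mollify_update, map_smul, MultilinearMap.map_update_smul]
      exact (AEEqFun.coeFn_smul _ _).symm)

theorem HasStrongBounds.tendstoInMeasure_extend (hT : HasStrongBounds T) (f : Fin m → LpSum n) :
    TendstoInMeasure volume (fun k => ⇑(T fun i => mollify k (f i))) atTop (hT.extend f) :=
  (hT.exists_tendstoInMeasure f).choose_spec

theorem HasStrongBounds.isExtension_extend (hT : HasStrongBounds T) :
    IsExtension T hT.extend := by
  refine ⟨fun f => ?_, fun s hs => ?_⟩
  · refine tendstoInMeasure_unique (hT.tendstoInMeasure_extend _) ?_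
    -- Test functions lie in every Lebesgue space, so any admissible exponents would do.
    have hs : ∀ _ : Fin m, (2 : ℝ≥0∞) ∈ Ioo (1 : ℝ≥0∞) ∞ := fun _ => ⟨by norm_num, by norm_num⟩
    obtain ⟨C, hC⟩ := hT _ hs
    refine tendstoInMeasure_of_tendsto_eLpNorm (inv_sum_inv_ne_zero hs)
      (fun k => AEEqFun.aestronglyMeasurable _) (AEEqFun.aestronglyMeasurable _) ?_
    refine tendsto_eLpNorm_map_sub T (fun i v => eLpNorm v 2 volume) (fun v _ => hC v)
      (w := fun _ => f) (fun k i => (add_sub_cancel _ _).symm)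
      (a := fun i => eLpNorm (f i) 2 volume)
      (fun i => ((f i).memLp 2).2.ne) (fun i => ?_) (fun i => tendsto_const_nhds) (fun i => ?_)
    · rw [← eLpNorm_ofTest]
      exact tendsto_eLpNorm_mollify (hs i) _ (ofTest_mem_Lp _ _)
    · refine (tendsto_eLpNorm_mollify_sub (hs i) _ (ofTest_mem_Lp (f i) _)).congr fun k => ?_
      refine eLpNorm_congr_ae ?_
      filter_upwards [coeFn_ofTest (f i)] with x hx
      rw [hx]
      rfl
  · obtain ⟨C, hC⟩ := hT s hs
    refine ⟨C, fun f hf => ?_⟩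
    have h1 := ENNReal.Tendsto.const_mul (a := (C : ℝ≥0∞))
      (ENNReal.tendsto_finsetProd_of_ne_top Finset.univ
        (fun i _ => tendsto_eLpNorm_mollify (hs i) _ (hf i))
        (fun i _ => (Lp.mem_Lp_iff_eLpNorm_lt_top.1 (hf i)).ne)) (.inr ENNReal.coe_ne_top)
    -- Lower semicontinuity of the norm under convergence in measure: eventually the approximants
    -- are bounded by any `B` above the limiting product.
    refine le_of_forall_gt_imp_ge_of_dense fun B hB => ?_
    refine eLpNorm_le_of_tendstoInMeasure ?_ (hT.tendstoInMeasure_extend f)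
      (fun k => AEEqFun.aestronglyMeasurable _)
    filter_upwards [h1.eventually (gt_mem_nhds hB)] with k hk
    exact (hC _).trans hk.le

/-- On Lebesgue spaces an extension is continuous and equals `T` on mollifications, so its value is
the limit in measure of `T` along them, whatever the extension. Additivity carries the equality to
sums. -/
theorem IsExtension.unique {S S' : MultilinearMap ℂ (fun _ : Fin m => LpSum n) (Fun n)}
    (hS : IsExtension T S) (hS' : IsExtension T S') : S = S' := by
  ext1 f
  induction f using LpSum_pi_induction with
  | base f s hs hf =>
    have key : ∀ {S : MultilinearMap ℂ (fun _ : Fin m => LpSum n) (Fun n)}, IsExtension T S →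
        TendstoInMeasure volume (fun k => ⇑(T fun i => mollify k (f i))) atTop (S f) := by
      intro S hS
      obtain ⟨C, hC⟩ := hS.2 s hs
      refine tendstoInMeasure_of_tendsto_eLpNorm (inv_sum_inv_ne_zero hs)
        (fun k => AEEqFun.aestronglyMeasurable _) (AEEqFun.aestronglyMeasurable _) ?_
      have hN : ∀ v : Fin m → LpSum n, (∀ i, eLpNorm (v i : Fun n) (s i) volume ≠ ∞) →
          eLpNorm (S v) (∑ i, (s i)⁻¹)⁻¹ volume ≤
            C * ∏ i, eLpNorm (v i : Fun n) (s i) volume := fun v hv =>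
        hC v fun i => Lp.mem_Lp_iff_eLpNorm_lt_top.2 (lt_top_iff_ne_top.2 (hv i))
      have h := tendsto_eLpNorm_map_sub (V := LpSum n) S
        (fun i v => eLpNorm (v : Fun n) (s i) volume) hN
        (l := atTop) (v := fun k i => ofTest (mollify k (f i))) (w := fun _ => f)
        (d := fun k i => ofTest (mollify k (f i)) - f i)
        (fun k i => Subtype.ext (add_sub_cancel (f i : Fun n) _).symm)
        (a := fun i => eLpNorm (f i : Fun n) (s i) volume)
        (fun i => (Lp.mem_Lp_iff_eLpNorm_lt_top.1 (hf i)).ne)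
        (fun i => by
          simp_rw [eLpNorm_ofTest]
          exact tendsto_eLpNorm_mollify (hs i) _ (hf i)) (fun i => tendsto_const_nhds)
        (fun i => by
          refine (tendsto_eLpNorm_mollify_sub (hs i) _ (hf i)).congr fun k => ?_
          refine (eLpNorm_congr_ae ?_).symm
          refine (AEEqFun.coeFn_sub (ofTest (mollify k (f i)) : Fun n) (f i : Fun n)).trans ?_
          filter_upwards [coeFn_ofTest (mollify k (f i))] with x hx
          rw [Pi.sub_apply, hx])
      simpa only [hS.1] using h
    exact tendstoInMeasure_unique (key hS) (key hS')
  | add f i x y hx hy => rw [S.map_update_add, S'.map_update_add, hx, hy]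

end Extension

/-! ### Hölder's inequality and the commutator. -/

section Commutator

variable {n m : ℕ}

theorem inv_sum_inv_ofReal {s : Fin m → ℝ} (hs : ∀ i, 0 < s i) {q : ℝ} (hq : 0 < q)
    (h : 1 / q = ∑ i, 1 / s i) :
    (∑ i, (ENNReal.ofReal (s i))⁻¹)⁻¹ = ENNReal.ofReal q := by
  rw [inv_eq_iff_eq_inv, ← ENNReal.ofReal_inv_of_pos hq, ← one_div, h,
    ENNReal.ofReal_sum_of_nonneg fun i _ => (one_div_pos.2 (hs i)).le]
  refine Finset.sum_congr rfl fun i _ => ?_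
  rw [one_div, ENNReal.ofReal_inv_of_pos (hs i)]

theorem holderTriple_ofReal {p q r : ℝ} (hp : 0 < p) (hq : 0 < q) (hr : 0 < r)
    (h : 1 / p + 1 / q = 1 / r) :
    ENNReal.HolderTriple (ENNReal.ofReal p) (ENNReal.ofReal q) (ENNReal.ofReal r) := by
  constructor
  rw [← ENNReal.ofReal_inv_of_pos hp, ← ENNReal.ofReal_inv_of_pos hq,
    ← ENNReal.ofReal_inv_of_pos hr, ← ENNReal.ofReal_add (inv_pos.2 hp).le (inv_pos.2 hq).le]
  simp only [one_div] at h
  rw [h]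

theorem eLpNorm_mul_le (f g : Fun n) (p q r : ℝ≥0∞) [ENNReal.HolderTriple p q r] :
    eLpNorm (f * g : Fun n) r volume ≤ eLpNorm f p volume * eLpNorm g q volume := by
  rw [eLpNorm_congr_ae (AEEqFun.coeFn_mul f g)]
  have h := eLpNorm_le_eLpNorm_mul_eLpNorm_of_nnnorm (p := p) (q := q) (r := r)
    f.aestronglyMeasurable g.aestronglyMeasurable (· * ·) 1
    (Eventually.of_forall fun x => by simp)
  rwa [ENNReal.coe_one, one_mul] at h

theorem mem_LpSum {s : ℝ≥0∞} (hs : s ∈ Ioo (1 : ℝ≥0∞) ∞) {f : Fun n} (hf : f ∈ Lp ℂ s volume) :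
    f ∈ LpSum n :=
  Submodule.mem_iSup_of_mem s (Submodule.mem_iSup_of_mem hs hf)

theorem mul_eq_sub_const_mul_add (b : Fun n) (c : ℂ) (f : Fun n) :
    b * f = (b - AEEqFun.const (E n) c) * f + c • f := by
  refine AEEqFun.ext ?_
  filter_upwards [AEEqFun.coeFn_mul b f, AEEqFun.coeFn_add ((b - AEEqFun.const (E n) c) * f) (c • f),
    AEEqFun.coeFn_mul (b - AEEqFun.const (E n) c) f, AEEqFun.coeFn_sub b (AEEqFun.const (E n) c),
    AEEqFun.coeFn_smul c f, AEEqFun.coeFn_const (μ := (volume : Measure (E n))) (E n) c]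
    with x h1 h2 h3 h4 h5 h6
  rw [h1, h2, Pi.add_apply, h3, h5, Pi.mul_apply, Pi.mul_apply, h4, Pi.sub_apply, h6,
    Pi.smul_apply, smul_eq_mul, Function.const_apply]
  ring

theorem MemDotLp.exists_const {b : Fun n} {r : ℝ≥0∞} (hb : MemDotLp b r) :
    ∃ c : ℂ, eLpNorm (b - AEEqFun.const (E n) c : Fun n) r volume < ∞ := by
  obtain ⟨c, hc⟩ := iInf_lt_iff.1 hb.2
  refine ⟨c, lt_of_eq_of_lt (eLpNorm_congr_ae ?_) hc⟩
  filter_upwards [AEEqFun.coeFn_sub b (AEEqFun.const (E n) c),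
    AEEqFun.coeFn_const (μ := (volume : Measure (E n))) (E n) c] with x h1 h2
  rw [h1, Pi.sub_apply, h2, Function.const_apply]

/-- Subtracting a constant from the symbol does not change the commutator. -/
theorem commutator_eq_of_sub_const (b : Fun n) (c : ℂ)
    (S : MultilinearMap ℂ (fun _ : Fin m => LpSum n) (Fun n)) (i : Fin m) (f : Fin m → LpSum n)
    (h : b * (f i : Fun n) ∈ LpSum n) (h0 : (b - AEEqFun.const (E n) c) * (f i : Fun n) ∈ LpSum n) :
    commutator b S i f h = commutator (b - AEEqFun.const (E n) c) S i f h0 := by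
  have h1 : (⟨b * (f i : Fun n), h⟩ : LpSum n) =
      ⟨(b - AEEqFun.const (E n) c) * (f i : Fun n), h0⟩ + c • f i :=
    Subtype.ext (mul_eq_sub_const_mul_add b c (f i))
  rw [commutator, commutator, h1, S.map_update_add, S.map_update_smul, Function.update_eq_self,
    mul_eq_sub_const_mul_add b c (S f)]
  abel

end Commutator

end MultilinearCZ

theorem proposition3p1 (n m : ℕ) (hn : 1 ≤ n) (hm : 2 ≤ m)
    (i₁ : Fin m) (hi₁ : (i₁ : ℕ) = 0)
    (q p r : ℝ) (pᵢ : Fin m → ℝ) (p₁' : ℝ)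
    (hq : 0 < q) (hqp : q < p) (hpᵢ : ∀ i, 1 < pᵢ i) (hp : 1 / p = ∑ i, 1 / pᵢ i)
    (hp₁' : 1 / pᵢ i₁ + 1 / p₁' = 1)
    (hr : 1 / r = 1 / q - 1 / p) (hr' : 1 / r < 1 / p₁')
    (b : MultilinearCZ.Fun n) (hb : MultilinearCZ.MemDotLp b (ENNReal.ofReal r))
    (T : MultilinearMap ℂ (fun _ : Fin m => MultilinearCZ.Test n) (MultilinearCZ.Fun n))
    (hT : MultilinearCZ.IsCZOperator T) :
    (∃! S : MultilinearMap ℂ (fun _ : Fin m => MultilinearCZ.LpSum n) (MultilinearCZ.Fun n),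
      MultilinearCZ.IsExtension T S) ∧
    ∀ S : MultilinearMap ℂ (fun _ : Fin m => MultilinearCZ.LpSum n) (MultilinearCZ.Fun n),
      MultilinearCZ.IsExtension T S →
      ∃ C : ℝ≥0, ∀ f : Fin m → MultilinearCZ.LpSum n,
        (∀ i, (f i : MultilinearCZ.Fun n) ∈ Lp ℂ (ENNReal.ofReal (pᵢ i)) volume) →
        ∃ h : b * (f i₁ : MultilinearCZ.Fun n) ∈ MultilinearCZ.LpSum n,
          eLpNorm (MultilinearCZ.commutator b S i₁ f h) (ENNReal.ofReal q) volume ≤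
            C * ∏ i, eLpNorm (f i : MultilinearCZ.Fun n) (ENNReal.ofReal (pᵢ i)) volume := by
  open MultilinearCZ in
  have : NeZero n := ⟨by omega⟩
  have hT' : HasStrongBounds T := fun s hs => hT.exists_strong_bound (by omega) hs
  refine ⟨⟨hT'.extend, hT'.isExtension_extend, fun S hS => hS.unique hT'.isExtension_extend⟩,
    fun S hS => ?_⟩
  -- exponents
  have hp0 : 0 < p := hq.trans hqp
  have hpi0 : ∀ i, 0 < pᵢ i := fun i => zero_lt_one.trans (hpᵢ i)
  have hr0 : 0 < r := by
    rw [← one_div_pos, hr, sub_pos]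
    exact one_div_lt_one_div_of_lt hq hqp
  -- Here `1 / r < 1 / p₁'` enters: the exponent `t` of `b₀ f₁` is larger than one, so `S` is
  -- bounded at that exponent.
  have hsum : 1 / r + 1 / pᵢ i₁ < 1 := by linarith
  have hsum0 : 0 < 1 / r + 1 / pᵢ i₁ := add_pos (one_div_pos.2 hr0) (one_div_pos.2 (hpi0 i₁))
  obtain ⟨t, ht1, ht⟩ : ∃ t : ℝ, 1 < t ∧ 1 / r + 1 / pᵢ i₁ = 1 / t :=
    ⟨(1 / r + 1 / pᵢ i₁)⁻¹, (one_lt_inv₀ hsum0).2 hsum, by rw [one_div _⁻¹, inv_inv]⟩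
  have ht0 : 0 < t := zero_lt_one.trans ht1
  have hIoo : ∀ x : ℝ, 1 < x → ENNReal.ofReal x ∈ Ioo (1 : ℝ≥0∞) ∞ := fun x hx =>
    ⟨by rwa [ENNReal.one_lt_ofReal], ENNReal.ofReal_lt_top⟩
  have hH1 := holderTriple_ofReal hr0 (hpi0 i₁) ht0 ht
  have hH2 := holderTriple_ofReal hr0 hp0 hq (by rw [hr]; ring)
  -- Exponents for the second term of the commutator. The reciprocals add up to `1 / q`, since `1 /
  -- t` exceeds `1 / p₁` by `1 / r = 1 / q - 1 / p`.
  set s : Fin m → ℝ := Function.update pᵢ i₁ t with hs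
  have hs1 : ∀ i, 1 < s i := by
    intro i
    rcases eq_or_ne i i₁ with rfl | hi
    · simpa [hs] using ht1
    · simpa [hs, hi] using hpᵢ i
  have hsq : 1 / q = ∑ i, 1 / s i := by
    rw [← Finset.add_sum_erase _ _ (Finset.mem_univ i₁)] at hp ⊢
    rw [Finset.sum_congr rfl fun i hi => show 1 / s i = 1 / pᵢ i by
      rw [hs, Function.update_of_ne (Finset.ne_of_mem_erase hi)], hs, Function.update_self, ← ht]
    linarith
  obtain ⟨c, hc⟩ := hb.exists_const
  set b₀ : Fun n := b - AEEqFun.const (E n) c with hb₀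
  set B := eLpNorm b₀ (ENNReal.ofReal r) volume with hB
  obtain ⟨C₁, hC₁⟩ := hS.2 _ fun i => hIoo _ (hpᵢ i)
  obtain ⟨C₂, hC₂⟩ := hS.2 _ fun i => hIoo _ (hs1 i)
  rw [inv_sum_inv_ofReal hpi0 hp0 hp] at hC₁
  rw [inv_sum_inv_ofReal (fun i => zero_lt_one.trans (hs1 i)) hq hsq] at hC₂
  -- `LpAddConst` accounts for `q < 1`, where the triangle inequality holds only up to a constant.
  have hconst : ENNReal.LpAddConst (ENNReal.ofReal q) * (B * C₁ + C₂ * B) ≠ ∞ :=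
    ENNReal.mul_ne_top (ENNReal.LpAddConst_lt_top _).ne (ENNReal.add_ne_top.2
      ⟨ENNReal.mul_ne_top hc.ne ENNReal.coe_ne_top, ENNReal.mul_ne_top ENNReal.coe_ne_top hc.ne⟩)
  refine ⟨(ENNReal.LpAddConst (ENNReal.ofReal q) * (B * C₁ + C₂ * B)).toNNReal, fun f hf => ?_⟩
  rw [ENNReal.coe_toNNReal hconst]
  have hu_norm : eLpNorm (b₀ * (f i₁ : Fun n) : Fun n) (ENNReal.ofReal t) volume ≤
      B * eLpNorm (f i₁ : Fun n) (ENNReal.ofReal (pᵢ i₁)) volume := eLpNorm_mul_le _ _ _ _ _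
  have hu : b₀ * (f i₁ : Fun n) ∈ Lp ℂ (ENNReal.ofReal t) volume :=
    Lp.mem_Lp_iff_eLpNorm_lt_top.2 (hu_norm.trans_lt
      (ENNReal.mul_lt_top hc (Lp.mem_Lp_iff_eLpNorm_lt_top.1 (hf i₁))))
  have hu' : b₀ * (f i₁ : Fun n) ∈ LpSum n := mem_LpSum (hIoo t ht1) hu
  -- `b f₁ = b₀ f₁ + c f₁` has summands in `L^t` and `L^{p₁}`; this is why the domain is the span of
  -- the Lebesgue spaces.
  have hmem : b * (f i₁ : Fun n) ∈ LpSum n := by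
    rw [mul_eq_sub_const_mul_add b c]
    exact add_mem hu' (Submodule.smul_mem _ c (f i₁).2)
  refine ⟨hmem, ?_⟩
  rw [commutator_eq_of_sub_const b c S i₁ f hmem hu', MultilinearCZ.commutator,
    eLpNorm_congr_ae (AEEqFun.coeFn_sub _ _)]
  set P := ∏ i, eLpNorm (f i : Fun n) (ENNReal.ofReal (pᵢ i)) volume with hP
  have h1 : eLpNorm (b₀ * S f : Fun n) (ENNReal.ofReal q) volume ≤ B * C₁ * P := by
    refine (eLpNorm_mul_le _ _ (ENNReal.ofReal r) (ENNReal.ofReal p) _).trans ?_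
    rw [mul_assoc]
    gcongr
    exact hC₁ f hf
  have h2 : eLpNorm (S (Function.update f i₁ ⟨b₀ * (f i₁ : Fun n), hu'⟩)) (ENNReal.ofReal q)
      volume ≤ C₂ * B * P := by
    refine (hC₂ _ fun i => ?_).trans ?_
    · rcases eq_or_ne i i₁ with rfl | hi
      · simpa [hs] using hu
      · simpa [hs, hi] using hf i
    · rw [mul_assoc, hP, ← Finset.mul_prod_erase _ _ (Finset.mem_univ i₁),
        ← Finset.mul_prod_erase _ _ (Finset.mem_univ i₁), ← mul_assoc B]
      gcongr with i hi
      · simpa [hs] using hu_norm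
      · simp [hs, Function.update_of_ne (Finset.ne_of_mem_erase hi)]
  calc _ ≤ ENNReal.LpAddConst (ENNReal.ofReal q) * (B * C₁ * P + C₂ * B * P) := by
        refine (eLpNorm_sub_le' (AEEqFun.aestronglyMeasurable _)
          (AEEqFun.aestronglyMeasurable _) _).trans ?_
        gcongr
    _ = _ := by ring
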